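/- **Lemma 5.1 (spectrum of $L$).** Let $\gamma>0$, $Re>0$, $r\ge 0$, $F\ge 0$, $\beta,U\in\mathbb R$ and $\mathcal R=(0,2\pi/\gamma)\times(0,\pi)$. All functions on $\mathcal R$ below are $2\pi/\gamma$-periodic in $x$, Sobolev spaces being those of the periodic channel. Let $H$ be the space of pairs $u=(\psi,\theta)$ of $H^2$ functions with $\psi=\theta=0$ at $y=0,\pi$. Let $R_1$ and $R_2$ be the solution operators, with zero values at $y=0,\pi$, of $-\Delta u=v$ and of $-\Delta u+2Fu=v$ for $v\in L^2$. Let $L=-A+B$, where $$A(\psi,\theta)=\Big(r\psi-\tfrac1{Re}\Delta\psi,\; r\theta-2rFR_2\theta-\tfrac1{Re}(\Delta\theta+2F\theta-4F^2R_2\theta)\Big),$$ $$B(\psi,\theta)=\Big(R_1(\beta\psi_x+U\Delta\theta_x),\;R_2(2FU\psi_x+\beta\theta_x+U\Delta\psi_x)\Big),$$ regarded as an unbounded operator in $H$ whose domain $D(L)$ consists of the pairs of $H^4$ functions with $\psi=\theta=\Delta\psi=\Delta\theta=0$ at $y=0,\pi$. Its spectrum $\sigma(L)$ is the spectrum of its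 complexification. For integers $k\ge0$, $l\ge1$ put $\lambda_{k,l}=\gamma^2k^2+l^2$ and $$\eta_{k,l}=\tfrac1{Re}\lambda_{k,l}+r+i\frac{\gamma k\beta}{\lambda_{k,l}},\qquad \mu^\pm_{k,l}=\frac{-(F+\lambda_{k,l})\eta_{k,l}\pm\sqrt{F^2\eta_{k,l}^2+\gamma^2k^2U^2(4F^2-\lambda_{k,l}^2)}}{2F+\lambda_{k,l}}$$ (principal square root), $\alpha^\pm_{k,l}=\Re\mu^\pm_{k,l}$, $\sigma^\pm_{k,l}=\Im\mu^\pm_{k,l}$, and $$e^{(1)}_{k,l}=(\sin\gamma kx\,\sin ly,0),\quad e^{(2)}_{k,l}=(\cos\gamma kx\,\sin ly,0),\quad e^{(3)}_{k,l}=(0,\sin\gamma kx\,\sin ly),\quad e^{(4)}_{k,l}=(0,\cos\gamma kx\,\sin ly),$$ $$v^{1,\pm}_{k,l}=\gamma kU\,e^{(1)}_{k,l}+\Re(\mu^\pm_{k,l}+\eta_{k,l})\,e^{(4)}_{k,l}+\Im(\mu^\pm_{k,l}+\eta_{k,l})\,e^{(3)}_{k,l},$$ $$v^{2,\pm}_{k,l}=\gamma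 kU\,e^{(2)}_{k,l}+\Im(\mu^\pm_{k,l}+\eta_{k,l})\,e^{(4)}_{k,l}-\Re(\mu^\pm_{k,l}+\eta_{k,l})\,e^{(3)}_{k,l},$$ and let $H_{k,l,\pm}$ be the real linear span of $v^{1,\pm}_{k,l}$ and $v^{2,\pm}_{k,l}$. Then: 1. The spectrum of $L$ consists exactly of the values $\mu^\pm_{k,l}$ and their complex conjugates: $\sigma(L)=\{\mu^\pm_{k,l},\overline{\mu^\pm_{k,l}}: k\ge0,\ l\ge1\}$. 2. For all $k\ge0$, $l\ge1$ the subspaces $H_{k,l,+}$ and $H_{k,l,-}$ are contained in $D(L)$ and invariant under $L$. They are linearly independent (that is, $H_{k,l,+}\cap H_{k,l,-}=\{0\}$) whenever $\beta\ne0$ or $\mu^+_{k,l}\ne\mu^-_{k,l}$. Each of them has dimension two if $k\ge1$ and $U\ne0$. 3. For all $k\ge0$, $l\ge1$ and both choices of the sign, $$Lv^{1,\pm}_{k,l}=\alpha^\pm_{k,l}v^{1,\pm}_{k,l}-\sigma^\pm_{k,l}v^{2,\pm}_{k,l},\qquad Lv^{2,\pm}_{k,l}=\alpha^\pm_{k,l}v^{2,\pm}_{k,l}+\sigma^\pm_{k,l}v^{1,\pm}_{k,l}.$$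 -/

import Mathlib

open MeasureTheory Set
open scoped ContDiff

noncomputable section

namespace QG

/-- The parameters of the two-layer model linearized around the shear flow: zonal wavenumber `γ`,
Reynolds number `Re`, friction coefficient `r`, Froude number `F`, planetary vorticity factor `β`,
shear velocity `U`. -/
structure Params where
  γ : ℝ
  Re : ℝ
  r : ℝ
  F : ℝ
  β : ℝ
  U : ℝ

/-- The rectangle `(0, 2π/γ) × (0, π)`. -/
def rect (γ : ℝ) : Set (ℝ × ℝ) := Ioo 0 (2 * Real.pi / γ) ×ˢ Ioo 0 Real.pi

/-- Complex `L²` on the rectangle (the complexification of the space of real `L²` functions). -/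
abbrev L2 (γ : ℝ) : Type := Lp ℂ 2 (volume.restrict (rect γ))

/-! ### Sobolev spaces of functions that are periodic in `x` -/

/-- Test functions on the periodic channel: smooth, `2π/γ`-periodic in `x`, and supported away from
the walls `y = 0` and `y = π`. -/
def IsTest (γ : ℝ) (φ : ℝ × ℝ → ℂ) : Prop :=
  ContDiff ℝ ∞ φ ∧ (∀ x y, φ (x + 2 * Real.pi / γ, y) = φ (x, y)) ∧
    ∃ a b, 0 < a ∧ b < Real.pi ∧ ∀ x y, y ∉ Icc a b → φ (x, y) = 0

/-- `v` is the weak derivative of `u` in direction `d` on the periodic channel. As the test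
functions are periodic and need not vanish at `x = 0`, this is the weak derivative of the
`2π/γ`-periodic extension of `u` to `ℝ × (0, π)`. -/
def HasWeakDeriv (γ : ℝ) (d : ℝ × ℝ) (u v : L2 γ) : Prop :=
  ∀ φ : ℝ × ℝ → ℂ, IsTest γ φ →
    ∫ p in rect γ, u p * fderiv ℝ φ p d = -∫ p in rect γ, v p * φ p

/-- The unit vector in the `x` direction. -/
def ex : ℝ × ℝ := (1, 0)

/-- The unit vector in the `y` direction. -/
def ey : ℝ × ℝ := (0, 1)

open Classical in
/-- The weak derivative in direction `d`, and `0` if there is none in `L²`. -/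
def wd (γ : ℝ) (d : ℝ × ℝ) (u : L2 γ) : L2 γ :=
  if h : ∃ v, HasWeakDeriv γ d u v then h.choose else 0

/-- Membership in the Sobolev space `Hⁿ` of the periodic channel. -/
def MemSob (γ : ℝ) : ℕ → L2 γ → Prop
  | 0, _ => True
  | n + 1, u => ∃ ux uy : L2 γ, HasWeakDeriv γ ex u ux ∧ HasWeakDeriv γ ey u uy ∧
      MemSob γ n ux ∧ MemSob γ n uy

/-- The squared `Hⁿ` norm: the sum of the squared `L²` norms of all iterated weak partial
derivatives of order at most `n`. -/
def sobNormSq (γ : ℝ) : ℕ → L2 γ → ℝ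
  | 0, u => ‖u‖ ^ 2
  | n + 1, u => ‖u‖ ^ 2 + sobNormSq γ n (wd γ ex u) + sobNormSq γ n (wd γ ey u)

/-- The Laplacian in the sense of weak derivatives. -/
def lap (γ : ℝ) (u : L2 γ) : L2 γ := wd γ ex (wd γ ex u) + wd γ ey (wd γ ey u)

/-- The boundary conditions: `u` has a continuous representative which is `2π/γ`-periodic in `x`
and vanishes on the walls `y = 0` and `y = π`. -/
def VanishesOnWalls (γ : ℝ) (u : L2 γ) : Prop :=
  ∃ g : ℝ × ℝ → ℂ, Continuous g ∧ u =ᵐ[volume.restrict (rect γ)] g ∧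
    (∀ x y, g (x + 2 * Real.pi / γ, y) = g (x, y)) ∧
    ∀ x, g (x, 0) = 0 ∧ g (x, Real.pi) = 0

/-! ### The operators -/

/-- `u` solves `-Δu + s u = v`, with `u` periodic in `x` and zero on the walls. -/
def SolvesDirichlet (γ s : ℝ) (v u : L2 γ) : Prop :=
  MemSob γ 2 u ∧ VanishesOnWalls γ u ∧ -lap γ u + s • u = v

open Classical in
/-- The solution operator of the Dirichlet problem `-Δu + s u = v`. -/
def solveDirichlet (γ s : ℝ) (v : L2 γ) : L2 γ :=
  if h : ∃ u, SolvesDirichlet γ s v u then h.choose else 0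

/-- `R₁`, the inverse of `-Δ`. -/
def R1 (P : Params) : L2 P.γ → L2 P.γ := solveDirichlet P.γ 0

/-- `R₂`, the inverse of `-Δ + 2F`. -/
def R2 (P : Params) : L2 P.γ → L2 P.γ := solveDirichlet P.γ (2 * P.F)

/-- The space `H` of pairs of `H²` functions that are periodic in `x` and zero on the walls. -/
def spaceH (γ : ℝ) : Set (L2 γ × L2 γ) :=
  {u | (MemSob γ 2 u.1 ∧ VanishesOnWalls γ u.1) ∧ MemSob γ 2 u.2 ∧ VanishesOnWalls γ u.2}

/-- The norm of `H`. -/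
def normH (γ : ℝ) (u : L2 γ × L2 γ) : ℝ := √(sobNormSq γ 2 u.1 + sobNormSq γ 2 u.2)

/-- The conditions on each component of an element of the domain of `L`: `H⁴`, periodic in `x`, and
both `ψ` and `Δψ` zero on the walls. -/
def MemDom (γ : ℝ) (ψ : L2 γ) : Prop :=
  MemSob γ 4 ψ ∧ VanishesOnWalls γ ψ ∧ VanishesOnWalls γ (lap γ ψ)

/-- The domain `D(L) = D(A)`. -/
def domL (γ : ℝ) : Set (L2 γ × L2 γ) := {u | MemDom γ u.1 ∧ MemDom γ u.2}

/-- The operator `A`. -/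
def opA (P : Params) (u : L2 P.γ × L2 P.γ) : L2 P.γ × L2 P.γ :=
  (P.r • u.1 - (1 / P.Re) • lap P.γ u.1,
   P.r • u.2 - (2 * P.r * P.F) • R2 P u.2
     - (1 / P.Re) • (lap P.γ u.2 + (2 * P.F) • u.2 - (4 * P.F ^ 2) • R2 P u.2))

/-- The operator `B`. Here `J(f, y) = ∂f/∂x` for the Jacobian
`J(f, g) = (∂f/∂x)(∂g/∂y) - (∂f/∂y)(∂g/∂x)`. -/
def opB (P : Params) (u : L2 P.γ × L2 P.γ) : L2 P.γ × L2 P.γ :=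
  (R1 P (P.β • wd P.γ ex u.1 + P.U • wd P.γ ex (lap P.γ u.2)),
   R2 P ((2 * P.F * P.U) • wd P.γ ex u.1 + P.β • wd P.γ ex u.2
     + P.U • wd P.γ ex (lap P.γ u.1)))

/-- The linearized operator `L = -A + B`, meaningful on `domL`. -/
def opL (P : Params) (u : L2 P.γ × L2 P.γ) : L2 P.γ × L2 P.γ := -opA P u + opB P u

/-- The resolvent set of `L`, as an unbounded operator in `H` with domain `domL`: `L - z` is a
bijection from its domain onto `H`, and its inverse is bounded in the norm of `H`. -/
def resolventL (P : Params) : Set ℂ :=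
  {z | BijOn (fun u => opL P u - z • u) (domL P.γ) (spaceH P.γ) ∧
    ∃ C : ℝ, ∀ u ∈ domL P.γ, normH P.γ u ≤ C * normH P.γ (opL P u - z • u)}

/-- The spectrum of `L`. -/
def spectrumL (P : Params) : Set ℂ := (resolventL P)ᶜ

/-! ### The explicit eigenvalues and invariant subspaces -/

instance (γ : ℝ) : IsFiniteMeasure ((volume : Measure (ℝ × ℝ)).restrict (rect γ)) := by
  refine ⟨?_⟩
  rw [Measure.restrict_apply_univ, rect, Measure.volume_eq_prod, Measure.prod_prod]
  exact ENNReal.mul_lt_top (by simp) (by simp)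

theorem memLp_sin (γ : ℝ) (k l : ℕ) :
    MemLp (fun p : ℝ × ℝ => ((Real.sin (γ * k * p.1) * Real.sin (l * p.2) : ℝ) : ℂ)) 2
      (volume.restrict (rect γ)) := by
  refine MemLp.of_bound (Continuous.aestronglyMeasurable (by fun_prop)) 1 (ae_of_all _ fun p => ?_)
  rw [Complex.norm_real, norm_mul]
  exact mul_le_one₀ (Real.abs_sin_le_one _) (norm_nonneg _) (Real.abs_sin_le_one _)

theorem memLp_cos (γ : ℝ) (k l : ℕ) :
    MemLp (fun p : ℝ × ℝ => ((Real.cos (γ * k * p.1) * Real.sin (l * p.2) : ℝ) : ℂ)) 2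
      (volume.restrict (rect γ)) := by
  refine MemLp.of_bound (Continuous.aestronglyMeasurable (by fun_prop)) 1 (ae_of_all _ fun p => ?_)
  rw [Complex.norm_real, norm_mul]
  exact mul_le_one₀ (Real.abs_cos_le_one _) (norm_nonneg _) (Real.abs_sin_le_one _)

/-- `sin(γkx) sin(ly)`. -/
def sinMode (γ : ℝ) (k l : ℕ) : L2 γ := (memLp_sin γ k l).toLp _

/-- `cos(γkx) sin(ly)`. -/
def cosMode (γ : ℝ) (k l : ℕ) : L2 γ := (memLp_cos γ k l).toLp _

def e1 (γ : ℝ) (k l : ℕ) : L2 γ × L2 γ := (sinMode γ k l, 0)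
def e2 (γ : ℝ) (k l : ℕ) : L2 γ × L2 γ := (cosMode γ k l, 0)
def e3 (γ : ℝ) (k l : ℕ) : L2 γ × L2 γ := (0, sinMode γ k l)
def e4 (γ : ℝ) (k l : ℕ) : L2 γ × L2 γ := (0, cosMode γ k l)

/-- `λ_{k,l} = γ²k² + l²`. -/
def lam (P : Params) (k l : ℕ) : ℝ := P.γ ^ 2 * k ^ 2 + l ^ 2

/-- `η_{k,l} = λ_{k,l}/Re + r + i γkβ/λ_{k,l}`. -/
def eta (P : Params) (k l : ℕ) : ℂ :=
  ((1 / P.Re * lam P k l + P.r : ℝ) : ℂ) + Complex.I * ((P.γ * k * P.β / lam P k l : ℝ) : ℂ)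

/-- `μ^±_{k,l}`, where the sign is an element of `ℤˣ = {1, -1}` and the square root is the principal
one. -/
def mu (P : Params) (s : ℤˣ) (k l : ℕ) : ℂ :=
  (-((P.F : ℂ) + lam P k l) * eta P k l + ((s : ℤ) : ℂ) *
      Complex.sqrt ((P.F : ℂ) ^ 2 * eta P k l ^ 2 +
        (P.γ : ℂ) ^ 2 * (k : ℂ) ^ 2 * (P.U : ℂ) ^ 2 *
          (4 * (P.F : ℂ) ^ 2 - (lam P k l : ℂ) ^ 2))) /
    (2 * (P.F : ℂ) + lam P k l)

/-- `v^{1,±}_{k,l}`. -/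
def v1 (P : Params) (s : ℤˣ) (k l : ℕ) : L2 P.γ × L2 P.γ :=
  (P.γ * k * P.U) • e1 P.γ k l +
    ((mu P s k l + eta P k l).re • e4 P.γ k l + (mu P s k l + eta P k l).im • e3 P.γ k l)

/-- `v^{2,±}_{k,l}`. -/
def v2 (P : Params) (s : ℤˣ) (k l : ℕ) : L2 P.γ × L2 P.γ :=
  (P.γ * k * P.U) • e2 P.γ k l +
    ((mu P s k l + eta P k l).im • e4 P.γ k l - (mu P s k l + eta P k l).re • e3 P.γ k l)

/-- `H_{k,l,±}`, the real span of `v^{1,±}_{k,l}` and `v^{2,±}_{k,l}`. -/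
def Hkl (P : Params) (s : ℤˣ) (k l : ℕ) : Submodule ℝ (L2 P.γ × L2 P.γ) :=
  Submodule.span ℝ {v1 P s k l, v2 P s k l}

end QG

end

noncomputable section

namespace QG

/-! ### One-dimensional integrals and completeness -/

/-! The functions `exp(iγkx) sin(ly)`, with `k ∈ ℤ` and `l ≥ 1`, form after normalization a Hilbert
basis of complex `L²`, and each of them is an eigenfunction of `∂ₓ`, `Δ`, `R₁` and `R₂`. In this
basis `L` is therefore block diagonal, with one 2×2 matrix per mode, and the statement becomes
linear algebra in each block once the function spaces are expressed by Fourier coefficients.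

That translation is the analytic part. With `λ` the eigenvalue of `-Δ` on a mode, a component lies
in `H` iff `∑ λ² |a|²` converges (`inH_iff`) and satisfies the domain condition iff `∑ λ⁴ |a|²`
converges (`memDom_iff`). From coefficients to functions, the series is differentiated termwise, and
it converges uniformly because `∑ λ⁻²` is finite, so it vanishes on the walls. Conversely, weak
derivatives are tested only against functions vanishing near the walls, whereas coefficients are
integrals against modes. A cutoff joins the two, and its boundary terms tend to zero thanks to the
Dirichlet condition (`coef_eyy`).

If `z` is a root of no characteristic determinant, the blocks of `L - z` are invertible with
inverses of size `O(1/λ)` uniformly in the mode: for large `λ` the dissipative diagonal, of order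
`λ`, dominates the off-diagonal entries, of order `√λ`, and only finitely many modes remain
(`resolvent_bound`). Hence the inverse maps `H` boundedly into `H` with values in the domain. If
some determinant vanishes, a kernel vector of that block destroys injectivity. At wavenumber `-k`
the determinant factors as `(z - μ⁺)(z - μ⁻)` (`charDet_neg_natCast`), and the blocks at `k` and
`-k` are complex conjugates, which gives the spectrum.

Up to a real constant, `v¹` and `v²` are the real and imaginary parts of the eigenvector for `μ` at
wavenumber `-k` (`v1_eq`, `v2_eq`). The action of `L` follows, and dimension and independence are
read off the coefficients at `-k`. -/

/-- Parseval on an interval: all Fourier coefficients vanish, so the `L²` norm does. -/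
theorem ae_eq_zero_of_integral_exp {a b : ℝ} (hab : a < b) {f : ℝ → ℂ}
    (hf : MemLp f 2 (volume.restrict (Ioc a b)))
    (h : ∀ k : ℤ, ∫ x in Ioc a b,
      f x * Complex.exp (Complex.I * ((2 * Real.pi / (b - a) * k * x : ℝ) : ℂ)) = 0) :
    f =ᵐ[volume.restrict (Ioc a b)] 0 := by
  have hs := hasSum_sq_fourierCoeffOn hab hf
  have h0 : ∀ n : ℤ, fourierCoeffOn hab f n = 0 := by
    intro n
    rw [fourierCoeffOn_eq_integral, intervalIntegral.integral_of_le hab.le]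
    have : ∫ x in Ioc a b, fourier (-n) (x : AddCircle (b - a)) • f x = 0 := by
      rw [← h (-n)]
      refine integral_congr_ae (ae_of_all _ fun x => ?_)
      simp only [fourier_coe_apply, smul_eq_mul]
      rw [mul_comm]
      congr 2
      push_cast
      ring
    rw [this, smul_zero]
  simp only [h0, norm_zero, ne_eq, OfNat.ofNat_ne_zero, not_false_eq_true, zero_pow] at hs
  have h1 := hs.unique hasSum_zero
  have hne : (b - a)⁻¹ ≠ 0 := inv_ne_zero (sub_pos.2 hab).ne'
  rw [smul_eq_mul, mul_eq_zero, or_iff_right hne, intervalIntegral.integral_of_le hab.le,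
    integral_eq_zero_iff_of_nonneg (fun x => by positivity) hf.integrable_norm_pow'] at h1
  filter_upwards [h1] with x hx
  simpa using hx

/-- The odd extension to `(-π, π]` has no cosine part, and its sine part is given by the hypothesis,
so completeness of the exponentials applies. -/
theorem ae_eq_zero_of_integral_sin {f : ℝ → ℂ} (hf : MemLp f 2 (volume.restrict (Ioc 0 Real.pi)))
    (h : ∀ l : ℕ, ∫ y in Ioc 0 Real.pi, f y * (Real.sin ((l + 1 : ℝ) * y) : ℂ) = 0) :
    f =ᵐ[volume.restrict (Ioc 0 Real.pi)] 0 := by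
  have hpi := Real.pi_pos
  set g : ℝ → ℂ := (Ioc 0 Real.pi).indicator f with hg
  have hgL : MemLp g 2 volume := (memLp_indicator_iff_restrict measurableSet_Ioc).2 hf
  have hgL' : MemLp (fun y => g (-y)) 2 volume :=
    hgL.comp_measurePreserving (Measure.measurePreserving_neg volume)
  set F : ℝ → ℂ := fun y => g y - g (-y) with hF
  have hFL : MemLp F 2 volume := hgL.sub hgL'
  have hgI : ∀ w : ℝ → ℂ, Continuous w → (∀ y, ‖w y‖ ≤ 1) → Integrable (fun y => g y * w y) := by
    intro w hw hb
    have h1 : Integrable f (volume.restrict (Ioc 0 Real.pi)) := hf.integrable (by norm_num)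
    have h2 : Integrable g volume := (integrable_indicator_iff measurableSet_Ioc).2 h1
    exact h2.mul_bdd hw.aestronglyMeasurable (ae_of_all _ hb)
  have hsin : ∀ m : ℤ, ∫ y, g y * (Real.sin (m * y) : ℂ) = 0 := by
    have hnat : ∀ l : ℕ, ∫ y, g y * (Real.sin (l * y) : ℂ) = 0 := by
      intro l
      cases l with
      | zero => simp
      | succ l =>
        rw [← h l, ← integral_indicator measurableSet_Ioc]
        congr 1
        ext y
        by_cases hy : y ∈ Ioc 0 Real.pi <;> simp [hg, hy]
    intro m
    rcases Int.eq_nat_or_neg m with ⟨l, rfl | rfl⟩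
    · exact_mod_cast hnat l
    · have : ∀ y : ℝ, g y * (Real.sin (((-(l : ℤ) : ℤ) : ℝ) * y) : ℂ)
          = -(g y * (Real.sin (l * y) : ℂ)) := by
        intro y
        rw [show ((-(l : ℤ) : ℤ) : ℝ) * y = -(l * y) by push_cast; ring, Real.sin_neg]
        push_cast; ring
      simp_rw [this]
      rw [integral_neg, hnat, neg_zero]
  have hz : F =ᵐ[volume.restrict (Ioc (-Real.pi) Real.pi)] 0 := by
    refine ae_eq_zero_of_integral_exp (by linarith) (hFL.restrict _) fun k => ?_
    have e1 : ∀ y : ℝ, Complex.exp (Complex.I *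
        ((2 * Real.pi / (Real.pi - -Real.pi) * k * y : ℝ) : ℂ)) =
        (Real.cos (k * y) : ℂ) + (Real.sin (k * y) : ℂ) * Complex.I := by
      intro y
      rw [show 2 * Real.pi / (Real.pi - -Real.pi) * k * y = k * y by field_simp; ring, mul_comm,
        Complex.exp_mul_I]
      push_cast; rfl
    set w : ℝ → ℂ := fun y => (Real.cos (k * y) : ℂ) + (Real.sin (k * y) : ℂ) * Complex.I with hw
    have hwc : Continuous w := by fun_prop
    have hwb : ∀ y, ‖w y‖ ≤ 1 := by
      intro y
      rw [hw]; simp only [Complex.ofReal_cos, Complex.ofReal_sin]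
      rw [← Complex.exp_mul_I, Complex.norm_exp_ofReal_mul_I]
    have e2 : ∫ y in Ioc (-Real.pi) Real.pi, F y * Complex.exp (Complex.I *
        ((2 * Real.pi / (Real.pi - -Real.pi) * k * y : ℝ) : ℂ)) = ∫ y, F y * w y := by
      simp_rw [e1]
      rw [← integral_indicator measurableSet_Ioc]
      -- The reflected function may be nonzero at `-π`, which the half-open interval omits; the
      -- point has measure zero.
      have hpt : ∀ᵐ y : ℝ, y ≠ -Real.pi := by simp [ae_iff, measure_singleton]
      refine integral_congr_ae (hpt.mono fun y hne => ?_)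
      by_cases hy : y ∈ Ioc (-Real.pi) Real.pi
      · simp [hy, hw]
      · have h1 : y ∉ Ioc 0 Real.pi := fun h => hy ⟨by linarith [h.1], h.2⟩
        have h2 : -y ∉ Ioc 0 Real.pi := by
          rintro ⟨h, h'⟩
          rcases lt_or_eq_of_le (show -Real.pi ≤ y by linarith) with h3 | h3
          · exact hy ⟨h3, by linarith⟩
          · exact hne h3.symm
        simp [hy, hF, hg, h1, h2]
    rw [e2]
    -- The reflection is moved from `g` to `w` by `y ↦ -y`, so that only the odd part of the
    -- exponential meets `g`.
    have e3 : ∀ y, F y * w y = g y * w y - (fun y => g y * w (-y)) (-y) := by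
      intro y; simp [hF]; ring
    have hI1 := hgI w hwc hwb
    have hI2 := hgI (fun y => w (-y)) (by fun_prop) (fun y => hwb _)
    simp_rw [e3]
    rw [integral_sub hI1 (Integrable.comp_neg (f := fun y => g y * w (-y)) hI2), 
      integral_neg_eq_self (fun y => g y * w (-y)), ← integral_sub hI1 hI2]
    have e4 : ∀ y, g y * w y - g y * w (-y) =
        (2 * Complex.I) * (g y * (Real.sin (k * y) : ℂ)) := by
      intro y; simp [hw, mul_neg]; ring
    simp_rw [e4]
    rw [integral_const_mul, hsin, mul_zero]
  have hsub : Ioc 0 Real.pi ⊆ Ioc (-Real.pi) Real.pi := Ioc_subset_Ioc_left (by linarith)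
  filter_upwards [ae_restrict_of_ae_restrict_of_subset hsub hz, ae_restrict_mem measurableSet_Ioc]
    with y hy hm
  have h2 : -y ∉ Ioc 0 Real.pi := fun h => by linarith [h.1, hm.1]
  simpa [hF, hg, hm, h2] using hy

theorem integral_exp_period {γ : ℝ} (hγ : 0 < γ) (m : ℤ) :
    ∫ x in Ioo 0 (2 * Real.pi / γ), Complex.exp (Complex.I * ((γ * m * x : ℝ) : ℂ)) =
      if m = 0 then ((2 * Real.pi / γ : ℝ) : ℂ) else 0 := by
  have hT : 0 ≤ 2 * Real.pi / γ := by positivity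
  rw [← integral_Ioc_eq_integral_Ioo, ← intervalIntegral.integral_of_le hT]
  split_ifs with h
  · simp [h]
  · have hc : Complex.I * (γ * m : ℂ) ≠ 0 := by
      have := hγ.ne'
      simp [h, this]
    have e : ∀ x : ℝ, Complex.exp (Complex.I * ((γ * m * x : ℝ) : ℂ)) =
        Complex.exp ((Complex.I * (γ * m : ℂ)) * x) := by
      intro x; congr 1; push_cast; ring
    simp_rw [e]
    rw [integral_exp_mul_complex hc]
    have : Complex.exp (Complex.I * (γ * m : ℂ) * ((2 * Real.pi / γ : ℝ) : ℂ)) = 1 := by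
      rw [← Complex.exp_int_mul_two_pi_mul_I m]
      congr 1
      have : (γ : ℂ) ≠ 0 := by exact_mod_cast hγ.ne'
      push_cast; field_simp
    rw [this]; simp

/-- Product to sum: the sum frequency `l + m + 2` is never zero and its phase `jπ` only changes a
sign, so orthogonality holds for sines and cosines alike. -/
theorem integral_sin_mul_sin_phase (j l m : ℕ) :
    ∫ y in Ioo 0 Real.pi, Real.sin ((l + 1) * y + j * (Real.pi / 2)) *
      Real.sin ((m + 1) * y + j * (Real.pi / 2)) = if l = m then Real.pi / 2 else 0 := by
  rw [← integral_Ioc_eq_integral_Ioo, ← intervalIntegral.integral_of_le Real.pi_pos.le]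
  have key : ∀ (n : ℤ) (q : ℕ), n ≠ 0 → ∫ y in (0:ℝ)..Real.pi, Real.cos (n * y + q * Real.pi) = 0 := by
    intro n q hn
    have hn' : (n : ℝ) ≠ 0 := by exact_mod_cast hn
    rw [intervalIntegral.integral_comp_mul_add _ hn', integral_cos]
    rw [show (n : ℝ) * Real.pi + q * Real.pi = ((n + q : ℤ) : ℝ) * Real.pi by push_cast; ring,
      Real.sin_int_mul_pi]
    simp
  have e : ∀ y : ℝ, Real.sin ((l + 1) * y + j * (Real.pi / 2)) *
      Real.sin ((m + 1) * y + j * (Real.pi / 2)) =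
      (1 / 2) * Real.cos (((l - m : ℤ) : ℝ) * y + (0 : ℕ) * Real.pi) -
      (1 / 2) * Real.cos (((l + m + 2 : ℤ) : ℝ) * y + j * Real.pi) := by
    intro y
    rw [show ((l - m : ℤ) : ℝ) * y + (0 : ℕ) * Real.pi =
      ((l + 1) * y + j * (Real.pi / 2)) - ((m + 1) * y + j * (Real.pi / 2)) by push_cast; ring,
      show ((l + m + 2 : ℤ) : ℝ) * y + j * Real.pi =
      ((l + 1) * y + j * (Real.pi / 2)) + ((m + 1) * y + j * (Real.pi / 2)) by push_cast; ring,
      Real.cos_sub, Real.cos_add ((l + 1) * y + j * (Real.pi / 2))]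
    ring
  simp_rw [e]
  rw [intervalIntegral.integral_sub (Continuous.intervalIntegrable (by fun_prop) _ _)
    (Continuous.intervalIntegrable (by fun_prop) _ _), intervalIntegral.integral_const_mul,
    intervalIntegral.integral_const_mul, key (l + m + 2) j (by omega)]
  split_ifs with h
  · subst h; simp; ring
  · rw [key _ _ (by omega)]; simp

/-! ### Fourier modes -/

/-- The wavenumber in `x`. -/
def kx (γ : ℝ) (i : ℤ × ℕ) : ℝ := γ * i.1

/-- The wavenumber in `y`. -/
def ky (i : ℤ × ℕ) : ℝ := i.2 + 1

/-- The eigenvalue of `-Δ` on a mode. -/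
def eig (γ : ℝ) (i : ℤ × ℕ) : ℝ := kx γ i ^ 2 + ky i ^ 2

/-- The `x` factor of a mode. -/
def modeX (γ : ℝ) (i : ℤ × ℕ) (x : ℝ) : ℂ := Complex.exp (Complex.I * ((γ * i.1 * x : ℝ) : ℂ))

/-- The `y` factor of a mode, with phase `j π / 2`. -/
def modeY (j : ℕ) (i : ℤ × ℕ) (y : ℝ) : ℂ := (Real.sin ((i.2 + 1) * y + j * (Real.pi / 2)) : ℂ)

/-- The normalizing constant of the modes. -/
def modeN (γ : ℝ) : ℂ := ((√γ / Real.pi : ℝ) : ℂ)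

/-- The normalized mode `exp(i kx x) sin(ky y + j π / 2)`. -/
def mode (γ : ℝ) (j : ℕ) (i : ℤ × ℕ) (p : ℝ × ℝ) : ℂ :=
  modeN γ * (modeX γ i p.1 * modeY j i p.2)

theorem modeX_contDiff (γ : ℝ) (i : ℤ × ℕ) : ContDiff ℝ ∞ (modeX γ i) := by
  unfold modeX
  refine ContDiff.cexp (contDiff_const.mul (Complex.ofRealCLM.contDiff.comp ?_))
  exact contDiff_const.mul contDiff_id

theorem modeY_contDiff (j : ℕ) (i : ℤ × ℕ) : ContDiff ℝ ∞ (modeY j i) := by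
  unfold modeY
  refine Complex.ofRealCLM.contDiff.comp (Real.contDiff_sin.comp ?_)
  exact (contDiff_const.mul contDiff_id).add contDiff_const

theorem mode_contDiff (γ : ℝ) (j : ℕ) (i : ℤ × ℕ) : ContDiff ℝ ∞ (mode γ j i) :=
  contDiff_const.mul (((modeX_contDiff γ i).comp contDiff_fst).mul
    ((modeY_contDiff j i).comp contDiff_snd))

theorem mode_continuous (γ : ℝ) (j : ℕ) (i : ℤ × ℕ) : Continuous (mode γ j i) :=
  (mode_contDiff γ j i).continuous

theorem norm_modeX (γ : ℝ) (i : ℤ × ℕ) (x : ℝ) : ‖modeX γ i x‖ = 1 := by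
  rw [modeX, mul_comm, Complex.norm_exp_ofReal_mul_I]

theorem norm_modeY_le (j : ℕ) (i : ℤ × ℕ) (y : ℝ) : ‖modeY j i y‖ ≤ 1 := by
  rw [modeY, Complex.norm_real]
  exact Real.abs_sin_le_one _

theorem norm_mode_le (γ : ℝ) (j : ℕ) (i : ℤ × ℕ) (p : ℝ × ℝ) : ‖mode γ j i p‖ ≤ ‖modeN γ‖ := by
  rw [mode, norm_mul, norm_mul, norm_modeX, one_mul]
  exact mul_le_of_le_one_right (norm_nonneg _) (norm_modeY_le _ _ _)

theorem memLp_mode (γ : ℝ) (j : ℕ) (i : ℤ × ℕ) : MemLp (mode γ j i) 2 (volume.restrict (rect γ)) :=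
  MemLp.of_bound (mode_continuous γ j i).aestronglyMeasurable _ (ae_of_all _ (norm_mode_le γ j i))

/-- The modes as elements of `L²`. -/
def modeLp (γ : ℝ) (j : ℕ) (i : ℤ × ℕ) : L2 γ := (memLp_mode γ j i).toLp _

theorem coeFn_modeLp (γ : ℝ) (j : ℕ) (i : ℤ × ℕ) :
    modeLp γ j i =ᵐ[volume.restrict (rect γ)] mode γ j i := MemLp.coeFn_toLp _

theorem measurableSet_rect (γ : ℝ) : MeasurableSet (rect γ) :=
  measurableSet_Ioo.prod measurableSet_Ioo

theorem volume_restrict_rect (γ : ℝ) : (volume : Measure (ℝ × ℝ)).restrict (rect γ) =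
    ((volume : Measure ℝ).restrict (Ioo 0 (2 * Real.pi / γ))).prod
      ((volume : Measure ℝ).restrict (Ioo 0 Real.pi)) := by
  rw [rect, Measure.volume_eq_prod, Measure.prod_restrict]

theorem inner_modeLp (γ : ℝ) (j : ℕ) (i : ℤ × ℕ) (u : L2 γ) :
    inner ℂ (modeLp γ j i) u = ∫ p in rect γ, u p * (starRingEnd ℂ) (mode γ j i p) := by
  rw [L2.inner_def]
  refine integral_congr_ae ?_
  filter_upwards [coeFn_modeLp γ j i] with p hp
  rw [hp, RCLike.inner_apply]

theorem orthonormal_modeLp {γ : ℝ} (hγ : 0 < γ) (j : ℕ) : Orthonormal ℂ (modeLp γ j) := by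
  rw [orthonormal_iff_ite]
  intro i i'
  rw [inner_modeLp]
  have e : ∫ p in rect γ, modeLp γ j i' p * (starRingEnd ℂ) (mode γ j i p) =
      ∫ p in rect γ, (modeN γ * (starRingEnd ℂ (modeN γ)) *
        Complex.exp (Complex.I * ((γ * ((i'.1 - i.1 : ℤ) : ℝ) * p.1 : ℝ) : ℂ))) *
        ((Real.sin ((i'.2 + 1) * p.2 + j * (Real.pi / 2)) *
          Real.sin ((i.2 + 1) * p.2 + j * (Real.pi / 2)) : ℝ) : ℂ) := by
    refine integral_congr_ae ?_
    filter_upwards [coeFn_modeLp γ j i'] with p hp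
    rw [hp]
    simp only [mode, modeX, modeY, map_mul, Complex.conj_ofReal, ← Complex.exp_conj, Complex.conj_I]
    have : Complex.exp (Complex.I * ((γ * ((i'.1 - i.1 : ℤ) : ℝ) * p.1 : ℝ) : ℂ)) =
        Complex.exp (Complex.I * ((γ * i'.1 * p.1 : ℝ) : ℂ)) *
        Complex.exp (-Complex.I * ((γ * i.1 * p.1 : ℝ) : ℂ)) := by
      rw [← Complex.exp_add]; congr 1; push_cast; ring
    rw [this]; push_cast; ring
  rw [e, rect, Measure.volume_eq_prod]
  rw [setIntegral_prod_mul (fun x : ℝ => modeN γ * (starRingEnd ℂ (modeN γ)) *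
        Complex.exp (Complex.I * ((γ * ((i'.1 - i.1 : ℤ) : ℝ) * x : ℝ) : ℂ)))
    (fun y : ℝ => ((Real.sin ((i'.2 + 1) * y + j * (Real.pi / 2)) *
          Real.sin ((i.2 + 1) * y + j * (Real.pi / 2)) : ℝ) : ℂ)), integral_const_mul,
    integral_exp_period hγ, integral_complex_ofReal, integral_sin_mul_sin_phase]
  by_cases h1 : i = i'
  · subst h1
    simp only [sub_self, if_true, modeN, Complex.conj_ofReal]
    norm_cast
    have := Real.mul_self_sqrt hγ.le
    have hpi := Real.pi_pos
    field_simp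
    nlinarith
  · rw [if_neg h1]
    by_cases h2 : i'.1 - i.1 = 0
    · rw [if_neg (c := i'.2 = i.2)]
      · simp
      · intro h3; exact h1 (Prod.ext (by omega) h3.symm)
    · simp [h2]

/-- Cauchy–Schwarz against the constant, in the form that the variance of `‖f‖` is nonnegative. -/
theorem sq_integral_norm_le {f : ℝ → ℂ} (hf : MemLp f 2 (volume.restrict (Ioo 0 Real.pi))) :
    (∫ y in Ioo 0 Real.pi, ‖f y‖) ^ 2 ≤ Real.pi * ∫ y in Ioo 0 Real.pi, ‖f y‖ ^ 2 := by
  have hpi := Real.pi_pos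
  set c := ∫ y in Ioo 0 Real.pi, ‖f y‖ with hc
  have h1 : Integrable (fun y => ‖f y‖) (volume.restrict (Ioo 0 Real.pi)) :=
    (hf.integrable (by norm_num)).norm
  have h2 : Integrable (fun y => ‖f y‖ ^ 2) (volume.restrict (Ioo 0 Real.pi)) :=
    hf.integrable_norm_pow'
  have h3 : 0 ≤ ∫ y in Ioo 0 Real.pi, (‖f y‖ - c / Real.pi) ^ 2 :=
    integral_nonneg fun y => sq_nonneg _
  have e : ∀ y, (‖f y‖ - c / Real.pi) ^ 2 =
      ‖f y‖ ^ 2 - (2 * (c / Real.pi)) * ‖f y‖ + (c / Real.pi) ^ 2 := fun y => by ring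
  simp_rw [e] at h3
  rw [integral_add (f := fun y => ‖f y‖ ^ 2 - (2 * (c / Real.pi)) * ‖f y‖)
    (h2.sub (h1.const_mul _)) (integrable_const _), integral_sub h2 (h1.const_mul _), integral_const_mul, ← hc] at h3
  simp only [integral_const, MeasurableSet.univ, measureReal_restrict_apply, univ_inter,
    Real.volume_real_Ioo, sub_zero, smul_eq_mul, max_eq_left hpi.le] at h3
  have h4 : Real.pi * (2 * (c / Real.pi) * c) = 2 * c ^ 2 := by field_simp
  have h5 : Real.pi * (Real.pi * (c / Real.pi) ^ 2) = c ^ 2 := by field_simp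
  nlinarith [mul_nonneg hpi.le h3]

/-- By Fubini, each sine coefficient in `y` is a function of `x`. Its exponential coefficients all
vanish, so it is zero for almost every `x`; completeness of the sines then kills almost every slice.
-/
theorem eq_zero_of_inner_modeLp {γ : ℝ} (hγ : 0 < γ) {u : L2 γ}
    (h : ∀ i, inner ℂ (modeLp γ 0 i) u = (0 : ℂ)) : u = 0 := by
  have hpi := Real.pi_pos
  have hT : 0 < 2 * Real.pi / γ := by positivity
  set μ := (volume : Measure ℝ).restrict (Ioo 0 (2 * Real.pi / γ)) with hμ
  set ν := (volume : Measure ℝ).restrict (Ioo 0 Real.pi) with hν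
  have key : ∀ f : ℝ × ℝ → ℂ, ∫ p in rect γ, f p = ∫ p, f p ∂(μ.prod ν) := fun f => by
    rw [volume_restrict_rect]
  have hu : MemLp u 2 (μ.prod ν) := by rw [← volume_restrict_rect]; exact Lp.memLp u
  have hu1 : Integrable u (μ.prod ν) := hu.integrable (by norm_num)
  have hu2 : Integrable (fun p => ‖u p‖ ^ 2) (μ.prod ν) := hu.integrable_norm_pow'
  have hslice : ∀ᵐ x ∂μ, MemLp (fun y => u (x, y)) 2 ν := by
    filter_upwards [hu.1.prodMk_left, hu2.prod_right_ae] with x h1 h2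
    exact (memLp_two_iff_integrable_sq_norm h1).2 h2
  have hus : ∀ l : ℕ, Integrable (fun p => u p * (Real.sin ((l + 1) * p.2) : ℂ)) (μ.prod ν) := by
    intro l
    refine hu1.mul_bdd (c := 1) (Continuous.aestronglyMeasurable (by fun_prop)) (ae_of_all _ fun p => ?_)
    rw [Complex.norm_real]; exact Real.abs_sin_le_one _
  have hgl : ∀ l : ℕ, ∀ᵐ x ∂μ, ∫ y, u (x, y) * (Real.sin ((l + 1) * y) : ℂ) ∂ν = 0 := by
    intro l
    have hm : AEStronglyMeasurable (fun x => ∫ y, u (x, y) * (Real.sin ((l + 1) * y) : ℂ) ∂ν) μ :=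
      (hus l).1.integral_prod_right'
    have hL : MemLp (fun x => ∫ y, u (x, y) * (Real.sin ((l + 1) * y) : ℂ) ∂ν) 2 μ := by
      rw [memLp_two_iff_integrable_sq_norm hm]
      refine (hu2.integral_prod_left.const_mul Real.pi).mono' (hm.norm.pow 2) ?_
      filter_upwards [hslice] with x hx
      rw [Real.norm_of_nonneg (by positivity)]
      refine le_trans ?_ (sq_integral_norm_le hx)
      refine pow_le_pow_left₀ (norm_nonneg _) ((norm_integral_le_integral_norm _).trans ?_) 2
      refine integral_mono_of_nonneg (ae_of_all _ fun y => norm_nonneg _)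
        (hx.integrable (by norm_num)).norm (ae_of_all _ fun y => ?_)
      simp only [norm_mul, Complex.norm_real]
      exact mul_le_of_le_one_right (norm_nonneg _) (Real.abs_sin_le_one _)
    rw [hμ, restrict_Ioo_eq_restrict_Ioc] at hL ⊢
    refine ae_eq_zero_of_integral_exp hT hL fun k => ?_
    -- The inner product conjugates the mode, hence the opposite wavenumber.
    have hk := h (-k, l)
    rw [inner_modeLp, key, integral_prod] at hk
    · have e : ∀ x y, u (x, y) * (starRingEnd ℂ) (mode γ 0 (-k, l) (x, y)) =
          starRingEnd ℂ (modeN γ) * (Complex.exp (Complex.I * ((γ * k * x : ℝ) : ℂ)) *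
            (u (x, y) * (Real.sin ((l + 1) * y) : ℂ))) := by
        intro x y
        simp only [mode, modeX, modeY, map_mul, Complex.conj_ofReal, ← Complex.exp_conj,
          Complex.conj_I, CharP.cast_eq_zero, zero_mul, add_zero]
        rw [show -Complex.I * ((γ * ((-k : ℤ) : ℝ) * x : ℝ) : ℂ) =
          Complex.I * ((γ * k * x : ℝ) : ℂ) by push_cast; ring]
        ring
      simp_rw [e] at hk
      simp_rw [integral_const_mul] at hk
      rw [mul_eq_zero] at hk
      rcases hk with hk | hk
      · exfalso
        simp only [modeN, Complex.conj_ofReal, Complex.ofReal_eq_zero] at hk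
        have : 0 < √γ / Real.pi := by positivity
        linarith
      · rw [hμ, restrict_Ioo_eq_restrict_Ioc] at hk
        rw [← hk]
        refine integral_congr_ae (ae_of_all _ fun x => ?_)
        simp only
        rw [mul_comm]
        congr 3
        congr 1
        field_simp
        ring
    · refine hu1.mul_bdd (c := ‖modeN γ‖) ?_ (ae_of_all _ fun p => ?_)
      · exact (Complex.continuous_conj.comp (mode_continuous _ _ _)).aestronglyMeasurable
      · rw [RCLike.norm_conj]; exact norm_mode_le _ _ _ _
  have hz : ∀ᵐ x ∂μ, ∀ᵐ y ∂ν, u (x, y) = 0 := by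
    filter_upwards [hslice, ae_all_iff.2 hgl] with x hx hx'
    rw [hν, restrict_Ioo_eq_restrict_Ioc] at hx hx' ⊢
    exact ae_eq_zero_of_integral_sin hx hx'
  have hz' : ∀ᵐ p ∂(μ.prod ν), u p = 0 :=
    (Measure.ae_prod_iff_ae_ae ((Lp.stronglyMeasurable u).measurable (measurableSet_singleton 0))).2 hz
  rw [← volume_restrict_rect] at hz'
  exact (Lp.eq_zero_iff_ae_eq_zero).2 hz'

/-- The modes with zero phase as a Hilbert basis. -/
def basis {γ : ℝ} (hγ : 0 < γ) : HilbertBasis (ℤ × ℕ) ℂ (L2 γ) :=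
  HilbertBasis.mkOfOrthogonalEqBot (orthonormal_modeLp hγ 0) (by
    rw [Submodule.eq_bot_iff]
    intro u hu
    refine eq_zero_of_inner_modeLp hγ fun i => ?_
    exact (Submodule.mem_orthogonal _ _).1 hu _ (Submodule.subset_span ⟨i, rfl⟩))

theorem coe_basis {γ : ℝ} (hγ : 0 < γ) : ⇑(basis hγ) = modeLp γ 0 :=
  HilbertBasis.coe_mkOfOrthogonalEqBot _ _

/-! ### Fourier coefficients and trigonometric series in `L²`. -/

/-- The Fourier coefficients. -/
def coef (γ : ℝ) (u : L2 γ) (i : ℤ × ℕ) : ℂ := inner ℂ (modeLp γ 0 i) u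

section coef

variable {γ : ℝ} (u v : L2 γ) (i : ℤ × ℕ)

theorem coef_eq_integral : coef γ u i = ∫ p in rect γ, u p * (starRingEnd ℂ) (mode γ 0 i p) :=
  inner_modeLp _ _ _ _

@[simp] theorem coef_add : coef γ (u + v) i = coef γ u i + coef γ v i := inner_add_right _ _ _
@[simp] theorem coef_sub : coef γ (u - v) i = coef γ u i - coef γ v i := inner_sub_right _ _ _
@[simp] theorem coef_neg : coef γ (-u) i = -coef γ u i := inner_neg_right _ _
@[simp] theorem coef_zero : coef γ 0 i = 0 := inner_zero_right _
@[simp] theorem coef_smul (c : ℂ) : coef γ (c • u) i = c * coef γ u i := inner_smul_right _ _ _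
@[simp] theorem coef_real_smul (c : ℝ) : coef γ (c • u) i = c * coef γ u i :=
  inner_smul_right_eq_smul _ _ _

end coef

theorem coef_ext {γ : ℝ} (hγ : 0 < γ) {u v : L2 γ} (h : ∀ i, coef γ u i = coef γ v i) : u = v :=
  sub_eq_zero.1 (eq_zero_of_inner_modeLp hγ fun i => by
    change coef γ (u - v) i = 0
    rw [coef_sub, h, sub_self])

theorem coef_modeLp {γ : ℝ} (hγ : 0 < γ) (i i' : ℤ × ℕ) :
    coef γ (modeLp γ 0 i') i = if i = i' then 1 else 0 :=
  (orthonormal_iff_ite.1 (orthonormal_modeLp hγ 0)) i i'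

theorem hasSum_norm_sq_coef {γ : ℝ} (hγ : 0 < γ) (u : L2 γ) :
    HasSum (fun i => ‖coef γ u i‖ ^ 2) (‖u‖ ^ 2) := by
  have h := (basis hγ).hasSum_inner_mul_inner u u
  rw [inner_self_eq_norm_sq_to_K] at h
  have := Complex.hasSum_re h
  convert this using 1
  · ext i
    rw [← inner_conj_symm u, coe_basis, ← coef]
    rw [mul_comm, Complex.mul_conj, Complex.normSq_eq_norm_sq]
    norm_cast
  · norm_cast

/-- The trigonometric series with phase `j` and coefficients `a`. -/
def series (γ : ℝ) (j : ℕ) (a : ℤ × ℕ → ℂ) : L2 γ := ∑' i, a i • modeLp γ j i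

theorem hasSum_series {γ : ℝ} (hγ : 0 < γ) (j : ℕ) {a : ℤ × ℕ → ℂ}
    (ha : Summable fun i => ‖a i‖ ^ 2) :
    HasSum (fun i => a i • modeLp γ j i) (series γ j a) := by
  have h := (orthonormal_modeLp hγ j).orthogonalFamily.summable_iff_norm_sq_summable a
  exact (h.2 ha).hasSum

/-- This holds for every phase, since orthonormality suffices. Completeness, available for phase
zero, is not needed, so the norms of `y`-derivatives, which are cosine series, are covered. -/
theorem norm_series_sq {γ : ℝ} (hγ : 0 < γ) (j : ℕ) {a : ℤ × ℕ → ℂ}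
    (ha : Summable fun i => ‖a i‖ ^ 2) : ‖series γ j a‖ ^ 2 = ∑' i, ‖a i‖ ^ 2 := by
  have hm : Memℓp a 2 := memℓp_gen (by simpa using ha)
  have h := (orthonormal_modeLp hγ j).orthogonalFamily.linearIsometry.norm_map ⟨a, hm⟩
  have h2 := lp.norm_rpow_eq_tsum (p := 2) (by simp) (⟨a, hm⟩ : lp (fun _ : ℤ × ℕ => ℂ) 2)
  have h3 : ‖(⟨a, hm⟩ : lp (fun _ : ℤ × ℕ => ℂ) 2)‖ ^ 2 = ∑' i, ‖a i‖ ^ 2 := by simpa using h2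
  rw [← h3, ← h]
  rfl

theorem coef_series {γ : ℝ} (hγ : 0 < γ) {a : ℤ × ℕ → ℂ} (ha : Summable fun i => ‖a i‖ ^ 2)
    (i : ℤ × ℕ) : coef γ (series γ 0 a) i = a i := by
  have h := (hasSum_series hγ 0 ha).mapL (innerSL ℂ (modeLp γ 0 i))
  simp only [innerSL_apply_apply, inner_smul_right] at h
  have h2 : HasSum (fun i' => a i' * inner ℂ (modeLp γ 0 i) (modeLp γ 0 i')) (a i) := by
    convert hasSum_single (f := fun i' => a i' * inner ℂ (modeLp γ 0 i) (modeLp γ 0 i')) i ?_ using 1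
    · rw [← coef, coef_modeLp hγ]; simp
    · intro i' hi'
      rw [← coef, coef_modeLp hγ, if_neg hi'.symm, mul_zero]
  exact h.unique h2

theorem eq_series_coef {γ : ℝ} (hγ : 0 < γ) (u : L2 γ) : u = series γ 0 (coef γ u) :=
  coef_ext hγ fun i => (coef_series hγ (hasSum_norm_sq_coef hγ u).summable i).symm

/-! ### Weak derivatives of Fourier series -/

theorem exists_bound_rect (γ : ℝ) {w : ℝ × ℝ → ℂ} (hw : Continuous w) :
    ∃ C, 0 ≤ C ∧ ∀ p ∈ rect γ, ‖w p‖ ≤ C := by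
  have hK : IsCompact (Icc (0 : ℝ) (2 * Real.pi / γ) ×ˢ Icc (0 : ℝ) Real.pi) :=
    isCompact_Icc.prod isCompact_Icc
  obtain ⟨C, hC⟩ := hK.exists_bound_of_continuousOn hw.continuousOn
  exact ⟨max C 0, le_max_right _ _, fun p hp => (hC p
    ⟨Ioo_subset_Icc_self hp.1, Ioo_subset_Icc_self hp.2⟩).trans (le_max_left _ _)⟩

theorem memLp_of_continuous (γ : ℝ) {w : ℝ × ℝ → ℂ} (hw : Continuous w) :
    MemLp w 2 (volume.restrict (rect γ)) := by
  obtain ⟨C, -, hC⟩ := exists_bound_rect γ hw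
  exact MemLp.of_bound hw.aestronglyMeasurable C
    (ae_restrict_of_forall_mem (measurableSet_rect γ) hC)

/-- Makes the two sides of the definition of a weak derivative continuous linear functionals on
`L²`, so that the relation passes to sums and limits. -/
theorem exists_pairing (γ : ℝ) {w : ℝ × ℝ → ℂ} (hw : Continuous w) :
    ∃ Φ : L2 γ →L[ℂ] ℂ, ∀ u, Φ u = ∫ p in rect γ, u p * w p := by
  have hc : Continuous fun p => (starRingEnd ℂ) (w p) := Complex.continuous_conj.comp hw
  refine ⟨innerSL ℂ ((memLp_of_continuous γ hc).toLp _), fun u => ?_⟩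
  rw [innerSL_apply_apply, L2.inner_def]
  refine integral_congr_ae ?_
  filter_upwards [(memLp_of_continuous γ hc).coeFn_toLp] with p hp
  rw [hp, RCLike.inner_apply, Complex.conj_conj]

theorem IsTest.continuous_fderiv {γ : ℝ} {φ : ℝ × ℝ → ℂ} (hφ : IsTest γ φ) (d : ℝ × ℝ) :
    Continuous fun p => fderiv ℝ φ p d :=
  (hφ.1.continuous_fderiv (by simp)).clm_apply continuous_const

theorem HasWeakDeriv.add {γ : ℝ} {d : ℝ × ℝ} {u v u' v' : L2 γ} (h : HasWeakDeriv γ d u v)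
    (h' : HasWeakDeriv γ d u' v') : HasWeakDeriv γ d (u + u') (v + v') := by
  intro φ hφ
  obtain ⟨Φ, hΦ⟩ := exists_pairing γ (hφ.continuous_fderiv d)
  obtain ⟨Ψ, hΨ⟩ := exists_pairing γ hφ.1.continuous
  have h1 := h φ hφ
  have h2 := h' φ hφ
  rw [← hΦ, ← hΨ] at *
  rw [map_add, map_add, h1, h2, neg_add]

theorem HasWeakDeriv.hasSum {γ : ℝ} {d : ℝ × ℝ} {ι : Type*} {f g : ι → L2 γ} {u v : L2 γ}
    (h : ∀ i, HasWeakDeriv γ d (f i) (g i)) (hf : HasSum f u) (hg : HasSum g v) :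
    HasWeakDeriv γ d u v := by
  intro φ hφ
  obtain ⟨Φ, hΦ⟩ := exists_pairing γ (hφ.continuous_fderiv d)
  obtain ⟨Ψ, hΨ⟩ := exists_pairing γ hφ.1.continuous
  rw [← hΦ, ← hΨ]
  have h1 := hf.mapL Φ
  have h2 := (hg.mapL Ψ).neg
  have e : (fun i => Φ (f i)) = fun i => -Ψ (g i) := funext fun i => by rw [hΦ, hΨ, h i φ hφ]
  rw [e] at h1
  exact h1.unique h2

theorem HasWeakDeriv.smul {γ : ℝ} {d : ℝ × ℝ} {u v : L2 γ} (h : HasWeakDeriv γ d u v) (c : ℂ) :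
    HasWeakDeriv γ d (c • u) (c • v) := by
  intro φ hφ
  obtain ⟨Φ, hΦ⟩ := exists_pairing γ (hφ.continuous_fderiv d)
  obtain ⟨Ψ, hΨ⟩ := exists_pairing γ hφ.1.continuous
  have h1 := h φ hφ
  rw [← hΦ, ← hΨ] at *
  rw [map_smul, map_smul, h1, smul_neg]

theorem integrableOn_rect (γ : ℝ) {w : ℝ × ℝ → ℂ} (hw : Continuous w) :
    Integrable w (volume.restrict (rect γ)) :=
  (memLp_of_continuous γ hw).integrable (by norm_num)

theorem integral_fderiv_ex {γ : ℝ} (hγ : 0 < γ) {φ : ℝ × ℝ → ℂ} (hφ : IsTest γ φ) :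
    ∫ p in rect γ, fderiv ℝ φ p ex = 0 := by
  have hT : 0 ≤ 2 * Real.pi / γ := by positivity
  have hi := integrableOn_rect γ (hφ.continuous_fderiv ex)
  rw [volume_restrict_rect] at hi ⊢
  rw [integral_prod_symm _ hi]
  refine integral_eq_zero_of_ae (ae_of_all _ fun y => ?_)
  simp only [Pi.zero_apply]
  rw [restrict_Ioo_eq_restrict_Ioc, ← intervalIntegral.integral_of_le hT,
    intervalIntegral.integral_eq_sub_of_hasDerivAt (f := fun x => φ (x, y))]
  · have := hφ.2.1 0 y
    rw [zero_add] at this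
    rw [this, sub_self]
  · intro x _
    have h1 : HasFDerivAt φ (fderiv ℝ φ (x, y)) (x, y) :=
      (hφ.1.differentiable (by simp) _).hasFDerivAt
    exact h1.comp_hasDerivAt x ((hasDerivAt_id x).prodMk (hasDerivAt_const x y))
  · exact ((hφ.continuous_fderiv ex).comp (by fun_prop : Continuous fun x : ℝ => (x, y))).intervalIntegrable _ _

theorem integral_fderiv_ey {γ : ℝ} {φ : ℝ × ℝ → ℂ} (hφ : IsTest γ φ) :
    ∫ p in rect γ, fderiv ℝ φ p ey = 0 := by
  have hi := integrableOn_rect γ (hφ.continuous_fderiv ey)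
  rw [volume_restrict_rect] at hi ⊢
  rw [integral_prod _ hi]
  refine integral_eq_zero_of_ae (ae_of_all _ fun x => ?_)
  simp only [Pi.zero_apply]
  rw [restrict_Ioo_eq_restrict_Ioc, ← intervalIntegral.integral_of_le Real.pi_pos.le,
    intervalIntegral.integral_eq_sub_of_hasDerivAt (f := fun y => φ (x, y))]
  · obtain ⟨a, b, ha, hb, h⟩ := hφ.2.2
    rw [h x 0 (fun h => by linarith [h.1]), h x Real.pi (fun h => by linarith [h.2]), sub_self]
  · intro y _
    have h1 : HasFDerivAt φ (fderiv ℝ φ (x, y)) (x, y) :=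
      (hφ.1.differentiable (by simp) _).hasFDerivAt
    exact h1.comp_hasDerivAt y ((hasDerivAt_const y x).prodMk (hasDerivAt_id y))
  · exact ((hφ.continuous_fderiv ey).comp (by fun_prop : Continuous fun y : ℝ => (x, y))).intervalIntegrable _ _

theorem IsTest.mul_left {γ : ℝ} {φ w : ℝ × ℝ → ℂ} (hφ : IsTest γ φ) (hw : ContDiff ℝ ∞ w)
    (hp : ∀ x y, w (x + 2 * Real.pi / γ, y) = w (x, y)) : IsTest γ fun p => w p * φ p := by
  obtain ⟨h1, h2, a, b, ha, hb, h3⟩ := hφ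
  refine ⟨hw.mul h1, fun x y => by simp only [h2, hp], a, b, ha, hb, fun x y hy => ?_⟩
  simp only [h3 x y hy, mul_zero]

/-- The product of a smooth periodic function and a test function is again a test function, so the
integral of its derivative vanishes; no boundary condition on `w` is required. -/
theorem hasWeakDeriv_of_smooth {γ : ℝ} {d : ℝ × ℝ}
    (hd : ∀ φ, IsTest γ φ → ∫ p in rect γ, fderiv ℝ φ p d = 0) {w w' : ℝ × ℝ → ℂ}
    (hw : ContDiff ℝ ∞ w) (hp : ∀ x y, w (x + 2 * Real.pi / γ, y) = w (x, y))
    (hw' : ∀ p, fderiv ℝ w p d = w' p) {u v : L2 γ}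
    (hu : u =ᵐ[volume.restrict (rect γ)] w) (hv : v =ᵐ[volume.restrict (rect γ)] w') :
    HasWeakDeriv γ d u v := by
  intro φ hφ
  have hwd : Continuous w' := by
    have : w' = fun p => fderiv ℝ w p d := funext fun p => (hw' p).symm
    rw [this]
    exact (hw.continuous_fderiv (by simp)).clm_apply continuous_const
  have e1 : ∫ p in rect γ, u p * fderiv ℝ φ p d = ∫ p in rect γ, w p * fderiv ℝ φ p d :=
    integral_congr_ae (hu.mono fun p hp => by simp only [hp])
  have e2 : ∫ p in rect γ, v p * φ p = ∫ p in rect γ, w' p * φ p :=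
    integral_congr_ae (hv.mono fun p hp => by simp only [hp])
  rw [e1, e2, eq_neg_iff_add_eq_zero,
    ← integral_add (f := fun p => w p * fderiv ℝ φ p d) (g := fun p => w' p * φ p)
      (integrableOn_rect γ (hw.continuous.mul (hφ.continuous_fderiv d)))
      (integrableOn_rect γ (hwd.mul hφ.1.continuous)), ← hd _ (hφ.mul_left hw hp)]
  refine integral_congr_ae (ae_of_all _ fun p => ?_)
  simp only
  rw [fderiv_fun_mul (hw.differentiable (by simp) p) (hφ.1.differentiable (by simp) p)]
  simp [hw', mul_comm]

theorem hasDerivAt_modeX (γ : ℝ) (i : ℤ × ℕ) (x : ℝ) :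
    HasDerivAt (modeX γ i) (Complex.I * kx γ i * modeX γ i x) x := by
  have h : HasDerivAt (fun x : ℝ => Complex.I * ((γ * i.1 * x : ℝ) : ℂ))
      (Complex.I * ((γ * i.1 * 1 : ℝ) : ℂ)) x :=
    (((hasDerivAt_id x).const_mul (γ * i.1 : ℝ)).ofReal_comp).const_mul Complex.I
  have h' : HasDerivAt (modeX γ i) _ x := h.cexp
  convert h' using 1
  rw [modeX, kx, mul_one]; ring

/-- Differentiation in `y` raises the phase by one, so one family of modes contains all
`y`-derivatives of the sines. -/
theorem hasDerivAt_modeY (j : ℕ) (i : ℤ × ℕ) (y : ℝ) :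
    HasDerivAt (modeY j i) (ky i * modeY (j + 1) i y) y := by
  have h : HasDerivAt (fun y : ℝ => (i.2 + 1) * y + j * (Real.pi / 2)) ((i.2 + 1 : ℝ) * 1) y :=
    ((hasDerivAt_id y).const_mul _).add_const _
  have h' : HasDerivAt (modeY j i) _ y := h.sin.ofReal_comp
  convert h' using 1
  rw [modeY, ky, ← Complex.ofReal_mul]
  congr 1
  rw [show ((i.2 : ℝ) + 1) * y + ((j + 1 : ℕ) : ℝ) * (Real.pi / 2) =
    ((i.2 + 1) * y + j * (Real.pi / 2)) + Real.pi / 2 by push_cast; ring, Real.sin_add_pi_div_two]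
  ring

theorem hasFDerivAt_mode (γ : ℝ) (j : ℕ) (i : ℤ × ℕ) (p : ℝ × ℝ) (d : ℝ × ℝ) :
    fderiv ℝ (mode γ j i) p d = d.1 * (Complex.I * kx γ i * mode γ j i p) +
      d.2 * (ky i * mode γ (j + 1) i p) := by
  have h1 := (hasDerivAt_modeX γ i p.1).hasFDerivAt.comp p (hasFDerivAt_fst (𝕜 := ℝ) (p := p))
  have h2 := (hasDerivAt_modeY j i p.2).hasFDerivAt.comp p (hasFDerivAt_snd (𝕜 := ℝ) (p := p))
  have h : HasFDerivAt (mode γ j i) _ p := (h1.mul h2).const_mul (modeN γ)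
  rw [h.fderiv]
  simp [mode]
  ring

theorem mode_periodic {γ : ℝ} (hγ : 0 < γ) (j : ℕ) (i : ℤ × ℕ) (x y : ℝ) :
    mode γ j i (x + 2 * Real.pi / γ, y) = mode γ j i (x, y) := by
  have : modeX γ i (x + 2 * Real.pi / γ) = modeX γ i x := by
    rw [modeX, modeX, ← Complex.exp_periodic.int_mul i.1 (Complex.I * ((γ * i.1 * x : ℝ) : ℂ))]
    congr 1
    have : (γ : ℂ) ≠ 0 := by exact_mod_cast hγ.ne'
    push_cast; field_simp
  simp only [mode, this]

theorem hasWeakDeriv_ex_modeLp {γ : ℝ} (hγ : 0 < γ) (j : ℕ) (i : ℤ × ℕ) :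
    HasWeakDeriv γ ex (modeLp γ j i) ((Complex.I * kx γ i) • modeLp γ j i) := by
  refine hasWeakDeriv_of_smooth (fun φ => integral_fderiv_ex hγ) (mode_contDiff γ j i)
    (mode_periodic hγ j i) (fun p => hasFDerivAt_mode γ j i p ex) (coeFn_modeLp γ j i) ?_
  filter_upwards [Lp.coeFn_smul (Complex.I * kx γ i : ℂ) (modeLp γ j i), coeFn_modeLp γ j i]
    with p h1 h2
  rw [h1, Pi.smul_apply, h2]
  simp [ex]

theorem hasWeakDeriv_ey_modeLp {γ : ℝ} (hγ : 0 < γ) (j : ℕ) (i : ℤ × ℕ) :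
    HasWeakDeriv γ ey (modeLp γ j i) ((ky i : ℂ) • modeLp γ (j + 1) i) := by
  refine hasWeakDeriv_of_smooth (fun φ => integral_fderiv_ey) (mode_contDiff γ j i)
    (mode_periodic hγ j i) (fun p => hasFDerivAt_mode γ j i p ey) (coeFn_modeLp γ j i) ?_
  filter_upwards [Lp.coeFn_smul (ky i : ℂ) (modeLp γ (j + 1) i), coeFn_modeLp γ (j + 1) i]
    with p h1 h2
  rw [h1, Pi.smul_apply, h2]
  simp [ey]

/-! ### Weighted summability, Sobolev regularity and boundary values of series. -/

theorem one_le_ky (i : ℤ × ℕ) : 1 ≤ ky i := by simp [ky]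

theorem one_le_eig (γ : ℝ) (i : ℤ × ℕ) : 1 ≤ eig γ i := by
  have := one_le_ky i
  rw [eig]; nlinarith [sq_nonneg (kx γ i)]

theorem eig_pos (γ : ℝ) (i : ℤ × ℕ) : 0 < eig γ i := one_pos.trans_le (one_le_eig γ i)

theorem summable_of_eig_pow {γ : ℝ} {m n : ℕ} (hmn : m ≤ n) {a : ℤ × ℕ → ℂ}
    (ha : Summable fun i => eig γ i ^ n * ‖a i‖ ^ 2) :
    Summable fun i => eig γ i ^ m * ‖a i‖ ^ 2 :=
  ha.of_nonneg_of_le (fun i => by have := eig_pos γ i; positivity) fun i =>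
    mul_le_mul_of_nonneg_right (pow_le_pow_right₀ (one_le_eig γ i) hmn) (by positivity)

theorem summable_sq_of_eig_pow {γ : ℝ} {n : ℕ} {a : ℤ × ℕ → ℂ}
    (ha : Summable fun i => eig γ i ^ n * ‖a i‖ ^ 2) : Summable fun i => ‖a i‖ ^ 2 := by
  simpa using summable_of_eig_pow n.zero_le ha

/-- A derivative multiplies coefficients by a factor of square at most `eig`, and so costs one power
of the weight. -/
theorem summable_mul_of_le {γ : ℝ} {n : ℕ} {a c : ℤ × ℕ → ℂ} (hc : ∀ i, ‖c i‖ ^ 2 ≤ eig γ i)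
    (ha : Summable fun i => eig γ i ^ (n + 1) * ‖a i‖ ^ 2) :
    Summable fun i => eig γ i ^ n * ‖c i * a i‖ ^ 2 :=
  ha.of_nonneg_of_le (fun i => by have := eig_pos γ i; positivity) fun i => by
    have := eig_pos γ i
    calc eig γ i ^ n * ‖c i * a i‖ ^ 2 = ‖c i‖ ^ 2 * (eig γ i ^ n * ‖a i‖ ^ 2) := by
          rw [norm_mul]; ring
      _ ≤ eig γ i * (eig γ i ^ n * ‖a i‖ ^ 2) := by gcongr; exact hc i
      _ = _ := by ring

theorem norm_kx_sq_le (γ : ℝ) (i : ℤ × ℕ) : ‖(Complex.I * kx γ i : ℂ)‖ ^ 2 ≤ eig γ i := by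
  rw [norm_mul, Complex.norm_I, one_mul, Complex.norm_real, Real.norm_eq_abs, sq_abs, eig]
  nlinarith [sq_nonneg (ky i)]

theorem norm_ky_sq_le (γ : ℝ) (i : ℤ × ℕ) : ‖(ky i : ℂ)‖ ^ 2 ≤ eig γ i := by
  rw [Complex.norm_real, Real.norm_eq_abs, sq_abs, eig]
  nlinarith [sq_nonneg (kx γ i)]

theorem hasWeakDeriv_ex_series {γ : ℝ} (hγ : 0 < γ) (j : ℕ) {a : ℤ × ℕ → ℂ}
    (ha : Summable fun i => eig γ i ^ 1 * ‖a i‖ ^ 2) :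
    HasWeakDeriv γ ex (series γ j a) (series γ j fun i => Complex.I * kx γ i * a i) := by
  have h2 := summable_mul_of_le (n := 0) (norm_kx_sq_le γ) ha
  refine HasWeakDeriv.hasSum (fun i => (hasWeakDeriv_ex_modeLp hγ j i).smul (a i))
    (hasSum_series hγ j (summable_sq_of_eig_pow ha)) ?_
  convert hasSum_series hγ j (summable_sq_of_eig_pow h2) using 2 with i
  rw [smul_smul, mul_comm]

theorem hasWeakDeriv_ey_series {γ : ℝ} (hγ : 0 < γ) (j : ℕ) {a : ℤ × ℕ → ℂ}
    (ha : Summable fun i => eig γ i ^ 1 * ‖a i‖ ^ 2) :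
    HasWeakDeriv γ ey (series γ j a) (series γ (j + 1) fun i => ky i * a i) := by
  have h2 := summable_mul_of_le (n := 0) (norm_ky_sq_le γ) ha
  refine HasWeakDeriv.hasSum (fun i => (hasWeakDeriv_ey_modeLp hγ j i).smul (a i))
    (hasSum_series hγ j (summable_sq_of_eig_pow ha)) ?_
  convert hasSum_series hγ (j + 1) (summable_sq_of_eig_pow h2) using 2 with i
  rw [smul_smul, mul_comm]

theorem memSob_series {γ : ℝ} (hγ : 0 < γ) {n : ℕ} {j : ℕ} {a : ℤ × ℕ → ℂ}
    (ha : Summable fun i => eig γ i ^ n * ‖a i‖ ^ 2) : MemSob γ n (series γ j a) := by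
  induction n generalizing j a with
  | zero => trivial
  | succ n ih =>
    have h1 := summable_of_eig_pow (m := 1) (by omega) ha
    exact ⟨_, _, hasWeakDeriv_ex_series hγ j h1, hasWeakDeriv_ey_series hγ j h1,
      ih (summable_mul_of_le (norm_kx_sq_le γ) ha), ih (summable_mul_of_le (norm_ky_sq_le γ) ha)⟩

/-- Since `ky ≥ 1`, one has `(kx² + 1) ky² ≤ (kx² + ky²)²`, which reduces the double series to a
product of two convergent ones. -/
theorem summable_eig_inv_sq {γ : ℝ} (hγ : 0 < γ) : Summable fun i => (eig γ i ^ 2)⁻¹ := by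
  have h1 : Summable fun k : ℤ => (γ ^ 2 * (k : ℝ) ^ 2 + 1)⁻¹ := by
    have h := (Real.summable_one_div_int_pow (p := 2)).2 (by norm_num)
    refine Summable.of_norm_bounded_eventually (h.mul_left (γ ^ 2)⁻¹) ?_
    have : ∀ᶠ k : ℤ in Filter.cofinite, k ≠ 0 := Filter.eventually_cofinite_ne 0
    filter_upwards [this] with k hk
    have hk' : (0 : ℝ) < (k : ℝ) ^ 2 := by positivity
    rw [Real.norm_of_nonneg (by positivity), one_div, ← mul_inv]
    exact inv_anti₀ (by positivity) (by linarith)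
  have h2 : Summable fun l : ℕ => (((l : ℝ) + 1) ^ 2)⁻¹ := by
    have h := (summable_nat_add_iff 1).2 ((Real.summable_one_div_nat_pow (p := 2)).2 (by norm_num))
    simpa using h
  refine (h1.mul_of_nonneg h2 (fun k => by positivity) (fun l => by positivity)).of_nonneg_of_le
    (fun i => by have := eig_pos γ i; positivity) fun i => ?_
  rw [← mul_inv]
  refine inv_anti₀ (by positivity) ?_
  have h3 := one_le_ky i
  have h4 : 1 ≤ ky i ^ 2 := one_le_pow₀ h3
  have e : (γ ^ 2 * (i.1 : ℝ) ^ 2 + 1) * ((i.2 : ℝ) + 1) ^ 2 = (kx γ i ^ 2 + 1) * ky i ^ 2 := by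
    rw [kx, ky]; ring
  rw [e, eig]
  nlinarith [sq_nonneg (kx γ i), mul_nonneg (sq_nonneg (kx γ i)) (sq_nonneg (ky i)),
    sq_nonneg (kx γ i ^ 2)]

/-- Write `‖a‖ = (eig ‖a‖) · eig⁻¹` and bound the product by the sum of the squares. -/
theorem summable_norm_of_eig_sq {γ : ℝ} (hγ : 0 < γ) {a : ℤ × ℕ → ℂ}
    (ha : Summable fun i => eig γ i ^ 2 * ‖a i‖ ^ 2) : Summable fun i => ‖a i‖ := by
  refine (ha.add (summable_eig_inv_sq hγ)).of_nonneg_of_le (fun i => norm_nonneg _) fun i => ?_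
  have h0 := eig_pos γ i
  have h1 : ‖a i‖ = (eig γ i * ‖a i‖) * (eig γ i)⁻¹ := by field_simp
  have h2 : eig γ i ^ 2 * ‖a i‖ ^ 2 + (eig γ i ^ 2)⁻¹ =
    (eig γ i * ‖a i‖) ^ 2 + ((eig γ i)⁻¹) ^ 2 := by rw [inv_pow]; ring
  rw [h2]
  set s := eig γ i * ‖a i‖
  set t := (eig γ i)⁻¹
  rw [h1]
  nlinarith [sq_nonneg (s - t), sq_nonneg s, sq_nonneg t]

/-- The series converges uniformly, so its pointwise sum is continuous, periodic and zero on the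
walls termwise. It represents the `L²` sum because both have the same coefficients, by termwise
integration. -/
theorem vanishesOnWalls_series {γ : ℝ} (hγ : 0 < γ) {a : ℤ × ℕ → ℂ}
    (ha : Summable fun i => eig γ i ^ 2 * ‖a i‖ ^ 2) : VanishesOnWalls γ (series γ 0 a) := by
  have hs := summable_norm_of_eig_sq hγ ha
  have hb : ∀ i p, ‖a i * mode γ 0 i p‖ ≤ ‖a i‖ * ‖modeN γ‖ := fun i p => by
    rw [norm_mul]; exact mul_le_mul_of_nonneg_left (norm_mode_le _ _ _ _) (norm_nonneg _)
  set g : ℝ × ℝ → ℂ := fun p => ∑' i, a i * mode γ 0 i p with hg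
  have hgc : Continuous g := continuous_tsum
    (fun i => continuous_const.mul (mode_continuous γ 0 i)) (hs.mul_right _) hb
  refine ⟨g, hgc, ?_, fun x y => ?_, fun x => ⟨?_, ?_⟩⟩
  · have hv := (memLp_of_continuous γ hgc).coeFn_toLp
    suffices series γ 0 a = (memLp_of_continuous γ hgc).toLp g by rw [this]; exact hv
    refine coef_ext hγ fun i => ?_
    rw [coef_series hγ (summable_sq_of_eig_pow ha), coef_eq_integral]
    have hcc : Continuous fun p => (starRingEnd ℂ) (mode γ 0 i p) :=
      Complex.continuous_conj.comp (mode_continuous γ 0 i)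
    have e1 : ∫ p in rect γ, (memLp_of_continuous γ hgc).toLp g p * (starRingEnd ℂ) (mode γ 0 i p) =
        ∫ p in rect γ, ∑' i', a i' * mode γ 0 i' p * (starRingEnd ℂ) (mode γ 0 i p) := by
      refine integral_congr_ae (hv.mono fun p hp => ?_)
      simp only [hp]
      simp only [hg, tsum_mul_right]
    have hint : ∀ i', ∫ p in rect γ, a i' * mode γ 0 i' p * (starRingEnd ℂ) (mode γ 0 i p) =
        a i' * if i = i' then 1 else 0 := by
      intro i'
      rw [← coef_modeLp hγ, coef_eq_integral, ← integral_const_mul]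
      refine integral_congr_ae ((coeFn_modeLp γ 0 i').mono fun p hp => ?_)
      simp only [hp]; ring
    rw [e1, ← integral_tsum_of_summable_integral_norm]
    · simp_rw [hint]
      rw [tsum_eq_single i (fun i' h => by rw [if_neg h.symm, mul_zero]), if_pos rfl, mul_one]
    · exact fun i' => integrableOn_rect γ ((continuous_const.mul (mode_continuous γ 0 i')).mul hcc)
    · refine (hs.mul_right (‖modeN γ‖ * ‖modeN γ‖ * (volume.restrict (rect γ)).real univ)).of_nonneg_of_le
        (fun i' => integral_nonneg fun p => norm_nonneg _) fun i' => ?_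
      have h1 := norm_setIntegral_le_of_norm_le_const (μ := volume) (s := rect γ)
        (f := fun p => ‖a i' * mode γ 0 i' p * (starRingEnd ℂ) (mode γ 0 i p)‖)
        (C := ‖a i'‖ * (‖modeN γ‖ * ‖modeN γ‖)) ?_ ?_
      · rw [Real.norm_of_nonneg (integral_nonneg fun p => norm_nonneg _)] at h1
        refine h1.trans (le_of_eq ?_)
        rw [measureReal_restrict_apply_univ]; ring
      · rw [← Measure.restrict_apply_univ]; exact measure_lt_top _ _
      · intro p _
        rw [norm_norm, norm_mul, norm_mul, RCLike.norm_conj, mul_assoc]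
        gcongr <;> exact norm_mode_le _ _ _ _
  · simp only [hg, mode_periodic hγ]
  · simp [hg, mode, modeY]
  · have : ∀ i : ℤ × ℕ, Real.sin ((i.2 + 1) * Real.pi) = 0 := fun i => by
      exact_mod_cast Real.sin_nat_mul_pi (i.2 + 1)
    simp only [hg, mode, modeY, CharP.cast_eq_zero, zero_mul, add_zero, this]
    simp

section Cutoff

/-! ### Cutoff functions and Fourier coefficients of weak derivatives -/

open Filter Topology

theorem deriv_smoothTransition_of_one_le {t : ℝ} (ht : 1 ≤ t) : deriv Real.smoothTransition t = 0 :=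
  IsLocalMax.deriv_eq_zero (Eventually.of_forall fun s => by
    rw [Real.smoothTransition.one_of_one_le ht]; exact Real.smoothTransition.le_one s)

theorem deriv_smoothTransition_of_nonpos {t : ℝ} (ht : t ≤ 0) : deriv Real.smoothTransition t = 0 :=
  IsLocalMin.deriv_eq_zero (Eventually.of_forall fun s => by
    rw [Real.smoothTransition.zero_of_nonpos ht]; exact Real.smoothTransition.nonneg s)

theorem deriv_smoothTransition_nonneg (t : ℝ) : 0 ≤ deriv Real.smoothTransition t :=
  Real.smoothTransition.monotone.deriv_nonneg

theorem continuous_deriv_smoothTransition : Continuous (deriv Real.smoothTransition) :=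
  (Real.smoothTransition.contDiff (n := 1)).continuous_deriv le_rfl

theorem hasDerivAt_smoothTransition (t : ℝ) :
    HasDerivAt Real.smoothTransition (deriv Real.smoothTransition t) t :=
  ((Real.smoothTransition.contDiff (n := 1)).differentiable (by simp) t).hasDerivAt

theorem exists_deriv_smoothTransition_le : ∃ C, ∀ t, deriv Real.smoothTransition t ≤ C := by
  obtain ⟨C, hC⟩ := (isCompact_Icc (a := (0 : ℝ)) (b := 1)).exists_bound_of_continuousOn
    continuous_deriv_smoothTransition.continuousOn
  refine ⟨max C 0, fun t => ?_⟩
  by_cases h0 : t ≤ 0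
  · rw [deriv_smoothTransition_of_nonpos h0]; exact le_max_right _ _
  by_cases h1 : 1 ≤ t
  · rw [deriv_smoothTransition_of_one_le h1]; exact le_max_right _ _
  · exact ((le_abs_self _).trans (hC t ⟨by linarith, by linarith⟩)).trans (le_max_left _ _)

/-- A smooth cutoff that vanishes near `0` and `π`. -/
def cut (n : ℕ) (y : ℝ) : ℝ :=
  Real.smoothTransition ((n + 1) * y - 1) * Real.smoothTransition ((n + 1) * (Real.pi - y) - 1)

/-- The derivative of the cutoff. -/
def cutDeriv (n : ℕ) (y : ℝ) : ℝ :=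
  deriv Real.smoothTransition ((n + 1) * y - 1) * (n + 1) *
      Real.smoothTransition ((n + 1) * (Real.pi - y) - 1) +
    Real.smoothTransition ((n + 1) * y - 1) *
      (deriv Real.smoothTransition ((n + 1) * (Real.pi - y) - 1) * -(n + 1))

/-- A bound for the derivative of the cutoff. -/
def cutBound (n : ℕ) (y : ℝ) : ℝ :=
  deriv Real.smoothTransition ((n + 1) * y - 1) * (n + 1) +
    deriv Real.smoothTransition ((n + 1) * (Real.pi - y) - 1) * (n + 1)

theorem hasDerivAt_left (n : ℕ) (y : ℝ) :
    HasDerivAt (fun y => Real.smoothTransition ((n + 1) * y - 1))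
      (deriv Real.smoothTransition ((n + 1) * y - 1) * (n + 1)) y := by
  have h : HasDerivAt (fun y : ℝ => ((n : ℝ) + 1) * y - 1) (n + 1) y := by
    simpa using ((hasDerivAt_id y).const_mul ((n : ℝ) + 1)).sub_const 1
  exact (hasDerivAt_smoothTransition _).comp y h

theorem hasDerivAt_right (n : ℕ) (y : ℝ) :
    HasDerivAt (fun y => Real.smoothTransition ((n + 1) * (Real.pi - y) - 1))
      (deriv Real.smoothTransition ((n + 1) * (Real.pi - y) - 1) * -(n + 1)) y := by
  have h : HasDerivAt (fun y : ℝ => ((n : ℝ) + 1) * (Real.pi - y) - 1) (-(n + 1)) y := by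
    have := (((hasDerivAt_id y).const_sub Real.pi).const_mul ((n : ℝ) + 1)).sub_const 1
    simpa using this
  exact (hasDerivAt_smoothTransition _).comp y h

theorem hasDerivAt_cut (n : ℕ) (y : ℝ) : HasDerivAt (cut n) (cutDeriv n y) y :=
  (hasDerivAt_left n y).mul (hasDerivAt_right n y)

theorem contDiff_cut (n : ℕ) : ContDiff ℝ ∞ (cut n) := by
  have h : ∀ m : ℕ∞, ContDiff ℝ m Real.smoothTransition := fun m => Real.smoothTransition.contDiff
  refine ((h ⊤).comp ?_).mul ((h ⊤).comp ?_)
  · exact (contDiff_const.mul contDiff_id).sub contDiff_const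
  · exact (contDiff_const.mul (contDiff_const.sub contDiff_id)).sub contDiff_const

theorem continuous_cutBound (n : ℕ) : Continuous (cutBound n) := by
  have := continuous_deriv_smoothTransition
  unfold cutBound
  fun_prop

theorem continuous_cutDeriv (n : ℕ) : Continuous (cutDeriv n) := by
  have := continuous_deriv_smoothTransition
  have := Real.smoothTransition.continuous
  unfold cutDeriv
  fun_prop

theorem cutBound_nonneg (n : ℕ) (y : ℝ) : 0 ≤ cutBound n y :=
  add_nonneg (mul_nonneg (deriv_smoothTransition_nonneg _) (by positivity))
    (mul_nonneg (deriv_smoothTransition_nonneg _) (by positivity))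

theorem abs_cutDeriv_le (n : ℕ) (y : ℝ) : |cutDeriv n y| ≤ cutBound n y := by
  have a1 := mul_nonneg (deriv_smoothTransition_nonneg ((n + 1) * y - 1))
    (by positivity : (0 : ℝ) ≤ n + 1)
  have a2 := mul_nonneg (deriv_smoothTransition_nonneg ((n + 1) * (Real.pi - y) - 1))
    (by positivity : (0 : ℝ) ≤ n + 1)
  have b1 := Real.smoothTransition.nonneg ((n + 1) * y - 1)
  have b2 := Real.smoothTransition.nonneg ((n + 1) * (Real.pi - y) - 1)
  have c1 := Real.smoothTransition.le_one ((n + 1) * y - 1)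
  have c2 := Real.smoothTransition.le_one ((n + 1) * (Real.pi - y) - 1)
  rw [cutDeriv, cutBound]
  refine (abs_add_le _ _).trans (add_le_add ?_ ?_)
  · rw [abs_of_nonneg (mul_nonneg a1 b2)]
    exact mul_le_of_le_one_right a1 c2
  · rw [mul_neg, mul_neg, abs_neg, abs_of_nonneg (mul_nonneg b1 a2)]
    exact mul_le_of_le_one_left a2 c1

/-- The bound is the derivative of the difference of the two transitions, each of which varies by at
most one. Thus the cutoff derivatives are bounded in `L¹` although they grow pointwise. -/
theorem integral_cutBound_le (n : ℕ) : ∫ y in Ioo 0 Real.pi, cutBound n y ≤ 2 := by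
  have hc := continuous_deriv_smoothTransition
  rw [← integral_Ioc_eq_integral_Ioo, ← intervalIntegral.integral_of_le Real.pi_pos.le]
  rw [intervalIntegral.integral_eq_sub_of_hasDerivAt (f := fun y =>
    Real.smoothTransition ((n + 1) * y - 1) - Real.smoothTransition ((n + 1) * (Real.pi - y) - 1))
    (fun y _ => ?_) ((continuous_cutBound n).intervalIntegrable _ _)]
  · have h := Real.smoothTransition.le_one
    have h' := Real.smoothTransition.nonneg
    linarith [h ((n + 1) * Real.pi - 1), h' ((n + 1) * (Real.pi - Real.pi) - 1),
      h' ((n + 1) * 0 - 1), h ((n + 1) * (Real.pi - 0) - 1)]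
  · have := (hasDerivAt_left n y).sub (hasDerivAt_right n y)
    rw [mul_neg, sub_neg_eq_add] at this
    exact this

theorem cutBound_eq_zero {n : ℕ} {y : ℝ} (h1 : 2 ≤ (n + 1) * y) (h2 : 2 ≤ (n + 1) * (Real.pi - y)) :
    cutBound n y = 0 := by
  rw [cutBound, deriv_smoothTransition_of_one_le (by linarith),
    deriv_smoothTransition_of_one_le (by linarith)]
  simp

/-- The derivative of the cutoff has size `n + 1`, but only within `2 / (n + 1)` of a wall, where a
quantity vanishing linearly at the walls compensates for it. -/
theorem exists_cutBound_mul_le : ∃ C, ∀ (n : ℕ) (y K t : ℝ), 0 ≤ y → 0 ≤ Real.pi - y → 0 ≤ K →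
    0 ≤ t → t ≤ K * y → t ≤ K * (Real.pi - y) → cutBound n y * t ≤ C * K := by
  obtain ⟨C, hC⟩ := exists_deriv_smoothTransition_le
  have h0 : 0 ≤ C := (deriv_smoothTransition_nonneg 0).trans (hC 0)
  have key : ∀ s : ℝ, 0 ≤ s → deriv Real.smoothTransition (s - 1) * s ≤ 2 * C := by
    intro s hs
    by_cases h : 2 ≤ s
    · rw [deriv_smoothTransition_of_one_le (by linarith)]; linarith
    · nlinarith [hC (s - 1), deriv_smoothTransition_nonneg (s - 1)]
  refine ⟨4 * C, fun n y K t hy hy' hK ht h1 h2 => ?_⟩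
  have k1 := key ((n + 1) * y) (by positivity)
  have k2 := key ((n + 1) * (Real.pi - y)) (by positivity)
  have a1 := mul_nonneg (deriv_smoothTransition_nonneg ((n + 1) * y - 1))
    (by positivity : (0 : ℝ) ≤ n + 1)
  have a2 := mul_nonneg (deriv_smoothTransition_nonneg ((n + 1) * (Real.pi - y) - 1))
    (by positivity : (0 : ℝ) ≤ n + 1)
  rw [cutBound, add_mul]
  have l1 := mul_le_mul_of_nonneg_left h1 a1
  have l2 := mul_le_mul_of_nonneg_left h2 a2
  have m1 := mul_le_mul_of_nonneg_right k1 hK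
  have m2 := mul_le_mul_of_nonneg_right k2 hK
  linarith

theorem isTest_cut_mul {γ : ℝ} (n : ℕ) {w : ℝ × ℝ → ℂ} (hw : ContDiff ℝ ∞ w)
    (hp : ∀ x y, w (x + 2 * Real.pi / γ, y) = w (x, y)) :
    IsTest γ fun p => (cut n p.2 : ℂ) * w p := by
  have hn : (0 : ℝ) < n + 1 := by positivity
  refine ⟨(Complex.ofRealCLM.contDiff.comp ((contDiff_cut n).comp contDiff_snd)).mul hw,
    fun x y => by simp only [hp], 1 / (n + 1), Real.pi - 1 / (n + 1), by positivity,
    by linarith [one_div_pos.2 hn], fun x y hy => ?_⟩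
  have : cut n y = 0 := by
    rw [mem_Icc, not_and_or, not_le, not_le] at hy
    rw [cut]
    rcases hy with h | h
    · rw [lt_div_iff₀ hn] at h
      rw [Real.smoothTransition.zero_of_nonpos (by linarith), zero_mul]
    · have h' : Real.pi - y < 1 / (n + 1) := by linarith
      rw [lt_div_iff₀ hn] at h'
      rw [Real.smoothTransition.zero_of_nonpos (x := (n + 1) * (Real.pi - y) - 1) (by linarith),
        mul_zero]
  simp [this]

theorem eventually_two_le {y : ℝ} (hy : 0 < y) : ∀ᶠ n : ℕ in atTop, 2 ≤ ((n : ℝ) + 1) * y := by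
  have h : Tendsto (fun n : ℕ => ((n : ℝ) + 1) * y) atTop atTop :=
    (tendsto_atTop_add_const_right _ _ tendsto_natCast_atTop_atTop).atTop_mul_const hy
  exact h.eventually_ge_atTop 2

theorem integrable_L2 {γ : ℝ} (u : L2 γ) : Integrable u (volume.restrict (rect γ)) :=
  (Lp.memLp u).integrable (by norm_num)

theorem tendsto_integral_cut_mul {γ : ℝ} (u : L2 γ) {f : ℝ × ℝ → ℂ} (hf : Continuous f) :
    Tendsto (fun n => ∫ p in rect γ, u p * ((cut n p.2 : ℂ) * f p)) atTop
      (𝓝 (∫ p in rect γ, u p * f p)) := by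
  obtain ⟨C, hC0, hC⟩ := exists_bound_rect γ hf
  refine tendsto_integral_of_dominated_convergence (fun p => ‖u p‖ * C) (fun n => ?_)
    ((integrable_L2 u).norm.mul_const C) (fun n => ?_) ?_
  · have : Continuous fun p : ℝ × ℝ => (cut n p.2 : ℂ) * f p :=
      (Complex.continuous_ofReal.comp ((contDiff_cut n).continuous.comp continuous_snd)).mul hf
    exact (integrable_L2 u).1.mul this.aestronglyMeasurable
  · refine ae_restrict_of_forall_mem (measurableSet_rect γ) fun p hp => ?_
    rw [norm_mul, norm_mul, Complex.norm_real]
    refine mul_le_mul_of_nonneg_left ?_ (norm_nonneg _)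
    have h1 : ‖cut n p.2‖ ≤ 1 := by
      have n1 := Real.smoothTransition.nonneg ((n + 1) * p.2 - 1)
      have n2 := Real.smoothTransition.nonneg ((n + 1) * (Real.pi - p.2) - 1)
      rw [cut, Real.norm_of_nonneg (mul_nonneg n1 n2)]
      exact mul_le_one₀ (Real.smoothTransition.le_one _) n2 (Real.smoothTransition.le_one _)
    exact (mul_le_of_le_one_left (norm_nonneg _) h1).trans (hC p hp)
  · refine ae_restrict_of_forall_mem (measurableSet_rect γ) fun p hp => ?_
    refine tendsto_const_nhds.congr' ?_
    filter_upwards [eventually_two_le hp.2.1, eventually_two_le (sub_pos.2 hp.2.2)] with n h1 h2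
    rw [cut, Real.smoothTransition.one_of_one_le (by linarith),
      Real.smoothTransition.one_of_one_le (by linarith)]
    simp

/-- First way to lose the boundary term: the smooth factor vanishes linearly at the walls, so
dominated convergence applies. -/
theorem tendsto_boundary_of_test {γ : ℝ} (u : L2 γ) {w : ℝ × ℝ → ℂ} (hw : Continuous w) {K : ℝ}
    (hK : 0 ≤ K) (h1 : ∀ p ∈ rect γ, ‖w p‖ ≤ K * p.2)
    (h2 : ∀ p ∈ rect γ, ‖w p‖ ≤ K * (Real.pi - p.2)) :
    Tendsto (fun n => ∫ p in rect γ, u p * ((cutDeriv n p.2 : ℂ) * w p)) atTop (𝓝 0) := by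
  obtain ⟨C, hC⟩ := exists_cutBound_mul_le
  rw [← integral_zero (ℝ × ℝ) ℂ (μ := volume.restrict (rect γ))]
  refine tendsto_integral_of_dominated_convergence (fun p => ‖u p‖ * (C * K)) (fun n => ?_)
    ((integrable_L2 u).norm.mul_const _) (fun n => ?_) ?_
  · have : Continuous fun p : ℝ × ℝ => (cutDeriv n p.2 : ℂ) * w p :=
      (Complex.continuous_ofReal.comp ((continuous_cutDeriv n).comp continuous_snd)).mul hw
    exact (integrable_L2 u).1.mul this.aestronglyMeasurable
  · refine ae_restrict_of_forall_mem (measurableSet_rect γ) fun p hp => ?_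
    rw [norm_mul, norm_mul, Complex.norm_real]
    refine mul_le_mul_of_nonneg_left ?_ (norm_nonneg _)
    refine (mul_le_mul_of_nonneg_right (abs_cutDeriv_le n p.2) (norm_nonneg _)).trans ?_
    exact hC n p.2 K _ hp.2.1.le (sub_pos.2 hp.2.2).le hK (norm_nonneg _) (h1 p hp) (h2 p hp)
  · refine ae_restrict_of_forall_mem (measurableSet_rect γ) fun p hp => ?_
    refine tendsto_const_nhds.congr' ?_
    filter_upwards [eventually_two_le hp.2.1, eventually_two_le (sub_pos.2 hp.2.2)] with n h1 h2
    have h3 := abs_cutDeriv_le n p.2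
    rw [cutBound_eq_zero h1 h2] at h3
    rw [abs_nonpos_iff.1 h3]
    simp

/-- Second way: `u` itself vanishes on the walls. By uniform continuity it is uniformly small where
the cutoff derivative lives, and that derivative is bounded in `L¹`. -/
theorem tendsto_boundary_of_vanishes {γ : ℝ} (hγ : 0 < γ) {u : L2 γ} (hu : VanishesOnWalls γ u)
    {w : ℝ × ℝ → ℂ} (hw : Continuous w) :
    Tendsto (fun n => ∫ p in rect γ, u p * ((cutDeriv n p.2 : ℂ) * w p)) atTop (𝓝 0) := by
  obtain ⟨g, hg, hug, -, hg0⟩ := hu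
  obtain ⟨M, hM0, hM⟩ := exists_bound_rect γ hw
  have hT : 0 < 2 * Real.pi / γ := by positivity
  have hpi := Real.pi_pos
  have hB : ∀ n, ∫ p in rect γ, cutBound n p.2 ≤ 2 * Real.pi / γ * 2 := by
    intro n
    have h := setIntegral_prod_mul (μ := (volume : Measure ℝ)) (ν := (volume : Measure ℝ))
      (fun _ : ℝ => (1 : ℝ)) (cutBound n) (Ioo 0 (2 * Real.pi / γ)) (Ioo 0 Real.pi)
    simp only [one_mul] at h
    rw [rect, Measure.volume_eq_prod, h]
    simp only [integral_const, MeasurableSet.univ, measureReal_restrict_apply, univ_inter,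
      Real.volume_real_Ioo, sub_zero, smul_eq_mul, max_eq_left hT.le, mul_one]
    exact mul_le_mul_of_nonneg_left (integral_cutBound_le n) hT.le
  rw [Metric.tendsto_atTop]
  intro η hη
  set D := M * (2 * Real.pi / γ * 2) with hD
  have hD0 : 0 ≤ D := by positivity
  -- The added one avoids dividing by zero and makes the final inequality strict.
  set ε := η / (D + 1) with hε
  have hε0 : 0 < ε := by positivity
  have hKc : IsCompact (Icc (0 : ℝ) (2 * Real.pi / γ) ×ˢ Icc (0 : ℝ) Real.pi) :=
    isCompact_Icc.prod isCompact_Icc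
  have huc := hKc.uniformContinuousOn_of_continuous hg.continuousOn
  rw [Metric.uniformContinuousOn_iff] at huc
  obtain ⟨δ, hδ, hgδ⟩ := huc ε hε0
  have hsmall : ∀ p ∈ rect γ, (p.2 < δ ∨ Real.pi - p.2 < δ) → ‖g p‖ ≤ ε := by
    rintro ⟨x, y⟩ ⟨hx, hy⟩ h
    have hxI := Ioo_subset_Icc_self hx
    have hyI := Ioo_subset_Icc_self hy
    simp only at h hxI hyI
    rcases h with h | h
    · have := hgδ (x, y) ⟨hxI, hyI⟩ (x, 0) ⟨hxI, by simp [hpi.le]⟩ (by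
        simp only [Prod.dist_eq, dist_self, Real.dist_eq, sub_zero]
        rw [abs_of_nonneg hyI.1]; exact max_lt hδ h)
      rw [(hg0 x).1, dist_zero_right] at this
      exact this.le
    · have := hgδ (x, y) ⟨hxI, hyI⟩ (x, Real.pi) ⟨hxI, by simp [hpi.le]⟩ (by
        simp only [Prod.dist_eq, dist_self, Real.dist_eq]
        rw [abs_sub_comm, abs_of_nonneg (sub_nonneg.2 hyI.2)]; exact max_lt hδ h)
      rw [(hg0 x).2, dist_zero_right] at this
      exact this.le
  obtain ⟨n₀, hn₀⟩ := eventually_atTop.1 (eventually_two_le hδ)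
  refine ⟨n₀, fun n hn => ?_⟩
  rw [dist_zero_right]
  have hδn := hn₀ n hn
  have hn' : (0 : ℝ) < n + 1 := by positivity
  have hpt : ∀ᵐ p ∂(volume.restrict (rect γ)), ‖u p * ((cutDeriv n p.2 : ℂ) * w p)‖ ≤
      ε * M * cutBound n p.2 := by
    filter_upwards [hug, ae_restrict_mem (measurableSet_rect γ)] with p hp hmem
    rw [norm_mul, norm_mul, Complex.norm_real, hp, Real.norm_eq_abs]
    have hc := abs_cutDeriv_le n p.2
    by_cases h : p.2 < δ ∨ Real.pi - p.2 < δ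
    · calc ‖g p‖ * (|cutDeriv n p.2| * ‖w p‖) ≤ ε * (cutBound n p.2 * M) := by
            gcongr
            · exact hsmall p hmem h
            · exact cutBound_nonneg _ _
            · exact hM p hmem
        _ = _ := by ring
    · rw [not_or, not_lt, not_lt] at h
      have hz := cutBound_eq_zero (n := n) (y := p.2)
        (hδn.trans (mul_le_mul_of_nonneg_left h.1 hn'.le))
        (hδn.trans (mul_le_mul_of_nonneg_left h.2 hn'.le))
      rw [hz] at hc ⊢
      rw [le_antisymm hc (abs_nonneg _)]
      simp
  have hint : Integrable (fun p : ℝ × ℝ => cutBound n p.2) (volume.restrict (rect γ)) := by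
    have := integrableOn_rect γ (w := fun p => (cutBound n p.2 : ℂ))
      (Complex.continuous_ofReal.comp ((continuous_cutBound n).comp continuous_snd))
    exact this.re
  calc ‖∫ p in rect γ, u p * ((cutDeriv n p.2 : ℂ) * w p)‖
      ≤ ∫ p in rect γ, ε * M * cutBound n p.2 := norm_integral_le_of_norm_le (hint.const_mul _) hpt
    _ = ε * M * ∫ p in rect γ, cutBound n p.2 := integral_const_mul _ _
    _ ≤ ε * M * (2 * Real.pi / γ * 2) := mul_le_mul_of_nonneg_left (hB n) (by positivity)
    _ = ε * D := by rw [hD]; ring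
    _ < ε * (D + 1) := by nlinarith
    _ = η := by rw [hε]; field_simp

/-- Integration by parts against functions that need not vanish near the walls. Testing with the
cutoff times `w` leaves one extra term, and `hb` says that it is absent or tends to zero. -/
theorem HasWeakDeriv.integral_mul {γ : ℝ} {d : ℝ × ℝ} {u v : L2 γ} (h : HasWeakDeriv γ d u v)
    {w : ℝ × ℝ → ℂ} (hw : ContDiff ℝ ∞ w) (hp : ∀ x y, w (x + 2 * Real.pi / γ, y) = w (x, y))
    (hb : d.2 = 0 ∨ Tendsto (fun n => ∫ p in rect γ, u p * ((cutDeriv n p.2 : ℂ) * w p)) atTop (𝓝 0)) :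
    ∫ p in rect γ, u p * fderiv ℝ w p d = -∫ p in rect γ, v p * w p := by
  have hwd : Continuous fun p => fderiv ℝ w p d :=
    (hw.continuous_fderiv (by simp)).clm_apply continuous_const
  have hb' : Tendsto (fun n => (d.2 : ℂ) * ∫ p in rect γ, u p * ((cutDeriv n p.2 : ℂ) * w p))
      atTop (𝓝 0) := by
    rcases hb with hb | hb
    · simp [hb]
    · simpa using hb.const_mul (d.2 : ℂ)
  have e : ∀ n, (∫ p in rect γ, u p * ((cut n p.2 : ℂ) * fderiv ℝ w p d)) +
      (d.2 : ℂ) * ∫ p in rect γ, u p * ((cutDeriv n p.2 : ℂ) * w p) =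
      -∫ p in rect γ, v p * ((cut n p.2 : ℂ) * w p) := by
    intro n
    rw [← h _ (isTest_cut_mul n hw hp), ← integral_const_mul]
    have c1 : Continuous fun p : ℝ × ℝ => (cut n p.2 : ℂ) * fderiv ℝ w p d :=
      (Complex.continuous_ofReal.comp ((contDiff_cut n).continuous.comp continuous_snd)).mul hwd
    have c2 : Continuous fun p : ℝ × ℝ => (cutDeriv n p.2 : ℂ) * w p :=
      (Complex.continuous_ofReal.comp ((continuous_cutDeriv n).comp continuous_snd)).mul
        hw.continuous
    have i1 : Integrable (fun p => u p * ((cut n p.2 : ℂ) * fderiv ℝ w p d))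
        (volume.restrict (rect γ)) := (Lp.memLp u).integrable_mul (memLp_of_continuous γ c1)
    have i2 : Integrable (fun p => u p * ((cutDeriv n p.2 : ℂ) * w p))
        (volume.restrict (rect γ)) := (Lp.memLp u).integrable_mul (memLp_of_continuous γ c2)
    rw [← integral_add i1 (i2.const_mul _)]
    refine integral_congr_ae (ae_of_all _ fun p => ?_)
    simp only
    have f1 : HasFDerivAt (fun p : ℝ × ℝ => (cut n p.2 : ℂ)) _ p :=
      ((hasDerivAt_cut n p.2).ofReal_comp.hasFDerivAt.comp p (hasFDerivAt_snd (𝕜 := ℝ) (p := p)))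
    have f2 : HasFDerivAt (fun p : ℝ × ℝ => (cut n p.2 : ℂ) * w p) _ p :=
      f1.mul (hw.differentiable (by simp) p).hasFDerivAt
    rw [f2.fderiv]
    simp
    ring
  have l1 := (tendsto_integral_cut_mul u hwd).add hb'
  simp_rw [e] at l1
  rw [add_zero] at l1
  exact tendsto_nhds_unique l1 (tendsto_integral_cut_mul v hw.continuous).neg

theorem conj_mode (γ : ℝ) (j : ℕ) (i : ℤ × ℕ) (p : ℝ × ℝ) :
    (starRingEnd ℂ) (mode γ j i p) = mode γ j (-i.1, i.2) p := by
  simp only [mode, modeX, modeY, modeN, map_mul, Complex.conj_ofReal, ← Complex.exp_conj,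
    Complex.conj_I]
  congr 3
  push_cast; ring

theorem coef_eq_integral_mode {γ : ℝ} (u : L2 γ) (i : ℤ × ℕ) :
    coef γ u i = ∫ p in rect γ, u p * mode γ 0 (-i.1, i.2) p := by
  rw [coef_eq_integral]
  simp_rw [conj_mode]

theorem HasWeakDeriv.unique {γ : ℝ} (hγ : 0 < γ) {d : ℝ × ℝ} {u v v' : L2 γ}
    (h : HasWeakDeriv γ d u v) (h' : HasWeakDeriv γ d u v') : v = v' := by
  refine coef_ext hγ fun i => ?_
  rw [coef_eq_integral_mode, coef_eq_integral_mode]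
  have l1 := tendsto_integral_cut_mul v (mode_continuous γ 0 (-i.1, i.2))
  have l2 := tendsto_integral_cut_mul v' (mode_continuous γ 0 (-i.1, i.2))
  refine tendsto_nhds_unique l1 (l2.congr fun n => ?_)
  have ht := isTest_cut_mul n (mode_contDiff γ 0 (-i.1, i.2)) (mode_periodic hγ 0 (-i.1, i.2))
  exact neg_injective ((h' _ ht).symm.trans (h _ ht))

theorem HasWeakDeriv.wd_eq {γ : ℝ} (hγ : 0 < γ) {d : ℝ × ℝ} {u v : L2 γ}
    (h : HasWeakDeriv γ d u v) : wd γ d u = v := by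
  have h' : ∃ v, HasWeakDeriv γ d u v := ⟨v, h⟩
  rw [wd, dif_pos h']
  exact h'.choose_spec.unique hγ h

theorem coef_ex {γ : ℝ} (hγ : 0 < γ) {u v : L2 γ} (h : HasWeakDeriv γ ex u v) (i : ℤ × ℕ) :
    coef γ v i = Complex.I * kx γ i * coef γ u i := by
  have := h.integral_mul (mode_contDiff γ 0 (-i.1, i.2)) (mode_periodic hγ 0 (-i.1, i.2))
    (Or.inl rfl)
  simp only [hasFDerivAt_mode, ex, Complex.ofReal_one, one_mul, Complex.ofReal_zero, zero_mul,
    add_zero] at this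
  rw [coef_eq_integral_mode, coef_eq_integral_mode, ← neg_inj, ← this, ← integral_const_mul,
    ← integral_neg]
  congr 1
  ext p
  simp only [kx]
  push_cast
  ring

/-- Two integrations by parts. For `u` against the cosine, the boundary term dies because `u`
vanishes on the walls; for its derivative against the sine, because the sine does. -/
theorem coef_eyy {γ : ℝ} (hγ : 0 < γ) {u v w : L2 γ} (hu : VanishesOnWalls γ u)
    (h : HasWeakDeriv γ ey u v) (h' : HasWeakDeriv γ ey v w) (i : ℤ × ℕ) :
    coef γ w i = -(ky i : ℂ) ^ 2 * coef γ u i := by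
  set i' : ℤ × ℕ := (-i.1, i.2) with hi'
  have hk : ky i' = ky i := rfl
  have hk0 : 0 ≤ ky i := zero_le_one.trans (one_le_ky i)
  have k1 := h.integral_mul (mode_contDiff γ 1 i') (mode_periodic hγ 1 i')
    (Or.inr (tendsto_boundary_of_vanishes hγ hu (mode_continuous _ _ _)))
  have k2 := h'.integral_mul (mode_contDiff γ 0 i') (mode_periodic hγ 0 i')
    (Or.inr (tendsto_boundary_of_test v (mode_continuous _ _ _) (K := ‖modeN γ‖ * ky i)
      (by positivity) (fun p hp => ?_) (fun p hp => ?_)))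
  · simp only [hasFDerivAt_mode, ey, Complex.ofReal_one, one_mul, Complex.ofReal_zero, zero_mul,
      zero_add, hk] at k1 k2
    have e : ∀ p, mode γ (1 + 1) i' p = -mode γ 0 i' p := by
      intro p
      simp only [mode, modeY]
      rw [show ((i'.2 : ℝ) + 1) * p.2 + ((1 + 1 : ℕ) : ℝ) * (Real.pi / 2) =
        ((i'.2 + 1) * p.2 + ((0 : ℕ) : ℝ) * (Real.pi / 2)) + Real.pi by push_cast; ring,
        Real.sin_add_pi]
      push_cast; ring
    simp_rw [e] at k1
    rw [coef_eq_integral_mode, coef_eq_integral_mode, ← hi', ← neg_inj, ← k2]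
    have r1 : ∫ p in rect γ, u p * (ky i * -mode γ 0 i' p) =
        -(ky i : ℂ) * ∫ p in rect γ, u p * mode γ 0 i' p := by
      rw [← integral_const_mul]; congr 1; ext p; ring
    have r2 : ∫ p in rect γ, v p * (ky i * mode γ 1 i' p) =
        (ky i : ℂ) * ∫ p in rect γ, v p * mode γ 1 i' p := by
      rw [← integral_const_mul]; congr 1; ext p; ring
    rw [r1] at k1
    rw [r2, ← neg_neg (∫ p in rect γ, v p * mode γ 1 i' p), ← k1]
    ring
  · rw [mode, norm_mul, norm_mul, norm_modeX, one_mul, mul_assoc]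
    refine mul_le_mul_of_nonneg_left ?_ (norm_nonneg _)
    have : (0 : ℝ) ≤ ky i * p.2 := mul_nonneg hk0 hp.2.1.le
    rw [modeY, Complex.norm_real, Real.norm_eq_abs]
    simp only [CharP.cast_eq_zero, zero_mul, add_zero]
    exact (Real.abs_sin_le_abs).trans (le_of_eq (abs_of_nonneg this))
  · rw [mode, norm_mul, norm_mul, norm_modeX, one_mul, mul_assoc]
    refine mul_le_mul_of_nonneg_left ?_ (norm_nonneg _)
    have : (0 : ℝ) ≤ ky i * (Real.pi - p.2) := mul_nonneg hk0 (sub_pos.2 hp.2.2).le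
    rw [modeY, Complex.norm_real, Real.norm_eq_abs]
    simp only [CharP.cast_eq_zero, zero_mul, add_zero]
    -- Reflection about `π / 2` changes a sine of integer frequency by at most a sign, which turns
    -- the bound at `y = 0` into the one at `y = π`.
    have e : |Real.sin (((i'.2 : ℝ) + 1) * p.2)| = |Real.sin (ky i * (Real.pi - p.2))| := by
      have := Real.sin_nat_mul_pi_sub (ky i * p.2) (i.2 + 1)
      rw [show ky i * (Real.pi - p.2) = ((i.2 + 1 : ℕ) : ℝ) * Real.pi - ky i * p.2 by
        rw [ky]; push_cast; ring, this, abs_neg, abs_mul]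
      simp [ky, hi']
    rw [e]
    exact (Real.abs_sin_le_abs).trans (le_of_eq (abs_of_nonneg this))

end Cutoff

/-! ### Fourier characterization of the function spaces -/

theorem MemSob.of_succ {γ : ℝ} {n : ℕ} {u : L2 γ} (h : MemSob γ (n + 1) u) : MemSob γ n u := by
  induction n generalizing u with
  | zero => trivial
  | succ n ih =>
    obtain ⟨ux, uy, hx, hy, h1, h2⟩ := h
    exact ⟨ux, uy, hx, hy, ih h1, ih h2⟩

theorem MemSob.add {γ : ℝ} {n : ℕ} {u v : L2 γ} (hu : MemSob γ n u) (hv : MemSob γ n v) :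
    MemSob γ n (u + v) := by
  induction n generalizing u v with
  | zero => trivial
  | succ n ih =>
    obtain ⟨ux, uy, hx, hy, h1, h2⟩ := hu
    obtain ⟨vx, vy, hx', hy', h1', h2'⟩ := hv
    exact ⟨_, _, hx.add hx', hy.add hy', ih h1 h1', ih h2 h2'⟩

theorem MemSob.wd {γ : ℝ} (hγ : 0 < γ) {n : ℕ} {u : L2 γ} (h : MemSob γ (n + 1) u) :
    HasWeakDeriv γ ex u (wd γ ex u) ∧ HasWeakDeriv γ ey u (wd γ ey u) ∧
      MemSob γ n (wd γ ex u) ∧ MemSob γ n (wd γ ey u) := by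
  obtain ⟨ux, uy, hx, hy, h1, h2⟩ := h
  rw [hx.wd_eq hγ, hy.wd_eq hγ]
  exact ⟨hx, hy, h1, h2⟩

theorem MemSob.lap {γ : ℝ} (hγ : 0 < γ) {n : ℕ} {u : L2 γ} (h : MemSob γ (n + 2) u) :
    MemSob γ n (lap γ u) := by
  obtain ⟨-, -, h1, h2⟩ := h.wd hγ
  exact (h1.wd hγ).2.2.1.add (h2.wd hγ).2.2.2

theorem coef_wd_ex {γ : ℝ} (hγ : 0 < γ) {n : ℕ} {u : L2 γ} (h : MemSob γ (n + 1) u) (i : ℤ × ℕ) :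
    coef γ (wd γ ex u) i = Complex.I * kx γ i * coef γ u i :=
  coef_ex hγ (h.wd hγ).1 i

/-- Membership of a single component in the space `H`. -/
def InH (γ : ℝ) (u : L2 γ) : Prop := MemSob γ 2 u ∧ VanishesOnWalls γ u

theorem coef_lap {γ : ℝ} (hγ : 0 < γ) {u : L2 γ} (h : InH γ u) (i : ℤ × ℕ) :
    coef γ (lap γ u) i = -(eig γ i : ℂ) * coef γ u i := by
  obtain ⟨-, hy, h1, h2⟩ := h.1.wd hγ
  rw [lap, coef_add, coef_wd_ex hγ h1, coef_wd_ex hγ h.1, coef_eyy hγ h.2 hy (h2.wd hγ).2.1, eig]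
  push_cast
  linear_combination (kx γ i : ℂ) ^ 2 * coef γ u i * Complex.I_sq

theorem summable_coef {γ : ℝ} (hγ : 0 < γ) (u : L2 γ) : Summable fun i => ‖coef γ u i‖ ^ 2 :=
  (hasSum_norm_sq_coef hγ u).summable

theorem summable_coef_lap {γ : ℝ} (hγ : 0 < γ) {u : L2 γ} (h : InH γ u) {n : ℕ}
    (hs : Summable fun i => eig γ i ^ n * ‖coef γ (lap γ u) i‖ ^ 2) :
    Summable fun i => eig γ i ^ (n + 2) * ‖coef γ u i‖ ^ 2 := by
  convert hs using 2 with i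
  rw [coef_lap hγ h, norm_mul, norm_neg, Complex.norm_real, Real.norm_of_nonneg (eig_pos γ i).le]
  ring

/-- Forward, the Laplacian lies in `L²` and has coefficients `-eig` times those of `u`. Backward,
`u` is its own sine series, and two powers of the weight give both regularity and boundary values.
-/
theorem inH_iff {γ : ℝ} (hγ : 0 < γ) {u : L2 γ} :
    InH γ u ↔ Summable fun i => eig γ i ^ 2 * ‖coef γ u i‖ ^ 2 := by
  refine ⟨fun h => summable_coef_lap hγ h (n := 0) (by simpa using summable_coef hγ _), fun h => ?_⟩
  rw [eq_series_coef hγ u]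
  exact ⟨memSob_series hγ h, vanishesOnWalls_series hγ h⟩

/-- Apply the description of `H` to the Laplacian, which contributes two further powers of `eig`. -/
theorem memDom_iff {γ : ℝ} (hγ : 0 < γ) {u : L2 γ} :
    MemDom γ u ↔ Summable fun i => eig γ i ^ 4 * ‖coef γ u i‖ ^ 2 := by
  constructor
  · rintro ⟨h1, h2, h3⟩
    exact summable_coef_lap hγ ⟨h1.of_succ.of_succ, h2⟩ ((inH_iff hγ).1 ⟨h1.lap hγ, h3⟩)
  · intro h
    have hH : InH γ u := (inH_iff hγ).2 (summable_of_eig_pow (by norm_num) h)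
    refine ⟨?_, hH.2, ?_⟩
    · rw [eq_series_coef hγ u]
      exact memSob_series hγ h
    · refine ((inH_iff hγ).2 ?_).2
      convert h using 2 with i
      rw [coef_lap hγ hH, norm_mul, norm_neg, Complex.norm_real,
        Real.norm_of_nonneg (eig_pos γ i).le]
      ring

theorem MemDom.inH {γ : ℝ} {u : L2 γ} (h : MemDom γ u) : InH γ u :=
  ⟨h.1.of_succ.of_succ, h.2.1⟩

theorem exists_solvesDirichlet {γ s : ℝ} (hγ : 0 < γ) (hs : 0 ≤ s) (v : L2 γ) :
    ∃ u, SolvesDirichlet γ s v u := by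
  have hpos : ∀ i, 0 < eig γ i + s := fun i => by linarith [eig_pos γ i]
  set a : ℤ × ℕ → ℂ := fun i => coef γ v i / ((eig γ i + s : ℝ) : ℂ) with ha
  have h2 : Summable fun i => eig γ i ^ 2 * ‖a i‖ ^ 2 := by
    refine (summable_coef hγ v).of_nonneg_of_le (fun i => by positivity) fun i => ?_
    rw [ha]
    simp only
    rw [norm_div, Complex.norm_real, Real.norm_of_nonneg (hpos i).le, div_pow, mul_div_assoc',
      div_le_iff₀ (pow_pos (hpos i) 2), mul_comm]
    have := eig_pos γ i
    gcongr
    linarith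
  have hc := coef_series hγ (summable_sq_of_eig_pow h2)
  have hH : InH γ (series γ 0 a) := (inH_iff hγ).2 (by simpa only [hc] using h2)
  refine ⟨series γ 0 a, hH.1, hH.2, coef_ext hγ fun i => ?_⟩
  have hne : ((eig γ i + s : ℝ) : ℂ) ≠ 0 := by exact_mod_cast (hpos i).ne'
  rw [coef_add, coef_neg, coef_lap hγ hH, coef_real_smul, hc, ha]
  simp only
  field_simp
  push_cast
  ring

/-- Any solution must have these coefficients, so the choice in the definition is immaterial. -/
theorem coef_solveDirichlet {γ s : ℝ} (hγ : 0 < γ) (hs : 0 ≤ s) (v : L2 γ) (i : ℤ × ℕ) :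
    coef γ (solveDirichlet γ s v) i = coef γ v i / ((eig γ i + s : ℝ) : ℂ) := by
  have h := exists_solvesDirichlet hγ hs v
  rw [solveDirichlet, dif_pos h]
  obtain ⟨h1, h2, h3⟩ := h.choose_spec
  have hne : ((eig γ i + s : ℝ) : ℂ) ≠ 0 := by
    have : 0 < eig γ i + s := by linarith [eig_pos γ i]
    exact_mod_cast this.ne'
  have h4 := congrArg (fun w => coef γ w i) h3
  simp only [coef_add, coef_neg, coef_lap hγ ⟨h1, h2⟩, coef_real_smul] at h4
  rw [eq_div_iff hne, ← h4]
  push_cast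
  ring

/-! ### The Sobolev norm in terms of Fourier coefficients -/

/-- Each order of differentiation produces three terms, each controlled by the same weighted sum;
hence `3 ^ n`. -/
theorem sobNormSq_series_le {γ : ℝ} (hγ : 0 < γ) {n : ℕ} {j : ℕ} {a : ℤ × ℕ → ℂ}
    (ha : Summable fun i => eig γ i ^ n * ‖a i‖ ^ 2) :
    sobNormSq γ n (series γ j a) ≤ 3 ^ n * ∑' i, eig γ i ^ n * ‖a i‖ ^ 2 := by
  induction n generalizing j a with
  | zero =>
    rw [sobNormSq, norm_series_sq hγ j (by simpa using ha)]
    simp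
  | succ n ih =>
    have h1 := summable_of_eig_pow (m := 1) (by omega) ha
    have hx := summable_mul_of_le (norm_kx_sq_le γ) ha
    have hy := summable_mul_of_le (norm_ky_sq_le γ) ha
    rw [sobNormSq, (hasWeakDeriv_ex_series hγ j h1).wd_eq hγ,
      (hasWeakDeriv_ey_series hγ j h1).wd_eq hγ, norm_series_sq hγ j (summable_sq_of_eig_pow ha)]
    have key : ∀ c : ℤ × ℕ → ℂ, (∀ i, ‖c i‖ ^ 2 ≤ eig γ i) →
        ∑' i, eig γ i ^ n * ‖c i * a i‖ ^ 2 ≤ ∑' i, eig γ i ^ (n + 1) * ‖a i‖ ^ 2 := by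
      intro c hc
      refine (summable_mul_of_le hc ha).tsum_le_tsum (fun i => ?_) ha
      have := eig_pos γ i
      calc eig γ i ^ n * ‖c i * a i‖ ^ 2 = ‖c i‖ ^ 2 * (eig γ i ^ n * ‖a i‖ ^ 2) := by
            rw [norm_mul]; ring
        _ ≤ eig γ i * (eig γ i ^ n * ‖a i‖ ^ 2) := by gcongr; exact hc i
        _ = _ := by ring
    have h0 : ∑' i, ‖a i‖ ^ 2 ≤ ∑' i, eig γ i ^ (n + 1) * ‖a i‖ ^ 2 :=
      (summable_sq_of_eig_pow ha).tsum_le_tsum (fun i => le_mul_of_one_le_left (sq_nonneg _)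
        (one_le_pow₀ (one_le_eig γ i))) ha
    have hE : 0 ≤ ∑' i, eig γ i ^ (n + 1) * ‖a i‖ ^ 2 :=
      (tsum_nonneg fun i => sq_nonneg _).trans h0
    have k1 := (ih (j := j) hx).trans
      (mul_le_mul_of_nonneg_left (key _ (norm_kx_sq_le γ)) (by positivity))
    have k2 := (ih (j := j + 1) hy).trans
      (mul_le_mul_of_nonneg_left (key _ (norm_ky_sq_le γ)) (by positivity))
    have h3 : (1 : ℝ) ≤ 3 ^ n := one_le_pow₀ (by norm_num)
    rw [pow_succ]
    nlinarith

/-- The `H²` seminorm `‖Δu‖²` in terms of Fourier coefficients. -/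
def energy (γ : ℝ) (u : L2 γ) : ℝ := ∑' i, eig γ i ^ 2 * ‖coef γ u i‖ ^ 2

theorem sobNormSq_le_energy {γ : ℝ} (hγ : 0 < γ) {u : L2 γ} (h : InH γ u) :
    sobNormSq γ 2 u ≤ 9 * energy γ u := by
  have := sobNormSq_series_le (j := 0) hγ ((inH_iff hγ).1 h)
  rw [← eq_series_coef hγ u] at this
  norm_num at this
  exact this

theorem energy_le_sobNormSq {γ : ℝ} (hγ : 0 < γ) {u : L2 γ} (h : InH γ u) :
    energy γ u ≤ 2 * sobNormSq γ 2 u := by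
  have e : energy γ u = ‖lap γ u‖ ^ 2 := by
    rw [← (hasSum_norm_sq_coef hγ (lap γ u)).tsum_eq, energy]
    congr 1
    ext i
    rw [coef_lap hγ h, norm_mul, norm_neg, Complex.norm_real, Real.norm_of_nonneg (eig_pos γ i).le]
    ring
  rw [e, lap]
  have h1 := norm_add_le (wd γ ex (wd γ ex u)) (wd γ ey (wd γ ey u))
  have h2 := pow_le_pow_left₀ (norm_nonneg _) h1 2
  simp only [sobNormSq]
  nlinarith [sq_nonneg (‖wd γ ex (wd γ ex u)‖ - ‖wd γ ey (wd γ ey u)‖), sq_nonneg ‖u‖,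
    sq_nonneg ‖wd γ ex u‖, sq_nonneg ‖wd γ ey u‖, sq_nonneg ‖wd γ ey (wd γ ex u)‖,
    sq_nonneg ‖wd γ ex (wd γ ey u)‖]

theorem sq_le_of_weighted_le {γ C t x₁ x₂ : ℝ} {a b : ℕ} {i : ℤ × ℕ} (ht : 0 ≤ t)
    (h : eig γ i ^ a * t ≤ C * (eig γ i ^ b * (x₁ + x₂))) :
    eig γ i ^ (2 * a) * t ^ 2 ≤
      2 * C ^ 2 * (eig γ i ^ (2 * b) * x₁ ^ 2 + eig γ i ^ (2 * b) * x₂ ^ 2) := by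
  have h0 := eig_pos γ i
  have h1 := pow_le_pow_left₀ (by positivity) h 2
  have h2 : 0 ≤ C ^ 2 * eig γ i ^ (2 * b) * (x₁ - x₂) ^ 2 := by
    have : 0 ≤ eig γ i ^ (2 * b) := by positivity
    positivity
  calc eig γ i ^ (2 * a) * t ^ 2 = (eig γ i ^ a * t) ^ 2 := by rw [pow_mul']; ring
    _ ≤ (C * (eig γ i ^ b * (x₁ + x₂))) ^ 2 := h1
    _ = C ^ 2 * eig γ i ^ (2 * b) * (x₁ + x₂) ^ 2 := by rw [pow_mul' _ 2 b]; ring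
    _ ≤ _ := by nlinarith

theorem summable_of_weighted_le {γ C : ℝ} {a b : ℕ} {y x₁ x₂ : ℤ × ℕ → ℂ}
    (h : ∀ i, eig γ i ^ a * ‖y i‖ ≤ C * (eig γ i ^ b * (‖x₁ i‖ + ‖x₂ i‖)))
    (h₁ : Summable fun i => eig γ i ^ (2 * b) * ‖x₁ i‖ ^ 2)
    (h₂ : Summable fun i => eig γ i ^ (2 * b) * ‖x₂ i‖ ^ 2) :
    Summable fun i => eig γ i ^ (2 * a) * ‖y i‖ ^ 2 :=
  ((h₁.add h₂).mul_left (2 * C ^ 2)).of_nonneg_of_le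
    (fun i => by have := eig_pos γ i; positivity)
    fun i => sq_le_of_weighted_le (norm_nonneg _) (h i)

theorem energy_le_of_weighted_le {γ C : ℝ} (hγ : 0 < γ) {y x₁ x₂ : L2 γ}
    (h : ∀ i, ‖coef γ y i‖ ≤ C * (‖coef γ x₁ i‖ + ‖coef γ x₂ i‖))
    (h₁ : InH γ x₁) (h₂ : InH γ x₂) :
    energy γ y ≤ 2 * C ^ 2 * (energy γ x₁ + energy γ x₂) := by
  rw [inH_iff hγ] at h₁ h₂
  have hw : ∀ i, eig γ i ^ 1 * ‖coef γ y i‖ ≤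
      C * (eig γ i ^ 1 * (‖coef γ x₁ i‖ + ‖coef γ x₂ i‖)) := fun i => by
    have := mul_le_mul_of_nonneg_left (h i) (eig_pos γ i).le
    rw [pow_one]; linarith
  have hs := summable_of_weighted_le (a := 1) (b := 1) hw h₁ h₂
  rw [energy, energy, energy, ← h₁.tsum_add h₂, ← tsum_mul_left]
  exact hs.tsum_le_tsum (fun i => sq_le_of_weighted_le (a := 1) (b := 1) (norm_nonneg _) (hw i))
    ((h₁.add h₂).mul_left _)

/-! ### The operator `L` on Fourier coefficients -/

/-- The `(1, 1)` entry of the matrix of `L` on a mode. -/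
def m11 (P : Params) (i : ℤ × ℕ) : ℂ :=
  -((P.r + eig P.γ i / P.Re : ℝ) : ℂ) + Complex.I * ((kx P.γ i * P.β / eig P.γ i : ℝ) : ℂ)

/-- The `(1, 2)` entry of the matrix of `L` on a mode. -/
def m12 (P : Params) (i : ℤ × ℕ) : ℂ := -(Complex.I * ((kx P.γ i * P.U : ℝ) : ℂ))

/-- The `(2, 1)` entry of the matrix of `L` on a mode. -/
def m21 (P : Params) (i : ℤ × ℕ) : ℂ :=
  Complex.I * ((kx P.γ i * P.U * ((2 * P.F - eig P.γ i) / (2 * P.F + eig P.γ i)) : ℝ) : ℂ)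

/-- The `(2, 2)` entry of the matrix of `L` on a mode. -/
def m22 (P : Params) (i : ℤ × ℕ) : ℂ :=
  ((eig P.γ i / (2 * P.F + eig P.γ i) : ℝ) : ℂ) * m11 P i

/-- The characteristic polynomial of the matrix of `L` on a mode. -/
def charDet (P : Params) (z : ℂ) (i : ℤ × ℕ) : ℂ :=
  (m11 P i - z) * (m22 P i - z) - m12 P i * m21 P i

section

variable {P : Params}

theorem coef_opL_fst (hγ : 0 < P.γ) {u : L2 P.γ × L2 P.γ} (hu : u ∈ domL P.γ) (i : ℤ × ℕ) :
    coef P.γ (opL P u).1 i = m11 P i * coef P.γ u.1 i + m12 P i * coef P.γ u.2 i := by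
  have h2 : MemSob P.γ 2 (lap P.γ u.2) := hu.2.1.lap hγ
  simp only [opL, opA, opB, R1, Prod.fst_add, Prod.fst_neg, coef_add, coef_neg, coef_sub,
    coef_real_smul, coef_lap hγ hu.1.inH, coef_lap hγ hu.2.inH,
    coef_solveDirichlet hγ le_rfl, coef_wd_ex hγ hu.1.1, coef_wd_ex hγ h2, m11, m12]
  have he : (eig P.γ i : ℂ) ≠ 0 := by exact_mod_cast (eig_pos P.γ i).ne'
  push_cast
  rw [add_zero]
  field_simp
  ring

/-- The terms with `R₂` collapse to one factor: `r - 2rF/(2F + λ) = rλ/(2F + λ)` and `λ - 2F +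
4F²/(2F + λ) = λ²/(2F + λ)`. This is why the second diagonal entry is a multiple of the first. -/
theorem coef_opL_snd (hγ : 0 < P.γ) (hF : 0 ≤ P.F) {u : L2 P.γ × L2 P.γ} (hu : u ∈ domL P.γ)
    (i : ℤ × ℕ) :
    coef P.γ (opL P u).2 i = m21 P i * coef P.γ u.1 i + m22 P i * coef P.γ u.2 i := by
  have h1 : MemSob P.γ 2 (lap P.γ u.1) := hu.1.1.lap hγ
  have hF2 : 0 ≤ 2 * P.F := by positivity
  simp only [opL, opA, opB, R2, Prod.snd_add, Prod.snd_neg, coef_add, coef_neg, coef_sub,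
    coef_real_smul, coef_lap hγ hu.1.inH, coef_lap hγ hu.2.inH,
    coef_solveDirichlet hγ hF2, coef_wd_ex hγ hu.1.1, coef_wd_ex hγ hu.2.1, coef_wd_ex hγ h1, m11,
    m21, m22]
  have he : (eig P.γ i : ℂ) ≠ 0 := by exact_mod_cast (eig_pos P.γ i).ne'
  have he2 : (2 * P.F + eig P.γ i : ℂ) ≠ 0 := by
    have : 0 < 2 * P.F + eig P.γ i := by linarith [eig_pos P.γ i]
    exact_mod_cast this.ne'
  push_cast
  rw [add_comm (eig P.γ i : ℂ) (2 * (P.F : ℂ))]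
  have e1 : (1 / (P.Re : ℂ)) = (P.Re : ℂ)⁻¹ := one_div _
  rw [e1, div_eq_mul_inv (eig P.γ i : ℂ) (P.Re : ℂ)]
  -- With the inverse as an atom, the identity is polynomial in it and needs no nonvanishing of
  -- `Re`.
  generalize (P.Re : ℂ)⁻¹ = q
  field_simp
  ring

/-! ### Bounds on the 2×2 blocks and the resolvent estimate. -/

theorem abs_kx_le (i : ℤ × ℕ) : |kx P.γ i| ≤ eig P.γ i := by
  have h := one_le_ky i
  rw [eig]
  rcases abs_cases (kx P.γ i) with ⟨h1, -⟩ | ⟨h1, -⟩ <;> rw [h1] <;>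
    nlinarith [sq_nonneg (kx P.γ i - 1), sq_nonneg (kx P.γ i + 1)]

theorem abs_ratio_le (hF : 0 ≤ P.F) (i : ℤ × ℕ) :
    |(2 * P.F - eig P.γ i) / (2 * P.F + eig P.γ i)| ≤ 1 := by
  have he := eig_pos P.γ i
  rw [abs_div, abs_of_pos (by linarith : 0 < 2 * P.F + eig P.γ i), div_le_one (by linarith), abs_le]
  constructor <;> linarith

theorem norm_m12 (i : ℤ × ℕ) : ‖m12 P i‖ = |kx P.γ i| * |P.U| := by
  rw [m12, norm_neg, norm_mul, Complex.norm_I, one_mul, Complex.norm_real, Real.norm_eq_abs, abs_mul]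

theorem norm_m21_le (hF : 0 ≤ P.F) (i : ℤ × ℕ) : ‖m21 P i‖ ≤ |kx P.γ i| * |P.U| := by
  rw [m21, norm_mul, Complex.norm_I, one_mul, Complex.norm_real, Real.norm_eq_abs, abs_mul, abs_mul]
  exact mul_le_of_le_one_right (by positivity) (abs_ratio_le hF i)

theorem norm_m11_le (hRe : 0 < P.Re) (hr : 0 ≤ P.r) (i : ℤ × ℕ) :
    ‖m11 P i‖ ≤ (P.r + 1 / P.Re + |P.β|) * eig P.γ i := by
  have he := one_le_eig P.γ i
  have h0 := eig_pos P.γ i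
  rw [m11]
  refine (norm_add_le _ _).trans ?_
  rw [norm_neg, norm_mul, Complex.norm_I, one_mul, Complex.norm_real, Complex.norm_real,
    Real.norm_of_nonneg (by positivity), Real.norm_eq_abs, abs_div, abs_mul, abs_of_pos h0]
  have h1 : |kx P.γ i| * |P.β| / eig P.γ i ≤ |P.β| * eig P.γ i := by
    rw [div_le_iff₀ h0]
    have : |kx P.γ i| ≤ eig P.γ i * eig P.γ i := (abs_kx_le i).trans (by nlinarith)
    nlinarith [mul_le_mul_of_nonneg_right this (abs_nonneg P.β)]
  have h2 : P.r ≤ P.r * eig P.γ i := le_mul_of_one_le_right hr he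
  have h3 : eig P.γ i / P.Re = 1 / P.Re * eig P.γ i := by ring
  linarith

theorem norm_m22_le (hF : 0 ≤ P.F) (i : ℤ × ℕ) : ‖m22 P i‖ ≤ ‖m11 P i‖ := by
  have he := eig_pos P.γ i
  rw [m22, norm_mul, Complex.norm_real, Real.norm_of_nonneg (by positivity)]
  exact mul_le_of_le_one_left (norm_nonneg _) ((div_le_one (by linarith)).2 (by linarith))

theorem mem_domL_iff (hγ : 0 < P.γ) {u : L2 P.γ × L2 P.γ} : u ∈ domL P.γ ↔
    (Summable fun i => eig P.γ i ^ 4 * ‖coef P.γ u.1 i‖ ^ 2) ∧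
      Summable fun i => eig P.γ i ^ 4 * ‖coef P.γ u.2 i‖ ^ 2 := by
  rw [← memDom_iff hγ, ← memDom_iff hγ]; rfl

theorem mem_spaceH_iff {γ : ℝ} {u : L2 γ × L2 γ} : u ∈ spaceH γ ↔ InH γ u.1 ∧ InH γ u.2 := Iff.rfl

/-- All matrix entries are `O(eig)`, so `L - z` trades the weight `eig ^ 4` for `eig ^ 2`. -/
theorem opL_sub_smul_mem_spaceH (hγ : 0 < P.γ) (hRe : 0 < P.Re) (hr : 0 ≤ P.r) (hF : 0 ≤ P.F)
    (z : ℂ) {u : L2 P.γ × L2 P.γ} (hu : u ∈ domL P.γ) : opL P u - z • u ∈ spaceH P.γ := by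
  obtain ⟨h1, h2⟩ := (mem_domL_iff hγ).1 hu
  set C := (P.r + 1 / P.Re + |P.β|) + |P.U| + ‖z‖ with hC
  have hb : ∀ (i : ℤ × ℕ) (a b x y : ℂ), ‖a‖ ≤ (P.r + 1 / P.Re + |P.β|) * eig P.γ i →
      ‖b‖ ≤ |kx P.γ i| * |P.U| → ‖a * x + b * y - z * x‖ ≤ C * (eig P.γ i * (‖x‖ + ‖y‖)) := by
    intro i a b x y ha hb
    have h0 := eig_pos P.γ i
    have hb' : ‖b‖ ≤ |P.U| * eig P.γ i := hb.trans (by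
      rw [mul_comm]; exact mul_le_mul_of_nonneg_left (abs_kx_le i) (abs_nonneg _))
    have hz : ‖z‖ ≤ ‖z‖ * eig P.γ i := le_mul_of_one_le_right (norm_nonneg _) (one_le_eig _ _)
    have hβ := abs_nonneg P.β
    have hU := abs_nonneg P.U
    have hR := one_div_pos.2 hRe
    calc ‖a * x + b * y - z * x‖ ≤ ‖a‖ * ‖x‖ + ‖b‖ * ‖y‖ + ‖z‖ * ‖x‖ := by
          refine (norm_sub_le _ _).trans (add_le_add ((norm_add_le _ _).trans ?_) ?_) <;>
            simp only [norm_mul, le_refl]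
      _ ≤ (P.r + 1 / P.Re + |P.β|) * eig P.γ i * ‖x‖ + |P.U| * eig P.γ i * ‖y‖ +
          ‖z‖ * eig P.γ i * ‖x‖ := by gcongr
      _ ≤ C * (eig P.γ i * (‖x‖ + ‖y‖)) := by
          rw [hC]
          have p1 : 0 ≤ (P.r + 1 / P.Re + |P.β|) * (eig P.γ i * ‖y‖) := by positivity
          have p2 : 0 ≤ |P.U| * (eig P.γ i * ‖x‖) := by positivity
          have p3 : 0 ≤ ‖z‖ * (eig P.γ i * ‖y‖) := by positivity
          linarith
  refine mem_spaceH_iff.2 ⟨(inH_iff hγ).2 ?_, (inH_iff hγ).2 ?_⟩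
  · refine summable_of_weighted_le (a := 1) (b := 2) (C := C) (fun i => ?_) h1 h2
    rw [Prod.fst_sub, Prod.smul_fst, coef_sub, coef_smul, coef_opL_fst hγ hu, pow_one]
    have := mul_le_mul_of_nonneg_left (hb i (m11 P i) (m12 P i) (coef P.γ u.1 i) (coef P.γ u.2 i)
      (norm_m11_le hRe hr i) (norm_m12 i).le) (eig_pos P.γ i).le
    rw [pow_two]; linarith
  · refine summable_of_weighted_le (a := 1) (b := 2) (C := C) (fun i => ?_) h2 h1
    rw [Prod.snd_sub, Prod.smul_snd, coef_sub, coef_smul, coef_opL_snd hγ hF hu, pow_one,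
      add_comm (m21 P i * _)]
    have := mul_le_mul_of_nonneg_left (hb i (m22 P i) (m21 P i) (coef P.γ u.2 i) (coef P.γ u.1 i)
      ((norm_m22_le hF i).trans (norm_m11_le hRe hr i)) (norm_m21_le hF i)) (eig_pos P.γ i).le
    rw [pow_two]; linarith

/-- Diagonal dominance. The real parts of both diagonal entries are at most `-c₀ eig`, while the
off-diagonal ones are bounded by `|kx| |U| ≤ √eig |U|`. Of `c₀ eig`, one quarter absorbs the
off-diagonal entries up to a constant, another absorbs that constant and `z`, and one half remains.
-/
theorem resolvent_bound_of_large (hRe : 0 < P.Re) (hr : 0 ≤ P.r) (hF : 0 ≤ P.F) (z : ℂ) :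
    ∃ c Λ : ℝ, 0 < c ∧ 0 < Λ ∧ ∀ i, Λ ≤ eig P.γ i → ∀ x y : ℂ, eig P.γ i * (‖x‖ + ‖y‖) ≤
      c * (‖(m11 P i - z) * x + m12 P i * y‖ + ‖m21 P i * x + (m22 P i - z) * y‖) := by
  set c₀ := 1 / (P.Re * (2 * P.F + 1)) with hc₀
  have hc : 0 < c₀ := by positivity
  refine ⟨2 / c₀, 4 / c₀ * (‖z‖ + |P.U| ^ 2 / c₀ + 1), by positivity, by positivity,
    fun i hi x y => ?_⟩
  have h0 := eig_pos P.γ i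
  have he := one_le_eig P.γ i
  have hs : c₀ * eig P.γ i ≤ eig P.γ i / (2 * P.F + eig P.γ i) * (P.r + eig P.γ i / P.Re) := by
    -- The quotient increases with `eig`, and `eig ≥ 1`; this is the source of `c₀`.
    have h1 : 1 / (2 * P.F + 1) ≤ eig P.γ i / (2 * P.F + eig P.γ i) := by
      rw [div_le_div_iff₀ (by linarith) (by linarith)]; nlinarith
    calc c₀ * eig P.γ i = 1 / (2 * P.F + 1) * (eig P.γ i / P.Re) := by rw [hc₀]; field_simp
      _ ≤ eig P.γ i / (2 * P.F + eig P.γ i) * (P.r + eig P.γ i / P.Re) := by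
          gcongr; linarith
  have hle : eig P.γ i / (2 * P.F + eig P.γ i) ≤ 1 := (div_le_one (by linarith)).2 (by linarith)
  have r11 : (m11 P i).re = -(P.r + eig P.γ i / P.Re) := by
    simp [m11, Complex.add_re, Complex.mul_re]
  have r22 : (m22 P i).re =
      -(eig P.γ i / (2 * P.F + eig P.γ i) * (P.r + eig P.γ i / P.Re)) := by
    rw [m22, Complex.re_ofReal_mul, r11]; ring
  have hzre := neg_le_of_abs_le (Complex.abs_re_le_norm z)
  have n22 : c₀ * eig P.γ i - ‖z‖ ≤ ‖m22 P i - z‖ := by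
    have := neg_le_of_abs_le (Complex.abs_re_le_norm (m22 P i - z))
    rw [Complex.sub_re, r22] at this
    linarith
  have n11 : c₀ * eig P.γ i - ‖z‖ ≤ ‖m11 P i - z‖ := by
    have := neg_le_of_abs_le (Complex.abs_re_le_norm (m11 P i - z))
    rw [Complex.sub_re, r11] at this
    have h2 : eig P.γ i / (2 * P.F + eig P.γ i) * (P.r + eig P.γ i / P.Re) ≤
        P.r + eig P.γ i / P.Re := mul_le_of_le_one_left (by positivity) hle
    linarith
  have hoff : |kx P.γ i| * |P.U| ≤ c₀ / 4 * eig P.γ i + |P.U| ^ 2 / c₀ := by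
    have h1 : |kx P.γ i| ^ 2 ≤ eig P.γ i := by rw [sq_abs, eig]; nlinarith [sq_nonneg (ky i)]
    have h2 : |kx P.γ i| * |P.U| ≤ c₀ / 4 * |kx P.γ i| ^ 2 + |P.U| ^ 2 / c₀ := by
      have h3 : c₀ / 4 * |kx P.γ i| ^ 2 + |P.U| ^ 2 / c₀ - |kx P.γ i| * |P.U| =
          (c₀ * |kx P.γ i| / 2 - |P.U|) ^ 2 / c₀ := by field_simp; ring
      have h4 : 0 ≤ (c₀ * |kx P.γ i| / 2 - |P.U|) ^ 2 / c₀ := by positivity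
      linarith
    have h5 := mul_le_mul_of_nonneg_left h1 (by positivity : 0 ≤ c₀ / 4)
    linarith
  have hbig : ‖z‖ + |P.U| ^ 2 / c₀ ≤ c₀ / 4 * eig P.γ i := by
    have h1 := mul_le_mul_of_nonneg_left hi (by positivity : 0 ≤ c₀ / 4)
    have h2 : c₀ / 4 * (4 / c₀ * (‖z‖ + |P.U| ^ 2 / c₀ + 1)) = ‖z‖ + |P.U| ^ 2 / c₀ + 1 := by
      field_simp
    linarith
  set p := ‖(m11 P i - z) * x + m12 P i * y‖ with hp
  set q := ‖m21 P i * x + (m22 P i - z) * y‖ with hq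
  have e1 : ‖m11 P i - z‖ * ‖x‖ ≤ p + |kx P.γ i| * |P.U| * ‖y‖ := by
    rw [← norm_mul, ← norm_m12, ← norm_mul, hp]
    calc _ = ‖((m11 P i - z) * x + m12 P i * y) - m12 P i * y‖ := by congr 1; ring
      _ ≤ _ := norm_sub_le _ _
  have e2 : ‖m22 P i - z‖ * ‖y‖ ≤ q + |kx P.γ i| * |P.U| * ‖x‖ := by
    refine le_trans ?_ (add_le_add_right (mul_le_mul_of_nonneg_right (norm_m21_le hF i)
      (norm_nonneg x)) q)
    rw [← norm_mul, ← norm_mul, hq]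
    calc _ = ‖(m21 P i * x + (m22 P i - z) * y) - m21 P i * x‖ := by congr 1; ring
      _ ≤ _ := norm_sub_le _ _
  have hx := norm_nonneg x
  have hy := norm_nonneg y
  have f1 := mul_le_mul_of_nonneg_right n11 hx
  have f2 := mul_le_mul_of_nonneg_right n22 hy
  have f3 := mul_le_mul_of_nonneg_right hoff (add_nonneg hx hy)
  have f4 := mul_le_mul_of_nonneg_right hbig (add_nonneg hx hy)
  have key : c₀ / 2 * (eig P.γ i * (‖x‖ + ‖y‖)) ≤ p + q := by linarith
  calc eig P.γ i * (‖x‖ + ‖y‖) = 2 / c₀ * (c₀ / 2 * (eig P.γ i * (‖x‖ + ‖y‖))) := by field_simp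
    _ ≤ 2 / c₀ * (p + q) := mul_le_mul_of_nonneg_left key (by positivity)

theorem resolvent_bound (hγ : 0 < P.γ) (hRe : 0 < P.Re) (hr : 0 ≤ P.r) (hF : 0 ≤ P.F) {z : ℂ}
    (hz : ∀ i, charDet P z i ≠ 0) : ∃ C, 0 ≤ C ∧ ∀ i, ∀ x y : ℂ, eig P.γ i * (‖x‖ + ‖y‖) ≤
      C * (‖(m11 P i - z) * x + m12 P i * y‖ + ‖m21 P i * x + (m22 P i - z) * y‖) := by
  obtain ⟨c, Λ, hc, hΛ, hlarge⟩ := resolvent_bound_of_large (P := P) hRe hr hF z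
  -- Summability of `eig⁻²` forces `eig` to infinity, so only finitely many modes escape the
  -- large-mode estimate.
  have hfin : {i | eig P.γ i < Λ}.Finite := by
    have h1 := (summable_eig_inv_sq hγ).tendsto_cofinite_zero.eventually
      (gt_mem_nhds (by positivity : 0 < (Λ ^ 2)⁻¹))
    refine (Filter.eventually_cofinite.1 h1).subset fun i hi => ?_
    rw [mem_ofPred_eq, not_lt]
    have h0 := eig_pos P.γ i
    exact inv_anti₀ (by positivity) (pow_le_pow_left₀ h0.le (le_of_lt hi) 2)
  -- Cramer's rule bounds the inverse of a single block by this quantity over `eig`.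
  set D : ℤ × ℕ → ℝ := fun i => eig P.γ i *
    (‖m11 P i - z‖ + ‖m12 P i‖ + ‖m21 P i‖ + ‖m22 P i - z‖) / ‖charDet P z i‖ with hD
  have hD0 : ∀ i, 0 ≤ D i := fun i => by have := eig_pos P.γ i; positivity
  have hsum : 0 ≤ ∑ i ∈ hfin.toFinset, D i := Finset.sum_nonneg fun i _ => hD0 i
  refine ⟨c + ∑ i ∈ hfin.toFinset, D i, by positivity, fun i x y => ?_⟩
  set p := (m11 P i - z) * x + m12 P i * y with hp
  set q := m21 P i * x + (m22 P i - z) * y with hq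
  have hpq : 0 ≤ ‖p‖ + ‖q‖ := by positivity
  by_cases hi : Λ ≤ eig P.γ i
  · exact (hlarge i hi x y).trans (mul_le_mul_of_nonneg_right (by linarith) hpq)
  · have hmem : i ∈ hfin.toFinset := by simpa using hi
    have h1 : D i ≤ ∑ i ∈ hfin.toFinset, D i :=
      Finset.single_le_sum (fun i _ => hD0 i) hmem
    refine le_trans ?_ (mul_le_mul_of_nonneg_right (by linarith : D i ≤ _) hpq)
    have h0 := eig_pos P.γ i
    have hd : 0 < ‖charDet P z i‖ := norm_pos_iff.2 (hz i)
    have ex : charDet P z i * x = (m22 P i - z) * p - m12 P i * q := by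
      rw [charDet, hp, hq]; ring
    have ey : charDet P z i * y = (m11 P i - z) * q - m21 P i * p := by
      rw [charDet, hp, hq]; ring
    have bx : ‖charDet P z i‖ * ‖x‖ ≤ ‖m22 P i - z‖ * ‖p‖ + ‖m12 P i‖ * ‖q‖ := by
      rw [← norm_mul, ex, ← norm_mul, ← norm_mul]; exact norm_sub_le _ _
    have by' : ‖charDet P z i‖ * ‖y‖ ≤ ‖m11 P i - z‖ * ‖q‖ + ‖m21 P i‖ * ‖p‖ := by
      rw [← norm_mul, ey, ← norm_mul, ← norm_mul]; exact norm_sub_le _ _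
    rw [hD]
    simp only
    rw [div_mul_eq_mul_div, le_div_iff₀ hd, mul_assoc, mul_assoc]
    refine mul_le_mul_of_nonneg_left ?_ h0.le
    have q1 : 0 ≤ ‖m11 P i - z‖ * ‖p‖ := by positivity
    have q2 : 0 ≤ ‖m12 P i‖ * ‖p‖ := by positivity
    have q3 : 0 ≤ ‖m21 P i‖ * ‖q‖ := by positivity
    have q4 : 0 ≤ ‖m22 P i - z‖ * ‖q‖ := by positivity
    linarith

/-- Solve block by block with Cramer's rule. The factor `eig` gained in `resolvent_bound` puts the
solution in the domain, and the same estimate gives injectivity and boundedness. -/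
theorem mem_resolventL (hγ : 0 < P.γ) (hRe : 0 < P.Re) (hr : 0 ≤ P.r) (hF : 0 ≤ P.F) {z : ℂ}
    (hz : ∀ i, charDet P z i ≠ 0) : z ∈ resolventL P := by
  obtain ⟨C, hC0, hC⟩ := resolvent_bound hγ hRe hr hF hz
  have c1 : ∀ {u}, u ∈ domL P.γ → ∀ i, coef P.γ (opL P u - z • u).1 i =
      (m11 P i - z) * coef P.γ u.1 i + m12 P i * coef P.γ u.2 i := fun hu i => by
    rw [Prod.fst_sub, Prod.smul_fst, coef_sub, coef_smul, coef_opL_fst hγ hu]; ring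
  have c2 : ∀ {u}, u ∈ domL P.γ → ∀ i, coef P.γ (opL P u - z • u).2 i =
      m21 P i * coef P.γ u.1 i + (m22 P i - z) * coef P.γ u.2 i := fun hu i => by
    rw [Prod.snd_sub, Prod.smul_snd, coef_sub, coef_smul, coef_opL_snd hγ hF hu]; ring
  -- Under the root, `9` and `2` compare the Sobolev norm with the energy, and `4 * C ^ 2` adds the
  -- estimates of the two components.
  refine ⟨⟨fun u hu => opL_sub_smul_mem_spaceH hγ hRe hr hF z hu, fun u hu v hv huv => ?_,
    fun v hv => ?_⟩, √(9 * (4 * C ^ 2) * 2), fun u hu => ?_⟩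
  · have hi : ∀ i, coef P.γ u.1 i = coef P.γ v.1 i ∧ coef P.γ u.2 i = coef P.γ v.2 i := by
      intro i
      have g1 := congrArg (fun w : L2 P.γ × L2 P.γ => coef P.γ w.1 i) huv
      have g2 := congrArg (fun w : L2 P.γ × L2 P.γ => coef P.γ w.2 i) huv
      simp only [c1 hu, c1 hv, c2 hu, c2 hv] at g1 g2
      have b := hC i (coef P.γ u.1 i - coef P.γ v.1 i) (coef P.γ u.2 i - coef P.γ v.2 i)
      rw [show (m11 P i - z) * (coef P.γ u.1 i - coef P.γ v.1 i) +
          m12 P i * (coef P.γ u.2 i - coef P.γ v.2 i) = 0 by linear_combination g1,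
        show m21 P i * (coef P.γ u.1 i - coef P.γ v.1 i) +
          (m22 P i - z) * (coef P.γ u.2 i - coef P.γ v.2 i) = 0 by linear_combination g2,
        norm_zero, add_zero, mul_zero] at b
      have b' := nonpos_of_mul_nonpos_right b (eig_pos P.γ i)
      have n1 := norm_nonneg (coef P.γ u.1 i - coef P.γ v.1 i)
      have n2 := norm_nonneg (coef P.γ u.2 i - coef P.γ v.2 i)
      exact ⟨sub_eq_zero.1 (norm_eq_zero.1 (by linarith)),
        sub_eq_zero.1 (norm_eq_zero.1 (by linarith))⟩
    exact Prod.ext (coef_ext hγ fun i => (hi i).1) (coef_ext hγ fun i => (hi i).2)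
  · obtain ⟨hv1, hv2⟩ := mem_spaceH_iff.1 hv
    rw [inH_iff hγ] at hv1 hv2
    set a : ℤ × ℕ → ℂ := fun i =>
      ((m22 P i - z) * coef P.γ v.1 i - m12 P i * coef P.γ v.2 i) / charDet P z i with ha
    set b : ℤ × ℕ → ℂ := fun i =>
      ((m11 P i - z) * coef P.γ v.2 i - m21 P i * coef P.γ v.1 i) / charDet P z i with hb
    have e1 : ∀ i, (m11 P i - z) * a i + m12 P i * b i = coef P.γ v.1 i := fun i => by
      have := hz i
      rw [ha, hb]
      simp only
      field_simp
      rw [charDet]; ring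
    have e2 : ∀ i, m21 P i * a i + (m22 P i - z) * b i = coef P.γ v.2 i := fun i => by
      have := hz i
      rw [ha, hb]
      simp only
      field_simp
      rw [charDet]; ring
    have hab : ∀ i, eig P.γ i * (‖a i‖ + ‖b i‖) ≤ C * (‖coef P.γ v.1 i‖ + ‖coef P.γ v.2 i‖) :=
      fun i => by have := hC i (a i) (b i); rwa [e1, e2] at this
    have hw : ∀ i (t : ℝ), t ≤ ‖a i‖ + ‖b i‖ → eig P.γ i ^ 2 * t ≤
        C * (eig P.γ i ^ 1 * (‖coef P.γ v.1 i‖ + ‖coef P.γ v.2 i‖)) := fun i t ht => by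
      have h0 := eig_pos P.γ i
      have k1 := mul_le_mul_of_nonneg_left (hab i) h0.le
      have k2 := mul_le_mul_of_nonneg_left ht (by positivity : 0 ≤ eig P.γ i ^ 2)
      rw [pow_one]; linarith
    have sa := summable_of_weighted_le (a := 2) (b := 1) (y := a)
      (fun i => hw i _ (le_add_of_nonneg_right (norm_nonneg _))) hv1 hv2
    have sb := summable_of_weighted_le (a := 2) (b := 1) (y := b)
      (fun i => hw i _ (le_add_of_nonneg_left (norm_nonneg _))) hv1 hv2
    have ca := coef_series hγ (summable_sq_of_eig_pow sa)
    have cb := coef_series hγ (summable_sq_of_eig_pow sb)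
    have hu : (series P.γ 0 a, series P.γ 0 b) ∈ domL P.γ :=
      (mem_domL_iff hγ).2 ⟨by simpa only [ca] using sa, by simpa only [cb] using sb⟩
    refine ⟨_, hu, Prod.ext (coef_ext hγ fun i => ?_) (coef_ext hγ fun i => ?_)⟩
    · simp only [c1 hu, ca, cb, e1]
    · simp only [c2 hu, ca, cb, e2]
  · set w := opL P u - z • u with hw
    obtain ⟨hw1, hw2⟩ := mem_spaceH_iff.1 (opL_sub_smul_mem_spaceH hγ hRe hr hF z hu)
    have hb : ∀ i, ‖coef P.γ u.1 i‖ + ‖coef P.γ u.2 i‖ ≤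
        C * (‖coef P.γ w.1 i‖ + ‖coef P.γ w.2 i‖) := fun i => by
      rw [hw, c1 hu, c2 hu]
      exact (le_mul_of_one_le_left (by positivity) (one_le_eig P.γ i)).trans (hC i _ _)
    have b1 := energy_le_of_weighted_le hγ (y := u.1)
      (fun i => (le_add_of_nonneg_right (norm_nonneg _)).trans (hb i)) hw1 hw2
    have b2 := energy_le_of_weighted_le hγ (y := u.2)
      (fun i => (le_add_of_nonneg_left (norm_nonneg _)).trans (hb i)) hw1 hw2
    have s1 := sobNormSq_le_energy hγ hu.1.inH
    have s2 := sobNormSq_le_energy hγ hu.2.inH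
    have t1 := energy_le_sobNormSq hγ hw1
    have t2 := energy_le_sobNormSq hγ hw2
    rw [normH, normH, ← Real.sqrt_mul (by positivity)]
    refine Real.sqrt_le_sqrt ?_
    have t3 := mul_le_mul_of_nonneg_left (add_le_add t1 t2) (by positivity : 0 ≤ 4 * C ^ 2)
    linarith

/-! ### Single modes, kernel vectors and the spectrum. -/

theorem coef_mode_smul (hγ : 0 < P.γ) (a : ℂ) (i i' : ℤ × ℕ) :
    coef P.γ (a • modeLp P.γ 0 i) i' = if i' = i then a else 0 := by
  rw [coef_smul, coef_modeLp hγ]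
  split_ifs <;> simp

theorem mode_mem_domL (hγ : 0 < P.γ) (a b : ℂ) (i : ℤ × ℕ) :
    (a • modeLp P.γ 0 i, b • modeLp P.γ 0 i) ∈ domL P.γ := by
  have h : ∀ a : ℂ, Summable fun i' => eig P.γ i' ^ 4 * ‖coef P.γ (a • modeLp P.γ 0 i) i'‖ ^ 2 := by
    intro a
    refine summable_of_ne_finset_zero (s := {i}) fun i' hi' => ?_
    rw [Finset.mem_singleton] at hi'
    rw [coef_mode_smul hγ, if_neg hi']
    simp
  exact (mem_domL_iff hγ).2 ⟨h a, h b⟩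

theorem opL_mode (hγ : 0 < P.γ) (hF : 0 ≤ P.F) (a b : ℂ) (i : ℤ × ℕ) :
    opL P (a • modeLp P.γ 0 i, b • modeLp P.γ 0 i) =
      ((m11 P i * a + m12 P i * b) • modeLp P.γ 0 i,
        (m21 P i * a + m22 P i * b) • modeLp P.γ 0 i) := by
  have hu := mode_mem_domL hγ a b i
  refine Prod.ext (coef_ext hγ fun i' => ?_) (coef_ext hγ fun i' => ?_)
  · rw [coef_opL_fst hγ hu]
    simp only [coef_mode_smul hγ]
    split_ifs with h
    · rw [h]
    · simp
  · rw [coef_opL_snd hγ hF hu]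
    simp only [coef_mode_smul hγ]
    split_ifs with h
    · rw [h]
    · simp

theorem not_mem_resolventL (hγ : 0 < P.γ) (hF : 0 ≤ P.F) {z : ℂ} {i : ℤ × ℕ}
    (hz : charDet P z i = 0) : z ∉ resolventL P := by
  rintro ⟨⟨-, hinj, -⟩, -⟩
  obtain ⟨a, b, hab, h1, h2⟩ : ∃ a b : ℂ, ¬(a = 0 ∧ b = 0) ∧
      (m11 P i - z) * a + m12 P i * b = 0 ∧ m21 P i * a + (m22 P i - z) * b = 0 := by
    rw [charDet] at hz
    -- A nonzero kernel vector of a singular 2×2 matrix is orthogonal to a nonzero row; if both rows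
    -- vanish, any vector serves.
    by_cases h : m12 P i = 0 ∧ m11 P i - z = 0
    · by_cases h' : m22 P i - z = 0 ∧ m21 P i = 0
      · exact ⟨1, 0, by simp, by simp [h.2], by simp [h'.2]⟩
      · exact ⟨m22 P i - z, -m21 P i, by simpa using h', by simp [h.1, h.2], by ring⟩
    · exact ⟨-m12 P i, m11 P i - z, by simpa using h, by ring, by linear_combination hz⟩
  have key : ∀ a b : ℂ, (m11 P i - z) * a + m12 P i * b = 0 →
      m21 P i * a + (m22 P i - z) * b = 0 →
      opL P (a • modeLp P.γ 0 i, b • modeLp P.γ 0 i) -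
        z • (a • modeLp P.γ 0 i, b • modeLp P.γ 0 i) = 0 := by
    intro a b h1 h2
    rw [opL_mode hγ hF, Prod.smul_mk, Prod.mk_sub_mk, smul_smul, smul_smul, ← sub_smul, ← sub_smul,
      show m11 P i * a + m12 P i * b - z * a = 0 by linear_combination h1,
      show m21 P i * a + m22 P i * b - z * b = 0 by linear_combination h2]
    simp
  have h3 := hinj (mode_mem_domL hγ a b i) (mode_mem_domL hγ 0 0 i)
    ((key a b h1 h2).trans (key 0 0 (by simp) (by simp)).symm)
  have h4 := congrArg (fun w : L2 P.γ × L2 P.γ => coef P.γ w.1 i) h3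
  have h5 := congrArg (fun w : L2 P.γ × L2 P.γ => coef P.γ w.2 i) h3
  simp only [coef_mode_smul hγ, if_true] at h4 h5
  exact hab ⟨h4, h5⟩

theorem mem_spectrumL_iff (hγ : 0 < P.γ) (hRe : 0 < P.Re) (hr : 0 ≤ P.r) (hF : 0 ≤ P.F) {z : ℂ} :
    z ∈ spectrumL P ↔ ∃ i, charDet P z i = 0 := by
  constructor
  · intro h
    by_contra! hne
    exact h (mem_resolventL hγ hRe hr hF hne)
  · rintro ⟨i, hi⟩
    exact not_mem_resolventL hγ hF hi

end

/-! ### The explicit eigenvalues and invariant subspaces -/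

section

variable {P : Params}

theorem add_mem_domL (hγ : 0 < P.γ) {u v : L2 P.γ × L2 P.γ} (hu : u ∈ domL P.γ)
    (hv : v ∈ domL P.γ) : u + v ∈ domL P.γ := by
  rw [mem_domL_iff hγ] at *
  have key : ∀ x y : L2 P.γ, (Summable fun i => eig P.γ i ^ 4 * ‖coef P.γ x i‖ ^ 2) →
      (Summable fun i => eig P.γ i ^ 4 * ‖coef P.γ y i‖ ^ 2) →
      Summable fun i => eig P.γ i ^ 4 * ‖coef P.γ (x + y) i‖ ^ 2 := fun x y hx hy =>
    summable_of_weighted_le (a := 2) (b := 2) (C := 1) (fun i => by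
      rw [one_mul, coef_add]
      have := eig_pos P.γ i
      gcongr
      exact norm_add_le _ _) hx hy
  exact ⟨key _ _ hu.1 hv.1, key _ _ hu.2 hv.2⟩

theorem smul_mem_domL (hγ : 0 < P.γ) (c : ℂ) {u : L2 P.γ × L2 P.γ} (hu : u ∈ domL P.γ) :
    c • u ∈ domL P.γ := by
  rw [mem_domL_iff hγ] at *
  have key : ∀ x : L2 P.γ, (Summable fun i => eig P.γ i ^ 4 * ‖coef P.γ x i‖ ^ 2) →
      Summable fun i => eig P.γ i ^ 4 * ‖coef P.γ (c • x) i‖ ^ 2 := fun x hx => by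
    refine (hx.mul_left (‖c‖ ^ 2)).congr fun i => ?_
    rw [coef_smul, norm_mul]; ring
  exact ⟨key _ hu.1, key _ hu.2⟩

/-- Weak derivatives and solution operators are defined by choice, so linearity is obtained on the
domain, where the coefficient formulas hold. -/
theorem opL_add (hγ : 0 < P.γ) (hF : 0 ≤ P.F) {u v : L2 P.γ × L2 P.γ} (hu : u ∈ domL P.γ)
    (hv : v ∈ domL P.γ) : opL P (u + v) = opL P u + opL P v := by
  have h := add_mem_domL hγ hu hv
  refine Prod.ext (coef_ext hγ fun i => ?_) (coef_ext hγ fun i => ?_)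
  · simp only [coef_opL_fst hγ h, Prod.fst_add, Prod.snd_add, coef_add, coef_opL_fst hγ hu,
      coef_opL_fst hγ hv]
    ring
  · simp only [coef_opL_snd hγ hF h, Prod.fst_add, Prod.snd_add, coef_add, coef_opL_snd hγ hF hu,
      coef_opL_snd hγ hF hv]
    ring

theorem opL_smul (hγ : 0 < P.γ) (hF : 0 ≤ P.F) (c : ℂ) {u : L2 P.γ × L2 P.γ}
    (hu : u ∈ domL P.γ) : opL P (c • u) = c • opL P u := by
  have h := smul_mem_domL hγ c hu
  refine Prod.ext (coef_ext hγ fun i => ?_) (coef_ext hγ fun i => ?_)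
  · simp only [coef_opL_fst hγ h, Prod.smul_fst, Prod.smul_snd, coef_smul, coef_opL_fst hγ hu]
    ring
  · simp only [coef_opL_snd hγ hF h, Prod.smul_fst, Prod.smul_snd, coef_smul,
      coef_opL_snd hγ hF hu]
    ring

/-- The eigenvector of `L` on a mode for the eigenvalue `z`. -/
def eigVec (P : Params) (z : ℂ) (i : ℤ × ℕ) : L2 P.γ × L2 P.γ :=
  (m12 P i • modeLp P.γ 0 i, (z - m11 P i) • modeLp P.γ 0 i)

/-- The first row of the eigenvalue equation holds by construction, and the second is the vanishing
of the determinant. -/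
theorem opL_eigVec (hγ : 0 < P.γ) (hF : 0 ≤ P.F) {z : ℂ} {i : ℤ × ℕ} (hz : charDet P z i = 0) :
    opL P (eigVec P z i) = z • eigVec P z i := by
  rw [charDet] at hz
  rw [eigVec, opL_mode hγ hF, Prod.smul_mk, smul_smul, smul_smul]
  congr 2
  · ring
  · linear_combination -hz

theorem eigVec_mem_domL (hγ : 0 < P.γ) (z : ℂ) (i : ℤ × ℕ) : eigVec P z i ∈ domL P.γ :=
  mode_mem_domL hγ _ _ i

theorem eig_neg (γ : ℝ) (k : ℤ) (m : ℕ) : eig γ (-k, m) = eig γ (k, m) := by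
  simp [eig, kx, ky]

theorem eig_natCast (k m : ℕ) : eig P.γ ((k : ℤ), m) = lam P k (m + 1) := by
  simp [eig, kx, ky, lam]; ring

theorem kx_neg (γ : ℝ) (k : ℤ) (m : ℕ) : kx γ (-k, m) = -kx γ (k, m) := by
  simp [kx]

theorem m11_conj (k : ℤ) (m : ℕ) : m11 P (k, m) = (starRingEnd ℂ) (m11 P (-k, m)) := by
  simp only [m11, eig_neg, kx_neg, map_add, map_neg, map_mul, Complex.conj_ofReal, Complex.conj_I]
  push_cast; ring

theorem m12_conj (k : ℤ) (m : ℕ) : m12 P (k, m) = (starRingEnd ℂ) (m12 P (-k, m)) := by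
  simp only [m12, kx_neg, map_neg, map_mul, Complex.conj_ofReal, Complex.conj_I]
  push_cast; ring

theorem m21_conj (k : ℤ) (m : ℕ) : m21 P (k, m) = (starRingEnd ℂ) (m21 P (-k, m)) := by
  simp only [m21, eig_neg, kx_neg, map_mul, Complex.conj_ofReal, Complex.conj_I]
  push_cast; ring

theorem m22_conj (k : ℤ) (m : ℕ) : m22 P (k, m) = (starRingEnd ℂ) (m22 P (-k, m)) := by
  rw [m22, m22, map_mul, ← m11_conj, Complex.conj_ofReal, eig_neg]

theorem charDet_conj (z : ℂ) (k : ℤ) (m : ℕ) :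
    charDet P ((starRingEnd ℂ) z) (k, m) = (starRingEnd ℂ) (charDet P z (-k, m)) := by
  rw [charDet, charDet, m11_conj, m12_conj, m21_conj, m22_conj]
  simp only [map_sub, map_mul]

/-- The sign convention of `eta` matches the mode `exp(-iγkx)`, so `μ` belongs to wavenumber `-k`
and its conjugate to `k`. -/
theorem m11_neg_natCast (k m : ℕ) : m11 P (-(k : ℤ), m) = -eta P k (m + 1) := by
  rw [m11, eta, eig_neg, eig_natCast, kx_neg]
  simp only [kx]
  push_cast; ring

theorem m12_neg_natCast (k m : ℕ) :
    m12 P (-(k : ℤ), m) = Complex.I * ((P.γ * k * P.U : ℝ) : ℂ) := by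
  simp only [m12, kx]
  push_cast; ring

/-- The quadratic formula. Of the square root only its defining identity matters, so the branch is
irrelevant to the product. -/
theorem charDet_neg_natCast (hF : 0 ≤ P.F) (z : ℂ) (k m : ℕ) :
    charDet P z (-(k : ℤ), m) = (z - mu P 1 k (m + 1)) * (z - mu P (-1) k (m + 1)) := by
  have hpos : 0 < 2 * P.F + lam P k (m + 1) := by
    have := eig_pos P.γ ((k : ℤ), m)
    rw [eig_natCast] at this
    linarith
  have hne : (2 * (P.F : ℂ) + lam P k (m + 1)) ≠ 0 := by exact_mod_cast hpos.ne'
  rw [charDet, m22, m11_neg_natCast, m12_neg_natCast, m21, eig_neg, eig_natCast, mu, mu]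
  simp only [kx, Units.val_one, Units.val_neg, Int.cast_one, Int.cast_neg, Int.cast_natCast]
  set D := (P.F : ℂ) ^ 2 * eta P k (m + 1) ^ 2 + (P.γ : ℂ) ^ 2 * (k : ℂ) ^ 2 * (P.U : ℂ) ^ 2 *
          (4 * (P.F : ℂ) ^ 2 - (lam P k (m + 1) : ℂ) ^ 2) with hD
  have hS : Complex.sqrt D ^ 2 = D := by
    simp [Complex.sqrt]
  rw [hD] at hS ⊢
  generalize Complex.sqrt _ = S at hS ⊢
  generalize eta P k (m + 1) = η at hS ⊢
  push_cast
  field_simp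
  linear_combination hS + (P.γ : ℂ) ^ 2 * (k : ℂ) ^ 2 * (P.U : ℂ) ^ 2 *
    (4 * (P.F : ℂ) ^ 2 - (lam P k (m + 1) : ℂ) ^ 2) * Complex.I_sq

theorem charDet_mu (hF : 0 ≤ P.F) (s : ℤˣ) (k m : ℕ) :
    charDet P (mu P s k (m + 1)) (-(k : ℤ), m) = 0 := by
  rw [charDet_neg_natCast hF]
  rcases Int.units_eq_one_or s with rfl | rfl <;> simp

theorem charDet_conj_mu (hF : 0 ≤ P.F) (s : ℤˣ) (k m : ℕ) :
    charDet P ((starRingEnd ℂ) (mu P s k (m + 1))) ((k : ℤ), m) = 0 := by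
  rw [charDet_conj, charDet_mu hF, map_zero]

theorem eq_mu_of_charDet (hF : 0 ≤ P.F) {z : ℂ} {k m : ℕ} (h : charDet P z (-(k : ℤ), m) = 0) :
    ∃ s : ℤˣ, z = mu P s k (m + 1) := by
  rw [charDet_neg_natCast hF, mul_eq_zero, sub_eq_zero, sub_eq_zero] at h
  rcases h with h | h
  · exact ⟨1, h⟩
  · exact ⟨-1, h⟩

/-- Nonpositive wavenumbers give `μ`; nonnegative ones give the conjugates, by the symmetry of the
blocks. -/
theorem exists_charDet_eq_zero_iff (hF : 0 ≤ P.F) (z : ℂ) : (∃ i, charDet P z i = 0) ↔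
    ∃ (s : ℤˣ) (k l : ℕ), 1 ≤ l ∧ (z = mu P s k l ∨ z = (starRingEnd ℂ) (mu P s k l)) := by
  constructor
  · rintro ⟨⟨k, m⟩, h⟩
    rcases Int.eq_nat_or_neg k with ⟨n, rfl | rfl⟩
    · have h' := charDet_conj (P := P) ((starRingEnd ℂ) z) n m
      rw [Complex.conj_conj, h] at h'
      obtain ⟨s, hs⟩ := eq_mu_of_charDet hF ((map_eq_zero _).1 h'.symm)
      exact ⟨s, n, m + 1, by omega, Or.inr (by rw [← hs, Complex.conj_conj])⟩
    · obtain ⟨s, hs⟩ := eq_mu_of_charDet hF h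
      exact ⟨s, n, m + 1, by omega, Or.inl hs⟩
  · rintro ⟨s, k, l, hl, h⟩
    obtain ⟨m, rfl⟩ : ∃ m, l = m + 1 := ⟨l - 1, by omega⟩
    rcases h with rfl | rfl
    · exact ⟨_, charDet_mu hF s k m⟩
    · exact ⟨_, charDet_conj_mu hF s k m⟩

/-! ### The real fields as combinations of complex eigenvectors. -/

theorem modeN_ne_zero {γ : ℝ} (hγ : 0 < γ) : modeN γ ≠ 0 := by
  have : 0 < √γ / Real.pi := by have := Real.pi_pos; positivity
  exact Complex.ofReal_ne_zero.2 this.ne'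

theorem ofReal_sin_mul (t : ℝ) : ((Real.sin t : ℝ) : ℂ) =
    (Complex.exp (Complex.I * t) - Complex.exp (-(Complex.I * t))) * (-Complex.I / 2) := by
  rw [Complex.ofReal_sin, Complex.sin, mul_comm Complex.I, neg_mul]
  ring

theorem ofReal_cos_mul (t : ℝ) : ((Real.cos t : ℝ) : ℂ) =
    (Complex.exp (Complex.I * t) + Complex.exp (-(Complex.I * t))) / 2 := by
  rw [Complex.ofReal_cos, Complex.cos, mul_comm Complex.I, neg_mul]

theorem sinMode_eq {γ : ℝ} (hγ : 0 < γ) (k m : ℕ) : sinMode γ k (m + 1) =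
    (-Complex.I / (2 * modeN γ)) • (modeLp γ 0 ((k : ℤ), m) - modeLp γ 0 (-(k : ℤ), m)) := by
  refine Lp.ext ?_
  have hN := modeN_ne_zero hγ
  filter_upwards [(memLp_sin γ k (m + 1)).coeFn_toLp,
    Lp.coeFn_smul (-Complex.I / (2 * modeN γ)) (modeLp γ 0 ((k : ℤ), m) - modeLp γ 0 (-(k : ℤ), m)),
    Lp.coeFn_sub (modeLp γ 0 ((k : ℤ), m)) (modeLp γ 0 (-(k : ℤ), m)),
    coeFn_modeLp γ 0 ((k : ℤ), m), coeFn_modeLp γ 0 (-(k : ℤ), m)] with p h1 h2 h3 h4 h5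
  rw [sinMode, h1, h2, Pi.smul_apply, h3, Pi.sub_apply, h4, h5, Complex.ofReal_mul, ofReal_sin_mul]
  simp only [mode, modeX, modeY, CharP.cast_eq_zero, zero_mul, add_zero, smul_eq_mul]
  push_cast
  field_simp

theorem cosMode_eq {γ : ℝ} (hγ : 0 < γ) (k m : ℕ) : cosMode γ k (m + 1) =
    (1 / (2 * modeN γ)) • (modeLp γ 0 ((k : ℤ), m) + modeLp γ 0 (-(k : ℤ), m)) := by
  refine Lp.ext ?_
  have hN := modeN_ne_zero hγ
  filter_upwards [(memLp_cos γ k (m + 1)).coeFn_toLp,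
    Lp.coeFn_smul (1 / (2 * modeN γ)) (modeLp γ 0 ((k : ℤ), m) + modeLp γ 0 (-(k : ℤ), m)),
    Lp.coeFn_add (modeLp γ 0 ((k : ℤ), m)) (modeLp γ 0 (-(k : ℤ), m)),
    coeFn_modeLp γ 0 ((k : ℤ), m), coeFn_modeLp γ 0 (-(k : ℤ), m)] with p h1 h2 h3 h4 h5
  rw [cosMode, h1, h2, Pi.smul_apply, h3, Pi.add_apply, h4, h5, Complex.ofReal_mul, ofReal_cos_mul]
  simp only [mode, modeX, modeY, CharP.cast_eq_zero, zero_mul, add_zero, smul_eq_mul]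
  push_cast
  field_simp

theorem eigVec_neg_eq (s : ℤˣ) (k m : ℕ) : eigVec P (mu P s k (m + 1)) (-(k : ℤ), m) =
    ((Complex.I * ((P.γ * k * P.U : ℝ) : ℂ)) • modeLp P.γ 0 (-(k : ℤ), m),
      (mu P s k (m + 1) + eta P k (m + 1)) • modeLp P.γ 0 (-(k : ℤ), m)) := by
  rw [eigVec, m12_neg_natCast, m11_neg_natCast, sub_neg_eq_add]

theorem eigVec_pos_eq (s : ℤˣ) (k m : ℕ) :
    eigVec P ((starRingEnd ℂ) (mu P s k (m + 1))) ((k : ℤ), m) =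
    ((-Complex.I * ((P.γ * k * P.U : ℝ) : ℂ)) • modeLp P.γ 0 ((k : ℤ), m),
      (starRingEnd ℂ) (mu P s k (m + 1) + eta P k (m + 1)) • modeLp P.γ 0 ((k : ℤ), m)) := by
  rw [eigVec, m12_conj, m11_conj, m12_neg_natCast, m11_neg_natCast]
  simp only [map_mul, map_add, map_neg, Complex.conj_I, Complex.conj_ofReal, sub_neg_eq_add]

theorem real_smul_eq {γ : ℝ} (c : ℝ) (u : L2 γ × L2 γ) : c • u = (c : ℂ) • u :=
  Prod.ext (Complex.coe_smul c u.1).symm (Complex.coe_smul c u.2).symm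

/-- The two eigenvectors are complex conjugate functions, so half their sum is a real part; the case
`k = 0`, where the modes coincide, is included. -/
theorem v1_eq (hγ : 0 < P.γ) (s : ℤˣ) (k m : ℕ) : v1 P s k (m + 1) = (1 / (2 * modeN P.γ)) •
    (eigVec P (mu P s k (m + 1)) (-(k : ℤ), m) +
      eigVec P ((starRingEnd ℂ) (mu P s k (m + 1))) ((k : ℤ), m)) := by
  rw [eigVec_neg_eq, eigVec_pos_eq]
  generalize hζ : mu P s k (m + 1) + eta P k (m + 1) = ζ
  have hc : (starRingEnd ℂ) ζ = ζ.re - ζ.im * Complex.I := by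
    apply Complex.ext <;> simp
  have hr : ζ = ζ.re + ζ.im * Complex.I := (Complex.re_add_im ζ).symm
  simp only [v1, e1, e3, e4, hζ, sinMode_eq hγ, cosMode_eq hγ, real_smul_eq, hc]
  clear hζ hc
  generalize ζ.re = x at hr ⊢
  generalize ζ.im = y at hr ⊢
  rw [hr]
  generalize P.γ * (k : ℝ) * P.U = κ
  refine Prod.ext ?_ ?_
  · simp only [Prod.smul_mk, Prod.mk_add_mk, smul_zero, add_zero]
    module
  · simp only [Prod.smul_mk, Prod.mk_add_mk, smul_zero, zero_add]
    module

/-- The corresponding imaginary part. -/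
theorem v2_eq (hγ : 0 < P.γ) (s : ℤˣ) (k m : ℕ) : v2 P s k (m + 1) =
    (-Complex.I / (2 * modeN P.γ)) • (eigVec P (mu P s k (m + 1)) (-(k : ℤ), m) -
      eigVec P ((starRingEnd ℂ) (mu P s k (m + 1))) ((k : ℤ), m)) := by
  rw [eigVec_neg_eq, eigVec_pos_eq]
  generalize hζ : mu P s k (m + 1) + eta P k (m + 1) = ζ
  have hc : (starRingEnd ℂ) ζ = ζ.re - ζ.im * Complex.I := by
    apply Complex.ext <;> simp
  have hr : ζ = ζ.re + ζ.im * Complex.I := (Complex.re_add_im ζ).symm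
  simp only [v2, e2, e3, e4, hζ, sinMode_eq hγ, cosMode_eq hγ, real_smul_eq, hc]
  clear hζ hc
  generalize ζ.re = x at hr ⊢
  generalize ζ.im = y at hr ⊢
  rw [hr]
  generalize P.γ * (k : ℝ) * P.U = κ
  refine Prod.ext ?_ ?_
  · simp only [Prod.smul_mk, Prod.mk_add_mk, Prod.mk_sub_mk, smul_zero, add_zero, sub_zero]
    match_scalars <;> linear_combination (κ / (2 * modeN P.γ) : ℂ) * Complex.I_sq
  · simp only [Prod.smul_mk, Prod.mk_add_mk, Prod.mk_sub_mk, smul_zero, zero_add]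
    match_scalars <;> linear_combination (y / (2 * modeN P.γ) : ℂ) * Complex.I_sq

end

/-! ### Action of `L` on the real fields, dimension and independence. -/

section

variable {P : Params}

theorem v1_mem_domL (hγ : 0 < P.γ) (s : ℤˣ) (k m : ℕ) : v1 P s k (m + 1) ∈ domL P.γ := by
  rw [v1_eq hγ]
  exact smul_mem_domL hγ _ (add_mem_domL hγ (eigVec_mem_domL hγ _ _) (eigVec_mem_domL hγ _ _))

theorem v2_mem_domL (hγ : 0 < P.γ) (s : ℤˣ) (k m : ℕ) : v2 P s k (m + 1) ∈ domL P.γ := by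
  rw [v2_eq hγ, sub_eq_add_neg, ← neg_one_smul ℂ (eigVec _ _ ((k : ℤ), m))]
  exact smul_mem_domL hγ _ (add_mem_domL hγ (eigVec_mem_domL hγ _ _)
    (smul_mem_domL hγ _ (eigVec_mem_domL hγ _ _)))

theorem opL_v1 (hγ : 0 < P.γ) (hF : 0 ≤ P.F) (s : ℤˣ) (k m : ℕ) : opL P (v1 P s k (m + 1)) =
    (mu P s k (m + 1)).re • v1 P s k (m + 1) - (mu P s k (m + 1)).im • v2 P s k (m + 1) := by
  rw [real_smul_eq, real_smul_eq, v1_eq hγ, v2_eq hγ,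
    opL_smul hγ hF _ (add_mem_domL hγ (eigVec_mem_domL hγ _ _) (eigVec_mem_domL hγ _ _)),
    opL_add hγ hF (eigVec_mem_domL hγ _ _) (eigVec_mem_domL hγ _ _),
    opL_eigVec hγ hF (charDet_mu hF s k m), opL_eigVec hγ hF (charDet_conj_mu hF s k m)]
  generalize eigVec P _ (-(k : ℤ), m) = V
  generalize eigVec P _ ((k : ℤ), m) = W
  generalize mu P s k (m + 1) = μ
  have hc : (starRingEnd ℂ) μ = μ.re - μ.im * Complex.I := by
    apply Complex.ext <;> simp
  have hr : μ = μ.re + μ.im * Complex.I := (Complex.re_add_im μ).symm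
  rw [hc]
  generalize μ.re = x at hr ⊢
  generalize μ.im = y at hr ⊢
  rw [hr]
  module

theorem opL_v2 (hγ : 0 < P.γ) (hF : 0 ≤ P.F) (s : ℤˣ) (k m : ℕ) : opL P (v2 P s k (m + 1)) =
    (mu P s k (m + 1)).re • v2 P s k (m + 1) + (mu P s k (m + 1)).im • v1 P s k (m + 1) := by
  have hm := smul_mem_domL hγ (-1) (eigVec_mem_domL (P := P) hγ
    ((starRingEnd ℂ) (mu P s k (m + 1))) ((k : ℤ), m))
  rw [real_smul_eq, real_smul_eq, v1_eq hγ, v2_eq hγ, sub_eq_add_neg,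
    ← neg_one_smul ℂ (eigVec _ _ ((k : ℤ), m)),
    opL_smul hγ hF _ (add_mem_domL hγ (eigVec_mem_domL hγ _ _) hm),
    opL_add hγ hF (eigVec_mem_domL hγ _ _) hm, opL_smul hγ hF _ (eigVec_mem_domL hγ _ _),
    opL_eigVec hγ hF (charDet_mu hF s k m), opL_eigVec hγ hF (charDet_conj_mu hF s k m)]
  generalize eigVec P _ (-(k : ℤ), m) = V
  generalize eigVec P _ ((k : ℤ), m) = W
  generalize mu P s k (m + 1) = μ
  have hc : (starRingEnd ℂ) μ = μ.re - μ.im * Complex.I := by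
    apply Complex.ext <;> simp
  have hr : μ = μ.re + μ.im * Complex.I := (Complex.re_add_im μ).symm
  rw [hc]
  generalize μ.re = x at hr ⊢
  generalize μ.im = y at hr ⊢
  rw [hr]
  match_scalars <;> linear_combination (-y / (2 * modeN P.γ) : ℂ) * Complex.I_sq

theorem mem_Hkl_iff {s : ℤˣ} {k l : ℕ} {u : L2 P.γ × L2 P.γ} :
    u ∈ Hkl P s k l ↔ ∃ a b : ℝ, a • v1 P s k l + b • v2 P s k l = u :=
  Submodule.mem_span_pair

theorem mem_domL_of_mem_Hkl (hγ : 0 < P.γ) {s : ℤˣ} {k m : ℕ} {u : L2 P.γ × L2 P.γ}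
    (hu : u ∈ Hkl P s k (m + 1)) : u ∈ domL P.γ := by
  obtain ⟨a, b, rfl⟩ := mem_Hkl_iff.1 hu
  rw [real_smul_eq, real_smul_eq]
  exact add_mem_domL hγ (smul_mem_domL hγ _ (v1_mem_domL hγ s k m))
    (smul_mem_domL hγ _ (v2_mem_domL hγ s k m))

theorem opL_mem_Hkl (hγ : 0 < P.γ) (hF : 0 ≤ P.F) {s : ℤˣ} {k m : ℕ} {u : L2 P.γ × L2 P.γ}
    (hu : u ∈ Hkl P s k (m + 1)) : opL P u ∈ Hkl P s k (m + 1) := by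
  obtain ⟨a, b, rfl⟩ := mem_Hkl_iff.1 hu
  have h1 := v1_mem_domL hγ s k m
  have h2 := v2_mem_domL hγ s k m
  have m1 : v1 P s k (m + 1) ∈ Hkl P s k (m + 1) := Submodule.subset_span (by simp)
  have m2 : v2 P s k (m + 1) ∈ Hkl P s k (m + 1) := Submodule.subset_span (by simp)
  rw [real_smul_eq a, real_smul_eq b, opL_add hγ hF (smul_mem_domL hγ _ h1) (smul_mem_domL hγ _ h2),
    opL_smul hγ hF _ h1, opL_smul hγ hF _ h2, ← real_smul_eq, ← real_smul_eq, opL_v1 hγ hF,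
    opL_v2 hγ hF]
  exact add_mem (Submodule.smul_mem _ _ (sub_mem (Submodule.smul_mem _ _ m1)
    (Submodule.smul_mem _ _ m2))) (Submodule.smul_mem _ _ (add_mem (Submodule.smul_mem _ _ m2)
    (Submodule.smul_mem _ _ m1)))

/-- For `k ≥ 1` the modes `k` and `-k` differ, so the coefficient at `-k` sees only one eigenvector;
the real pair `(a, b)` enters as the complex number `a - ib`. -/
theorem coef_combination (hγ : 0 < P.γ) (s : ℤˣ) {k : ℕ} (hk : 1 ≤ k) (m : ℕ) (a b : ℝ) :
    coef P.γ (a • v1 P s k (m + 1) + b • v2 P s k (m + 1)).1 (-(k : ℤ), m) =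
        (a - b * Complex.I) * (Complex.I * ((P.γ * k * P.U : ℝ) : ℂ) / (2 * modeN P.γ)) ∧
      coef P.γ (a • v1 P s k (m + 1) + b • v2 P s k (m + 1)).2 (-(k : ℤ), m) =
        (a - b * Complex.I) * ((mu P s k (m + 1) + eta P k (m + 1)) / (2 * modeN P.γ)) := by
  have hne : ((-(k : ℤ), m) : ℤ × ℕ) ≠ ((k : ℤ), m) := fun h => by
    have := congrArg Prod.fst h
    simp only at this
    omega
  rw [v1_eq hγ, v2_eq hγ, eigVec_neg_eq, eigVec_pos_eq, real_smul_eq, real_smul_eq]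
  simp only [Prod.fst_add, Prod.snd_add, Prod.smul_fst, Prod.smul_snd, Prod.fst_sub, Prod.snd_sub,
    coef_add, coef_sub, coef_smul, coef_modeLp hγ, if_neg hne, if_true]
  constructor <;> ring

theorem coef_combination_eq_zero (hγ : 0 < P.γ) {k : ℕ} (hk : 1 ≤ k) (hU : P.U ≠ 0) {a b : ℝ}
    (h : ((a : ℂ) - b * Complex.I) * (Complex.I * ((P.γ * k * P.U : ℝ) : ℂ) / (2 * modeN P.γ)) = 0) :
    a = 0 ∧ b = 0 := by
  have hN := modeN_ne_zero hγ
  have hk' : (k : ℝ) ≠ 0 := by exact_mod_cast (by omega : k ≠ 0)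
  have h1 : Complex.I * ((P.γ * k * P.U : ℝ) : ℂ) / (2 * modeN P.γ) ≠ 0 :=
    div_ne_zero (mul_ne_zero Complex.I_ne_zero
      (Complex.ofReal_ne_zero.2 (mul_ne_zero (mul_ne_zero hγ.ne' hk') hU)))
      (mul_ne_zero two_ne_zero hN)
  have h2 := (mul_eq_zero.1 h).resolve_right h1
  exact ⟨by simpa using congrArg Complex.re h2, by simpa using congrArg Complex.im h2⟩

theorem finrank_Hkl (hγ : 0 < P.γ) (s : ℤˣ) {k : ℕ} (hk : 1 ≤ k) (m : ℕ) (hU : P.U ≠ 0) :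
    Module.finrank ℝ (Hkl P s k (m + 1)) = 2 := by
  have hli : LinearIndependent ℝ ![v1 P s k (m + 1), v2 P s k (m + 1)] := by
    rw [LinearIndependent.pair_iff]
    intro a b hab
    have h := (coef_combination hγ s hk m a b).1
    rw [hab, Prod.fst_zero, coef_zero] at h
    exact coef_combination_eq_zero hγ hk hU h.symm
  have := finrank_span_eq_card hli
  rwa [Matrix.range_cons_cons_empty, Fintype.card_fin] at this

theorem Hkl_eq_bot {s : ℤˣ} {k m : ℕ} (h : P.γ * k * P.U = 0)
    (hs : mu P s k (m + 1) + eta P k (m + 1) = 0) : Hkl P s k (m + 1) = ⊥ := by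
  rw [Hkl, v1, v2, h, hs]
  simp

/-- Equal roots mean zero discriminant. Its imaginary part is `2F²ντ`, where `η = ν + iτ` with `ν >
0` and `τ ≠ 0`, which forces `F = 0`; then its real part is `-γ²k²U²λ² ≠ 0`. -/
theorem mu_ne_of_beta_ne_zero (hγ : 0 < P.γ) (hRe : 0 < P.Re) (hr : 0 ≤ P.r) (hF : 0 ≤ P.F)
    {k : ℕ} (hk : 1 ≤ k) (m : ℕ) (hU : P.U ≠ 0) (hβ : P.β ≠ 0) :
    mu P 1 k (m + 1) ≠ mu P (-1) k (m + 1) := by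
  intro h
  have hlam : 0 < lam P k (m + 1) := by
    rw [← eig_natCast]; exact eig_pos _ _
  have hk' : (k : ℝ) ≠ 0 := by exact_mod_cast (by omega : k ≠ 0)
  have hpos : 0 < 2 * P.F + lam P k (m + 1) := by linarith
  have hne : (2 * (P.F : ℂ) + lam P k (m + 1)) ≠ 0 := by exact_mod_cast hpos.ne'
  rw [mu, mu, div_left_inj' hne] at h
  simp only [Units.val_one, Units.val_neg, Int.cast_one, Int.cast_neg] at h
  set D := (P.F : ℂ) ^ 2 * eta P k (m + 1) ^ 2 + (P.γ : ℂ) ^ 2 * (k : ℂ) ^ 2 * (P.U : ℂ) ^ 2 *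
          (4 * (P.F : ℂ) ^ 2 - (lam P k (m + 1) : ℂ) ^ 2) with hD
  have hS : Complex.sqrt D ^ 2 = D := by simp [Complex.sqrt]
  have h0 : Complex.sqrt D = 0 := by linear_combination h / 2
  rw [h0, zero_pow two_ne_zero] at hS
  set ν := 1 / P.Re * lam P k (m + 1) + P.r with hν
  set τ := P.γ * k * P.β / lam P k (m + 1) with hτ
  have hν0 : 0 < ν := by
    have : 0 < 1 / P.Re * lam P k (m + 1) := by positivity
    linarith
  have hτ0 : τ ≠ 0 := div_ne_zero (mul_ne_zero (mul_ne_zero hγ.ne' hk') hβ) hlam.ne'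
  have hD' : D = ((P.F ^ 2 * (ν ^ 2 - τ ^ 2) + P.γ ^ 2 * k ^ 2 * P.U ^ 2 *
      (4 * P.F ^ 2 - lam P k (m + 1) ^ 2) : ℝ) : ℂ) +
      ((2 * P.F ^ 2 * ν * τ : ℝ) : ℂ) * Complex.I := by
    have heta : eta P k (m + 1) = (ν : ℂ) + Complex.I * (τ : ℂ) := rfl
    rw [hD, heta]
    push_cast
    linear_combination (P.F : ℂ) ^ 2 * (τ : ℂ) ^ 2 * Complex.I_sq
  rw [hD'] at hS
  have him := congrArg Complex.im hS
  have hre := congrArg Complex.re hS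
  simp only [Complex.zero_re, Complex.zero_im, Complex.add_re, Complex.add_im, Complex.ofReal_re,
    Complex.ofReal_im, Complex.re_ofReal_mul, Complex.im_ofReal_mul, Complex.I_re, Complex.I_im,
    mul_zero, mul_one, add_zero, zero_add] at him hre
  have hF0 : P.F = 0 := by
    by_contra hne
    exact mul_ne_zero (mul_ne_zero (mul_ne_zero two_ne_zero (pow_ne_zero 2 hne)) hν0.ne') hτ0
      him.symm
  rw [hF0] at hre
  have h1 : P.γ ^ 2 * k ^ 2 * P.U ^ 2 * lam P k (m + 1) ^ 2 = 0 := by linear_combination hre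
  exact mul_ne_zero (mul_ne_zero (mul_ne_zero (pow_ne_zero 2 hγ.ne') (pow_ne_zero 2 hk'))
    (pow_ne_zero 2 hU)) (pow_ne_zero 2 hlam.ne') h1

theorem disjoint_Hkl (hγ : 0 < P.γ) (hRe : 0 < P.Re) (hr : 0 ≤ P.r) (hF : 0 ≤ P.F) (k m : ℕ)
    (h : P.β ≠ 0 ∨ mu P 1 k (m + 1) ≠ mu P (-1) k (m + 1)) :
    Disjoint (Hkl P 1 k (m + 1)) (Hkl P (-1) k (m + 1)) := by
  by_cases hκ : P.γ * k * P.U = 0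
  · have hd := charDet_neg_natCast hF (-eta P k (m + 1)) k m
    rw [charDet, m11_neg_natCast, m12_neg_natCast, hκ] at hd
    simp only [sub_self, zero_mul, Complex.ofReal_zero, mul_zero] at hd
    rcases mul_eq_zero.1 hd.symm with h' | h'
    · rw [Hkl_eq_bot hκ (s := 1) (by linear_combination -h')]
      exact disjoint_bot_left
    · rw [Hkl_eq_bot hκ (s := -1) (by linear_combination -h')]
      exact disjoint_bot_right
  · have hU : P.U ≠ 0 := fun h => hκ (by rw [h, mul_zero])
    have hk : 1 ≤ k := by
      by_contra hk
      exact hκ (by rw [show k = 0 by omega]; simp)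
    have hmu : mu P 1 k (m + 1) ≠ mu P (-1) k (m + 1) :=
      h.elim (mu_ne_of_beta_ne_zero hγ hRe hr hF hk m hU) id
    rw [Submodule.disjoint_def]
    intro u hu hu'
    obtain ⟨a, b, rfl⟩ := mem_Hkl_iff.1 hu
    obtain ⟨c, d, hcd⟩ := mem_Hkl_iff.1 hu'
    obtain ⟨p1, p2⟩ := coef_combination hγ 1 hk m a b
    obtain ⟨q1, q2⟩ := coef_combination hγ (-1) hk m c d
    rw [hcd] at q1 q2
    have h1 : (((a - c : ℝ) : ℂ) - ((b - d : ℝ) : ℂ) * Complex.I) *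
        (Complex.I * ((P.γ * k * P.U : ℝ) : ℂ) / (2 * modeN P.γ)) = 0 := by
      push_cast at p1 q1 ⊢
      linear_combination q1 - p1
    obtain ⟨hac, hbd⟩ := coef_combination_eq_zero hγ hk hU h1
    rw [sub_eq_zero] at hac hbd
    -- The first components have forced equal coefficients in both spans; the second components then
    -- differ by `(a - ib)(μ⁺ - μ⁻)` up to a nonzero factor.
    subst hac hbd
    have h2 : ((a : ℂ) - b * Complex.I) *
        ((mu P 1 k (m + 1) - mu P (-1) k (m + 1)) / (2 * modeN P.γ)) = 0 := by
      linear_combination q2 - p2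
    have h3 := (mul_eq_zero.1 h2).resolve_right
      (div_ne_zero (sub_ne_zero.2 hmu) (mul_ne_zero two_ne_zero (modeN_ne_zero hγ)))
    have ha : a = 0 := by simpa using congrArg Complex.re h3
    have hb : b = 0 := by simpa using congrArg Complex.im h3
    rw [ha, hb, zero_smul, zero_smul, add_zero]

end

end QG

end

theorem lemma5p1 (P : QG.Params) (hγ : 0 < P.γ) (hRe : 0 < P.Re) (hr : 0 ≤ P.r) (hF : 0 ≤ P.F) :
    -- the spectrum
    QG.spectrumL P =
      {z : ℂ | ∃ (s : ℤˣ) (k l : ℕ), 1 ≤ l ∧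
        (z = QG.mu P s k l ∨ z = (starRingEnd ℂ) (QG.mu P s k l))} ∧
    ∀ k l : ℕ, 1 ≤ l →
      -- invariance of the two subspaces under `L`
      (∀ s : ℤˣ, ∀ u ∈ QG.Hkl P s k l, u ∈ QG.domL P.γ ∧ QG.opL P u ∈ QG.Hkl P s k l) ∧
      -- linear independence of the two subspaces
      (P.β ≠ 0 ∨ QG.mu P 1 k l ≠ QG.mu P (-1) k l →
        Disjoint (QG.Hkl P 1 k l) (QG.Hkl P (-1) k l)) ∧
      -- their dimension
      (1 ≤ k → P.U ≠ 0 → ∀ s : ℤˣ, Module.finrank ℝ (QG.Hkl P s k l) = 2) ∧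
      -- the action of `L` on the spanning functions
      ∀ s : ℤˣ,
        QG.opL P (QG.v1 P s k l) =
          (QG.mu P s k l).re • QG.v1 P s k l - (QG.mu P s k l).im • QG.v2 P s k l ∧
        QG.opL P (QG.v2 P s k l) =
          (QG.mu P s k l).re • QG.v2 P s k l + (QG.mu P s k l).im • QG.v1 P s k l := by
  refine ⟨?_, fun k l hl => ?_⟩
  · ext z
    rw [QG.mem_spectrumL_iff hγ hRe hr hF, QG.exists_charDet_eq_zero_iff hF]
    rfl
  · obtain ⟨m, rfl⟩ : ∃ m, l = m + 1 := ⟨l - 1, by omega⟩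
    exact ⟨fun s u hu => ⟨QG.mem_domL_of_mem_Hkl hγ hu, QG.opL_mem_Hkl hγ hF hu⟩,
      QG.disjoint_Hkl hγ hRe hr hF k m, fun hk hU s => QG.finrank_Hkl hγ s hk m hU,
      fun s => ⟨QG.opL_v1 hγ hF s k m, QG.opL_v2 hγ hF s k m⟩⟩
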